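/- Theorem (Poly-time online learning). Let $G$ range over finite connected simple graphs with $n$ vertices, and let $\omega(G)$ be the clique number. For distinct vertices $u,v$ let $I(u,v)$ be the set of vertices lying on some induced path between $u$ and $v$, and let $I(u,u)=\emptyset$. A set $X\subseteq V(G)$ is m-convex if $I(u,v)\subseteq X$ for all $u,v\in X$; it is an m-halfspace if $X$ and $V(G)\setminus X$ are both m-convex. Let $\mathcal H(G)$ be the set of all m-halfspaces. For an edge $\{z,x\}$ the edge shadow is $z/x=\{y : z\in I(y,x)\}$. In realizable online learning of $\mathcal H(G)$, the learner gets $G$, and the environment fixes some $H\in\mathcal H(G)$; in each of finitely many rounds the environment presents a vertex $v$, the learner predicts a label in $\{0,1\}$, and then the true label $\mathbf 1_{v\in H}$ is revealed; a wrong prediction is a mistake. Running time is measured by steps of a unit-cost random access machine with addition and subtraction, for one fixed program that works for all graphs; a time bound holds for the preprocessing of $G$ and for each single round. 1. There is a learner that runs in time $\mathrm{poly}(n)$ and, for all $n\ge 2$, makes $O(\omega(G)\log n)$ mistakes for every $H\in\mathcal H(G)$ and every sequence of vertices. Its predictions are those of the Winnow algorithm (elimination version, promotion factor $2$, initial weights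 $1$, threshold half the number of features) with the features $\mathbf 1_{v\in z/x}$, one for each ordered pair $(z,x)$ of adjacent vertices. 2. There is a learner that runs in time $|\mathcal H(G)|\cdot\mathrm{poly}(n)$ and, for all $n\ge 1$, makes $O\bigl(\omega(G)+\log\frac{n}{\omega(G)}\bigr)$ mistakes for every $H\in\mathcal H(G)$ and every sequence of vertices. Its predictions are those of the Halving algorithm, that is, the majority vote (ties giving $1$) over all members of $\mathcal H(G)$ consistent with the labels revealed so far. Moreover $|\mathcal H(G)|\le 2^{\omega(G)}\,\mathrm{poly}(n)$, so this time is $2^{\omega(G)}\,\mathrm{poly}(n)$. 3. If $n\ge 2$, every $H\in\mathcal H(G)$ is a union of at most $\omega(G)$ edge shadows $z/x$; if $H\ne V(G)$, these can be chosen with $z\in H$ and $x\notin H$. The constants in $O(\cdot)$ and the polynomials are absolute. -/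

import Mathlib

/-! ## Monophonic convexity -/

/-- The monophonic interval `I(u,v)`: all vertices on some induced (that is, chordless) path
between `u` and `v` if `u ≠ v`; the empty set if `u = v`. -/
def mInterval {V : Type*} (G : SimpleGraph V) (u v : V) : Set V :=
  {z | u ≠ v ∧ ∃ p : G.Walk u v, p.IsPath ∧ p.IsChordless ∧ z ∈ p.support}

/-- Monophonically convex sets. -/
def MConvex {V : Type*} (G : SimpleGraph V) (X : Set V) : Prop :=
  ∀ u ∈ X, ∀ v ∈ X, mInterval G u v ⊆ X

/-- The class of all monophonic halfspaces. -/
def mHalfspaces {V : Type*} (G : SimpleGraph V) : Set (Set V) :=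
  {H | MConvex G H ∧ MConvex G Hᶜ}

/-- The monophonic shadow `u / v`. -/
def mShadow {V : Type*} (G : SimpleGraph V) (u v : V) : Set V :=
  {z | u ∈ mInterval G z v}

/-! ## Realizable online learning

A (deterministic) prediction rule maps the labelled examples seen so far, oldest first, and the
current point to a predicted label. -/

/-- The label `1_{v ∈ H}`. -/
noncomputable def label {V : Type*} (H : Set V) (v : V) : Bool :=
  open Classical in decide (v ∈ H)

/-- Prediction rules. -/
abbrev PredictionRule (V : Type*) := List (V × Bool) → V → Bool

/-- The predictions that the rule `P` makes, after the history `h`, on the points `vs` presented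
one after the other, the label in `H` of each point being revealed after its prediction. -/
noncomputable def PredictionRule.predictions {V : Type*} (P : PredictionRule V) (H : Set V) :
    List (V × Bool) → List V → List Bool
  | _, [] => []
  | h, v :: vs => P h v :: PredictionRule.predictions P H (h ++ [(v, label H v)]) vs

/-- The number of mistakes of the predictions `ys` on the points `vs` labelled by `H`. -/
noncomputable def mistakes {V : Type*} (H : Set V) (vs : List V) (ys : List Bool) : ℕ :=
  (vs.zip ys).countP (fun q => q.2 != label H q.1)

/-- The hypotheses in `𝓗` that are consistent with the labelled examples `h`. -/
def versionSpace {V : Type*} (𝓗 : Set (Set V)) (h : List (V × Bool)) : Set (Set V) :=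
  {H ∈ 𝓗 | ∀ q ∈ h, label H q.1 = q.2}

/-- Halving: the majority vote of the version space (a tie gives the label `1`). -/
noncomputable def halving {V : Type*} (𝓗 : Set (Set V)) : PredictionRule V := fun h v =>
  decide ({H ∈ versionSpace 𝓗 h | v ∉ H}.ncard ≤ {H ∈ versionSpace 𝓗 h | v ∈ H}.ncard)

open Classical in
/-- The prediction of Winnow with weights `w` on a point whose active features are `φ`: the label
`1` if the total weight of the active features exceeds half the number of features. -/
noncomputable def winnowPredict {ι : Type*} [Fintype ι] (w : ι → ℕ) (φ : ι → Prop) : Bool :=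
  decide (Fintype.card ι < 2 * ∑ i, if φ i then w i else 0)

open Classical in
/-- The update of Winnow: only after a mistake, the weights of the active features are doubled
if the true label is `1`, and set to zero if the true label is `0`. -/
noncomputable def winnowUpdate {ι : Type*} [Fintype ι] (w : ι → ℕ) (φ : ι → Prop) (y : Bool) :
    ι → ℕ := fun i =>
  if winnowPredict w φ ≠ y ∧ φ i then (if y then 2 * w i else 0) else w i

/-- The Winnow algorithm (elimination version, promotion factor two, all initial weights one),
for the Boolean features `φ v i` of a point `v`. -/
noncomputable def winnow {V ι : Type*} [Fintype ι] (φ : V → ι → Prop) : PredictionRule V :=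
  fun h v => winnowPredict (h.foldl (fun w q => winnowUpdate w (φ q.1) q.2) (fun _ => 1)) (φ v)

open Classical in
/-- Winnow on edge-shadow features: one feature for each of the two orientations `(z, x)` of each
edge, active at `v` if and only if `v ∈ z / x`. -/
noncomputable def shadowWinnow {V : Type*} [Fintype V] (G : SimpleGraph V) : PredictionRule V :=
  winnow (fun (v : V) (e : G.Dart) => v ∈ mShadow G e.fst e.snd)

/-! ## Random access machine

Programs are structured (while) programs of a random access machine. The store has registers,
and arrays with indirect addressing, all holding natural numbers; a program refers to
finitely many registers and arrays by constant names. As usual for the unit-cost criterion, the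
arithmetic is restricted to addition and truncated subtraction. Every operation costs one step. -/

/-- Machine stores: registers and arrays. -/
structure Store where
  reg : ℕ → ℕ
  arr : ℕ → ℕ → ℕ

/-- Writing a register. -/
def Store.setReg (s : Store) (x k : ℕ) : Store :=
  { s with reg := Function.update s.reg x k }

/-- Writing an array cell. -/
def Store.setArr (s : Store) (a i k : ℕ) : Store :=
  { s with arr := Function.update s.arr a (Function.update (s.arr a) i k) }

/-- Expressions: constants, registers, array cells `a[e]`, sums and truncated differences. -/
inductive Expr where
  | lit (k : ℕ)
  | reg (x : ℕ)
  | get (a : ℕ) (e : Expr)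
  | add (e f : Expr)
  | sub (e f : Expr)

/-- The value of an expression. -/
def Expr.eval (s : Store) : Expr → ℕ
  | .lit k => k
  | .reg x => s.reg x
  | .get a e => s.arr a (e.eval s)
  | .add e f => e.eval s + f.eval s
  | .sub e f => e.eval s - f.eval s

/-- The number of steps for evaluating an expression. -/
def Expr.cost : Expr → ℕ
  | .lit _ => 1
  | .reg _ => 1
  | .get _ e => e.cost + 1
  | .add e f => e.cost + f.cost + 1
  | .sub e f => e.cost + f.cost + 1

/-- Programs. -/
inductive Program where
  | skip
  | setReg (x : ℕ) (e : Expr)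
  | setArr (a : ℕ) (i e : Expr)
  | seq (c d : Program)
  | ite (e : Expr) (c d : Program)
  | while (e : Expr) (c : Program)

/-- `Exec c s t s'`: the program `c`, started in the store `s`, halts after exactly `t` steps in
the store `s'`. A condition holds if its value is nonzero. -/
inductive Exec : Program → Store → ℕ → Store → Prop
  | skip (s : Store) : Exec .skip s 1 s
  | setReg (x : ℕ) (e : Expr) (s : Store) :
      Exec (.setReg x e) s (e.cost + 1) (s.setReg x (e.eval s))
  | setArr (a : ℕ) (i e : Expr) (s : Store) :
      Exec (.setArr a i e) s (i.cost + e.cost + 1) (s.setArr a (i.eval s) (e.eval s))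
  | seq {c d : Program} {s s' s'' : Store} {t t' : ℕ}
      (hc : Exec c s t s') (hd : Exec d s' t' s'') : Exec (.seq c d) s (t + t') s''
  | ite_true {e : Expr} {c d : Program} {s s' : Store} {t : ℕ}
      (he : e.eval s ≠ 0) (hc : Exec c s t s') : Exec (.ite e c d) s (e.cost + 1 + t) s'
  | ite_false {e : Expr} {c d : Program} {s s' : Store} {t : ℕ}
      (he : e.eval s = 0) (hd : Exec d s t s') : Exec (.ite e c d) s (e.cost + 1 + t) s'
  | while_true {e : Expr} {c : Program} {s s' s'' : Store} {t t' : ℕ}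
      (he : e.eval s ≠ 0) (hc : Exec c s t s') (hw : Exec (.while e c) s' t' s'') :
      Exec (.while e c) s (e.cost + 1 + t + t') s''
  | while_false {e : Expr} {c : Program} {s : Store}
      (he : e.eval s = 0) : Exec (.while e c) s (e.cost + 1) s

/-! ## Online learners as programs -/

open Classical in
/-- The initial store for a graph `G` on `n` vertices: register `0` holds `n`, array `0` holds
the adjacency matrix row by row, and everything else is `0`. -/
noncomputable def inputStore {n : ℕ} (G : SimpleGraph (Fin n)) : Store where
  reg x := if x = 0 then n else 0
  arr a k := if a = 0 ∧ ∃ i j : Fin n, G.Adj i j ∧ k = i * n + j then 1 else 0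

/-- An online learner for graphs: a program run once on the input graph, and two programs run in
each round, the first for predicting the label of the current vertex and the second for digesting
the revealed label. The store persists between them. -/
structure OnlineLearner where
  init : Program
  predict : Program
  update : Program

/-- `A.Rounds H B s vs ys`: in the store `s`, when the vertices `vs` are presented one after the
other and labelled by `H`, the learner makes the predictions `ys` and spends at most `B` steps in
each round. At the start of a round the vertex is written to register `1`; the prediction is then
read off register `1` (it is `1` if the content is nonzero); and then the true label is written
to register `1`. -/
inductive OnlineLearner.Rounds (A : OnlineLearner) {n : ℕ} (H : Set (Fin n)) (B : ℕ) :
    Store → List (Fin n) → List Bool → Prop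
  | nil (s : Store) : OnlineLearner.Rounds A H B s [] []
  | cons {s s₁ s₂ : Store} {t₁ t₂ : ℕ} {v : Fin n} {vs : List (Fin n)} {ys : List Bool}
      (hp : Exec A.predict (s.setReg 1 v) t₁ s₁)
      (hu : Exec A.update (s₁.setReg 1 (label H v).toNat) t₂ s₂)
      (ht : t₁ + t₂ ≤ B)
      (hr : OnlineLearner.Rounds A H B s₂ vs ys) :
      OnlineLearner.Rounds A H B s (v :: vs) (decide (s₁.reg 1 ≠ 0) :: ys)

/-- `A.Plays G H B vs ys`: on the input graph `G`, when the vertices `vs` are presented one after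
the other and labelled by `H`, the learner makes the predictions `ys`, and it spends at most `B`
steps before the first round and at most `B` steps in each round. -/
def OnlineLearner.Plays (A : OnlineLearner) {n : ℕ} (G : SimpleGraph (Fin n)) (H : Set (Fin n))
    (B : ℕ) (vs : List (Fin n)) (ys : List Bool) : Prop :=
  ∃ t s, Exec A.init (inputStore G) t s ∧ t ≤ B ∧ A.Rounds H B s vs ys

/-! In a connected graph, `H` is a halfspace if and only if the vertices of `H` with a neighbour
outside form a clique, and the same holds for the complement (`mem_mHalfspaces_iff`). Indeed a
chordless path that leaves `H` and returns would contain two border vertices joined by a chord, and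
two nonadjacent border vertices are joined by a chordless path through the complement. The other
combinatorial tool is a description of the shadow z/x as a reachability set: the vertices reached
from z by walks that, after their start, avoid x and its neighbours (`mem_mShadow_iff`).

Shadows. Give every border vertex z of `H` a neighbour x outside `H`. The shadows z/x lie in `H`
because the complement is convex, and they cover `H` because every vertex of `H` is reached from the
border by a walk off the border. The border is a clique, so at most ω shadows are used. For the full
vertex set there is no border; a cyclic permutation f of a maximum clique yields the shadows k/f(k)
instead. Thus `H` is a disjunction of at most ω among at most n² features, and the potential
argument for Winnow gives the first mistake bound.

Counting. Fix an edge ab with a in `H` and b outside. The labels of the common neighbours of a and b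
determine `H` (`eq_of_agree`), and nonadjacent common neighbours have opposite labels, so the labels
on one maximal clique of common neighbours suffice. This leaves at most 2^ω halfspaces for each
ordered edge. Halving makes at most the binary logarithm of the total, and log n = log (n/ω) + log ω
gives the stated form.

Programs. Winnow needs the features active at a vertex; for each x one transitive closure yields all
shadows z/x. Halving needs a list of all halfspaces in time linear in their number. A nontrivial
halfspace is filed under its lexicographically first cut edge (a,b). For fixed (a,b) these
halfspaces are the solutions of a 2-SAT instance: the border conditions involve up to four vertices,
but comparison with the edge ab fixes the labels of enough of them (`forbidden_iff`). Once the
implications are transitively closed, every consistent partial assignment can be extended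
(`addable_or`), so assigning the variables one by one meets no dead end and never holds more rows
than there are solutions. Each round is then a single scan of the table.

Running times are read off the syntax. Only loops bounded by the register `20` may depend on the
number of halfspaces, and these are never nested, so that number enters linearly. -/

namespace SimpleGraph

variable {V : Type*} {G : SimpleGraph V}

/-! ## Chordless paths -/

/-- Prepending a vertex to a chordless path. -/
theorem Walk.isPath_isChordless_cons {u u' v : V} {h : G.Adj u u'} {p : G.Walk u' v} :
    ((Walk.cons h p).IsPath ∧ (Walk.cons h p).IsChordless) ↔
      (p.IsPath ∧ p.IsChordless) ∧ u ∉ p.support ∧ ∀ w ∈ p.support, G.Adj u w → w = u' := by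
  simp only [Walk.isChordless_iff_forall_mem_edges, Walk.cons_isPath_iff, Walk.support_cons,
    Walk.edges_cons, List.mem_cons]
  constructor
  · rintro ⟨⟨hp, hu⟩, hc⟩
    refine ⟨⟨hp, fun x y hx hy hxy => ?_⟩, hu, fun w hw huw => ?_⟩
    · rcases hc (Or.inr hx) (Or.inr hy) hxy with he | he
      · rw [Sym2.eq_iff] at he
        rcases he with ⟨rfl, rfl⟩ | ⟨rfl, rfl⟩ <;> contradiction
      · exact he
    · rcases hc (Or.inl rfl) (Or.inr hw) huw with he | he
      · rw [Sym2.eq_iff] at he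
        rcases he with ⟨_, rfl⟩ | ⟨_, rfl⟩
        · rfl
        · exact (G.loopless.irrefl _ huw).elim
      · exact (hu (p.fst_mem_support_of_mem_edges he)).elim
  · rintro ⟨⟨hp, hc⟩, hu, hw⟩
    refine ⟨⟨hp, hu⟩, ?_⟩
    rintro x y (rfl | hx) (rfl | hy) hxy
    · exact (G.loopless.irrefl _ hxy).elim
    · exact Or.inl (by rw [hw y hy hxy])
    · exact Or.inl (by rw [hw x hx hxy.symm, Sym2.eq_swap])
    · exact Or.inr (hc hx hy hxy)

theorem Walk.IsChordless.reverse {u v : V} {p : G.Walk u v} (h : p.IsChordless) :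
    p.reverse.IsChordless := by
  rw [Walk.isChordless_iff_forall_mem_edges] at h ⊢
  simpa using h

/-- A vertex adjacent to a chordless path is joined to its end by a chordless path. -/
theorem Walk.exists_isChordless_of_adj {u : V} : ∀ {u' v : V} (p : G.Walk u' v), p.IsPath →
    p.IsChordless → u ∉ p.support → (∃ w ∈ p.support, G.Adj u w) →
    ∃ q : G.Walk u v, q.IsPath ∧ q.IsChordless ∧ ∀ x ∈ q.support, x = u ∨ x ∈ p.support
  | _, _, .nil, hp, hc, hu, ⟨w, hw, huw⟩ => by
    simp only [Walk.support_nil, List.mem_singleton] at hw hu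
    subst hw
    obtain ⟨h1, h2⟩ := (Walk.isPath_isChordless_cons (h := huw) (p := .nil)).2
      ⟨⟨hp, hc⟩, by simpa using hu, by simp⟩
    exact ⟨_, h1, h2, by simp⟩
  | _, _, .cons h p, hp, hc, hu, ⟨w, hw, huw⟩ => by
    obtain ⟨⟨hp', hc'⟩, -, -⟩ := Walk.isPath_isChordless_cons.1 ⟨hp, hc⟩
    simp only [Walk.support_cons, List.mem_cons, not_or] at hu
    -- Descending as long as the tail contains a neighbour of `u` stops at the last neighbour on the
    -- path, and there prepending `u` creates no chord.
    by_cases hex : ∃ w ∈ p.support, G.Adj u w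
    · obtain ⟨q, h1, h2, h3⟩ := Walk.exists_isChordless_of_adj p hp' hc' hu.2 hex
      refine ⟨q, h1, h2, fun x hx => (h3 x hx).imp_right fun h => ?_⟩
      simp [h]
    · push Not at hex
      simp only [Walk.support_cons, List.mem_cons] at hw
      rcases hw with rfl | hw
      · obtain ⟨h1, h2⟩ := (Walk.isPath_isChordless_cons (h := huw) (p := .cons h p)).2
          ⟨⟨hp, hc⟩, by simpa using hu, by
            intro x hx hux
            simp only [Walk.support_cons, List.mem_cons] at hx
            exact hx.resolve_right fun h => hex x h hux⟩
        exact ⟨_, h1, h2, by simp⟩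
      · exact (hex w hw huw).elim

/-- A walk within a set can be replaced by a chordless path within the set. -/
theorem Walk.exists_isChordless (U : Set V) : ∀ {u v : V} (p : G.Walk u v),
    (∀ x ∈ p.support, x ∈ U) →
    ∃ q : G.Walk u v, q.IsPath ∧ q.IsChordless ∧ ∀ x ∈ q.support, x ∈ U
  | _, _, .nil, hU => ⟨.nil, by simp, by simp [Walk.isChordless_iff_forall_mem_edges], hU⟩
  | u, v, .cons (v := u') h p, hU => by
    simp only [Walk.support_cons, List.mem_cons, forall_eq_or_imp] at hU
    obtain ⟨q, h1, h2, h3⟩ := Walk.exists_isChordless U p hU.2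
    by_cases hu : u ∈ q.support
    -- If `u` already lies on `q`, the final segment of `q` from `u` on is the required path.
    · clear h hU
      induction q with
      | nil =>
        simp only [Walk.support_nil, List.mem_singleton] at hu
        subst hu
        exact ⟨.nil, h1, h2, h3⟩
      | cons h q ih =>
        rw [Walk.support_cons, List.mem_cons] at hu
        simp only [Walk.support_cons, List.mem_cons, forall_eq_or_imp] at h3
        rcases hu with rfl | hu
        · exact ⟨.cons h q, h1, h2, by simpa using h3⟩
        · obtain ⟨⟨hp', hc'⟩, -, -⟩ := Walk.isPath_isChordless_cons.1 ⟨h1, h2⟩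
          exact ih q hp' hc' h3.2 hu
    · obtain ⟨r, hr1, hr2, hr3⟩ :=
        Walk.exists_isChordless_of_adj q h1 h2 hu ⟨u', q.start_mem_support, h⟩
      refine ⟨r, hr1, hr2, fun x hx => ?_⟩
      rcases hr3 x hx with rfl | hx
      · exact hU.1
      · exact h3 x hx

/-! ## Edge shadows as reachability -/

/-- Read the path from `x`. Being chordless and containing the neighbour `z` of `x`, it must have
`z` as its second vertex, and no later vertex is adjacent to `x`. Conversely, a walk from `z` that
avoids the closed neighbourhood of `x` shortens to a chordless path, to which `x` can be prepended.
Shadows thereby become computable by transitive closure. -/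
theorem mem_mShadow_iff {z x y : V} (hzx : G.Adj z x) :
    y ∈ mShadow G z x ↔
      Relation.ReflTransGen (fun u w => G.Adj u w ∧ w ≠ x ∧ ¬ G.Adj x w) z y := by
  constructor
  · rintro ⟨hne, p, hp, hc, hz⟩
    have hp' := hp.reverse
    have hc' := hc.reverse
    have hz' : z ∈ p.reverse.support := by simpa using hz
    revert hp' hc' hz'
    cases p.reverse with
    | nil => exact (hne rfl).elim
    | @cons _ x' _ h q =>
      intro hp' hc' hz'
      obtain ⟨-, hx, hq⟩ := Walk.isPath_isChordless_cons.1 ⟨hp', hc'⟩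
      have hzq : z ∈ q.support := by
        rw [Walk.support_cons, List.mem_cons] at hz'
        exact hz'.resolve_left hzx.ne
      obtain rfl := hq z hzq hzx.symm
      have hqp : q.IsPath := hp'.of_cons
      have key : ∀ {a b : V} (q : G.Walk a b), q.IsPath → x ∉ q.support →
          (∀ w ∈ q.support, G.Adj x w → w = a) →
          Relation.ReflTransGen (fun u w => G.Adj u w ∧ w ≠ x ∧ ¬ G.Adj x w) a b := by
        intro a b q
        induction q with
        | nil => intro _ _ _; exact .refl
        | @cons a c b h q ih =>
          intro hp hx hq
          rw [Walk.cons_isPath_iff] at hp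
          simp only [Walk.support_cons, List.mem_cons, not_or, forall_eq_or_imp] at hx hq
          have hc : c ∈ q.support := q.start_mem_support
          have hcx : ¬ G.Adj x c := fun hxc => h.ne (hq.2 c hc hxc).symm
          refine .head ⟨h, fun e => hx.2 (e ▸ hc), hcx⟩ (ih hp.1 hx.2 fun w hw hxw => ?_)
          exact (hp.2 (hq.2 w hw hxw ▸ hw)).elim
      exact key q hqp hx hq
  · intro hr
    have hw : ∃ p : G.Walk z y, ∀ w ∈ p.support, w = z ∨ (w ≠ x ∧ ¬ G.Adj x w) := by
      induction hr with
      | refl => exact ⟨.nil, by simp⟩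
      | tail _ hbc ih =>
        obtain ⟨p, hp⟩ := ih
        refine ⟨p.concat hbc.1, fun w hw => ?_⟩
        rw [Walk.support_concat, List.mem_append, List.mem_singleton] at hw
        rcases hw with hw | rfl
        · exact hp w hw
        · exact Or.inr hbc.2
    obtain ⟨p, hp⟩ := hw
    obtain ⟨q, h1, h2, h3⟩ := p.exists_isChordless {w | w = z ∨ (w ≠ x ∧ ¬ G.Adj x w)} hp
    have hxq : x ∉ q.support := fun hx => (h3 x hx).elim (fun h => hzx.ne h.symm) fun h => h.1 rfl
    obtain ⟨h4, h5⟩ := (Walk.isPath_isChordless_cons (h := hzx.symm) (p := q)).2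
      ⟨⟨h1, h2⟩, hxq, fun w hw hxw => (h3 w hw).resolve_right fun h => h.2 hxw⟩
    refine ⟨?_, _, h4.reverse, h5.reverse, by simp⟩
    rintro rfl
    exact hxq q.end_mem_support

/-! ## Borders of halfspaces -/

/-- The border of a set: its vertices that have a neighbour outside. -/
def border (G : SimpleGraph V) (H : Set V) : Set V := {u ∈ H | ∃ w, w ∉ H ∧ G.Adj u w}

theorem Walk.exists_mem_border {H : Set V} : ∀ {u v : V} (p : G.Walk u v), u ∉ H → v ∈ H →
    ∃ w ∈ p.support, w ∈ G.border H
  | _, _, .nil, hu, hv => (hu hv).elim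
  | u, v, .cons (v := u') h p, hu, hv => by
    by_cases hu' : u' ∈ H
    · exact ⟨u', by simp, hu', u, hu, h.symm⟩
    · obtain ⟨w, hw, hb⟩ := Walk.exists_mem_border p hu' hv
      exact ⟨w, by simp [hw], hb⟩

/-- If the path stepped from `u` in `H` to `u'` outside, it would re-enter at a border vertex `w`.
The border is a clique, so `u` and `w` are adjacent, and chordlessness leaves only `w = u'`, which
is outside `H`. -/
theorem mConvex_of_isClique_border {H : Set V} (hb : G.IsClique (G.border H)) : MConvex G H := by
  rintro u hu v hv z ⟨-, p, hp, hc, hz⟩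
  induction p with
  | nil => simpa using (by simpa using hz : z = _) ▸ hu
  | @cons u u' v h p ih =>
    obtain ⟨⟨hp', hc'⟩, hup, hw⟩ := Walk.isPath_isChordless_cons.1 ⟨hp, hc⟩
    have hu' : u' ∈ H := by
      by_contra hu'
      obtain ⟨w, hwp, hwb⟩ := p.exists_mem_border hu' hv
      have hne : u ≠ w := fun e => hup (e ▸ hwp)
      have := hw w hwp (hb ⟨hu, u', hu', h⟩ hwb hne)
      exact hu' (this ▸ hwb.1)
    rw [Walk.support_cons, List.mem_cons] at hz
    rcases hz with rfl | hz
    · exact hu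
    · exact ih hu' hv hp' hc' hz

/-- Outer neighbours of two border vertices are joined inside the complement, by its convexity. If
the border vertices were nonadjacent, this would give a chordless path between them with interior
outside `H`, against the convexity of `H`. -/
theorem isClique_border (hG : G.Connected) {H : Set V} (hH : MConvex G H) (hc : MConvex G Hᶜ) :
    G.IsClique (G.border H) := by
  rintro a₁ ⟨ha₁, b₁, hb₁, h₁⟩ a₂ ⟨ha₂, b₂, hb₂, h₂⟩ hne
  by_contra hadj
  have hw : ∃ p : G.Walk b₁ b₂, ∀ x ∈ p.support, x ∈ Hᶜ := by
    obtain ⟨p⟩ := hG.preconnected b₁ b₂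
    obtain ⟨q, hq1, hq2, -⟩ := p.exists_isChordless Set.univ (by simp)
    -- The interval between equal vertices is empty by definition, so convexity says nothing here
    -- and the trivial walk is used.
    by_cases hb : b₁ = b₂
    · subst hb
      exact ⟨.nil, by simpa using hb₁⟩
    · exact ⟨q, fun x hx => hc b₁ hb₁ b₂ hb₂ ⟨hb, q, hq1, hq2, hx⟩⟩
  obtain ⟨p, hp⟩ := hw
  obtain ⟨q, hq1, hq2, hq3⟩ := (Walk.cons h₁ (p.concat h₂.symm)).exists_isChordless
    (insert a₁ (insert a₂ Hᶜ)) (by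
      intro x hx
      simp only [Walk.support_cons, Walk.support_concat, List.mem_cons,
        List.mem_append, List.not_mem_nil, or_false] at hx
      rcases hx with rfl | hx | rfl
      · simp
      · exact Or.inr (Or.inr (hp x hx))
      · simp)
  -- The second vertex of `q` lies in `H` by convexity; within the allowed set it could only be an
  -- end of `q` or a vertex outside `H`, and each choice is impossible.
  cases q with
  | nil => exact hne rfl
  | @cons _ c _ h q =>
    have hcU := hq3 c (by simp)
    have hcH : c ∈ H := hH a₁ ha₁ a₂ ha₂ ⟨hne, _, hq1, hq2, by simp⟩
    rcases hcU with rfl | rfl | hcU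
    · exact h.ne rfl
    · exact hadj h
    · exact hcU hcH

/-- Convexity, a condition on all induced paths, becomes a local condition on cut edges. Both the
counting and the encoding as 2-SAT rest on this form. -/
theorem mem_mHalfspaces_iff (hG : G.Connected) {H : Set V} :
    H ∈ mHalfspaces G ↔ G.IsClique (G.border H) ∧ G.IsClique (G.border Hᶜ) := by
  constructor
  · rintro ⟨h1, h2⟩
    exact ⟨isClique_border hG h1 h2, isClique_border hG h2 (by rwa [compl_compl])⟩
  · rintro ⟨h1, h2⟩
    exact ⟨mConvex_of_isClique_border h1, mConvex_of_isClique_border h2⟩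

theorem empty_mem_mHalfspaces : ∅ ∈ mHalfspaces G :=
  ⟨fun _ h => h.elim, fun _ _ _ _ _ _ => by simp⟩

theorem univ_mem_mHalfspaces : Set.univ ∈ mHalfspaces G :=
  ⟨fun _ _ _ _ _ _ => by simp, fun _ h => (h trivial).elim⟩

end SimpleGraph

namespace SimpleGraph

variable {V : Type*} {G : SimpleGraph V}

/-! ## Halfspaces as unions of edge shadows -/

theorem mShadow_subset {H : Set V} (hc : MConvex G Hᶜ) {z x : V} (hz : z ∈ H) (hx : x ∉ H) :
    mShadow G z x ⊆ H := by
  intro y hy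
  by_contra hyH
  exact hc y hyH x hx hy hz

/-- Every vertex of a nontrivial set is reached from its border through vertices off the border. -/
theorem exists_border_reflTransGen {H : Set V} : ∀ {y x : V} (_ : G.Walk y x), y ∈ H → x ∉ H →
    ∃ z ∈ G.border H,
      Relation.ReflTransGen (fun u w => G.Adj u w ∧ w ∈ H ∧ w ∉ G.border H) z y
  | _, _, .nil, hy, hx => (hx hy).elim
  | y, x, .cons (v := y') h p, hy, hx => by
    by_cases hb : y ∈ G.border H
    · exact ⟨y, hb, .refl⟩
    · have hy' : y' ∈ H := by
        by_contra hy'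
        exact hb ⟨hy, y', hy', h⟩
      obtain ⟨z, hz, hr⟩ := exists_border_reflTransGen p hy' hx
      exact ⟨z, hz, hr.tail ⟨h.symm, hy, hb⟩⟩

/-- One edge is chosen per border vertex, leading outside `H`. The bound on their number is the
clique property of the border; covering comes from walks in `H` that start at the border and then
stay off it. -/
theorem exists_shadows_of_ne_univ [Finite V] (hG : G.Connected) {H : Set V}
    (hH : H ∈ mHalfspaces G) (hne : H ≠ Set.univ) :
    ∃ S : Finset G.Dart, S.card ≤ G.cliqueNum ∧ H = (⋃ e ∈ S, mShadow G e.fst e.snd) ∧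
      ∀ e ∈ S, e.fst ∈ H ∧ e.snd ∉ H := by
  classical
  have := Fintype.ofFinite V
  have hb := ((mem_mHalfspaces_iff hG).1 hH).1
  have hex : ∀ z : G.border H, ∃ e : G.Dart, e.fst = z ∧ e.snd ∉ H := by
    rintro ⟨z, hz, x, hx, hzx⟩
    exact ⟨⟨(z, x), hzx⟩, rfl, hx⟩
  choose f hf1 hf2 using hex
  let S : Finset G.Dart := Finset.univ.image f
  have hS : ∀ e ∈ S, e.fst ∈ H ∧ e.snd ∉ H := by
    intro e he
    obtain ⟨z, -, rfl⟩ := Finset.mem_image.1 he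
    exact ⟨(hf1 z).symm ▸ z.2.1, hf2 z⟩
  refine ⟨S, ?_, ?_, hS⟩
  · have hcl : G.IsClique ((G.border H).toFinset : Set V) := by simpa using hb
    calc S.card ≤ Fintype.card (G.border H) := Finset.card_image_le
      _ = (G.border H).toFinset.card := (Set.toFinset_card _).symm
      _ ≤ G.cliqueNum := IsClique.card_le_cliqueNum (tc := hcl)
  · ext y
    simp only [Set.mem_iUnion, exists_prop]
    constructor
    · intro hy
      obtain ⟨x₀, hx₀⟩ := (Set.ne_univ_iff_exists_notMem H).1 hne
      obtain ⟨p⟩ := hG.preconnected y x₀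
      obtain ⟨z, hz, hr⟩ := exists_border_reflTransGen p hy hx₀
      refine ⟨f ⟨z, hz⟩, Finset.mem_image_of_mem _ (Finset.mem_univ _), ?_⟩
      rw [mem_mShadow_iff (f ⟨z, hz⟩).adj, hf1]
      -- A vertex of `H` off the border has no neighbour outside `H`; in particular it is not
      -- adjacent to the chosen outer end.
      refine Relation.ReflTransGen.mono (fun u w ⟨huw, hw, hwb⟩ => ⟨huw, ?_, fun h => ?_⟩) _ _ hr
      · rintro rfl
        exact hf2 _ hw
      · exact hwb ⟨hw, _, hf2 _, h.symm⟩
    · rintro ⟨e, he, hy⟩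
      exact mShadow_subset hH.2 (hS e he).1 (hS e he).2 hy

theorem exists_near_reflTransGen {K : Set V} : ∀ {y x : V} (_ : G.Walk y x), x ∈ K →
    ∃ z, (z ∈ K ∨ ∃ k ∈ K, G.Adj k z) ∧
      Relation.ReflTransGen (fun u w => G.Adj u w ∧ w ∉ K ∧ ∀ k ∈ K, ¬ G.Adj k w) z y
  | y, _, .nil, hx => ⟨y, Or.inl hx, .refl⟩
  | y, x, .cons (v := y') h p, hx => by
    by_cases hb : y ∈ K ∨ ∃ k ∈ K, G.Adj k y
    · exact ⟨y, hb, .refl⟩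
    · obtain ⟨z, hz, hr⟩ := exists_near_reflTransGen p hx
      push Not at hb
      exact ⟨z, hz, hr.tail ⟨h.symm, hb⟩⟩

/-- Let `f` permute a maximum clique `K` cyclically and use the shadows of `k` with respect to `f
k`. Every vertex is reached from some `z` in the closed neighbourhood of `K` by a walk that
afterwards avoids this neighbourhood. If `z` is in `K`, take `k = z`. Otherwise `z` is adjacent to
some but, by maximality, not to all members of `K`, so somewhere on the cycle `k` is adjacent to `z`
and `f k` is not; the walk then starts at `k` and goes through `z`. -/
theorem exists_shadows_univ [Finite V] [Nontrivial V] (hG : G.Connected) :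
    ∃ S : Finset G.Dart, S.card ≤ G.cliqueNum ∧
      Set.univ = (⋃ e ∈ S, mShadow G e.fst e.snd) := by
  classical
  have := Fintype.ofFinite V
  obtain ⟨K, hK⟩ := G.maximumClique_exists
  have hKmax := hK.isMaximalClique
  have hcl : G.IsClique (K : Set V) := hK.isClique
  obtain ⟨f, hf, -⟩ := K.exists_cycleOn
  obtain ⟨u₀, v₀, huv⟩ : ∃ u v, G.Adj u v := by
    obtain ⟨u⟩ := hG.nonempty
    obtain ⟨v, hv⟩ := hG.preconnected.exists_adj_of_nontrivial u
    exact ⟨u, v, hv⟩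
  have hKnt : (K : Set V).Nontrivial := by
    have h2 : ({u₀, v₀} : Finset V).card ≤ K.card :=
      hK.maximum _ (by simpa [isClique_pair] using fun _ => huv)
    rw [Finset.card_pair huv.ne] at h2
    exact Finset.one_lt_card_iff_nontrivial.1 h2
  have hadj : ∀ k : K, G.Adj k (f k) := fun k =>
    hcl k.2 (hf.apply_mem_iff.2 k.2) (hf.apply_ne hKnt k.2).symm
  let S : Finset G.Dart := Finset.univ.image fun k : K => ⟨(k, f k), hadj k⟩
  refine ⟨S, ?_, ?_⟩
  · calc S.card ≤ Fintype.card K := Finset.card_image_le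
      _ = K.card := Fintype.card_coe K
      _ ≤ G.cliqueNum := IsClique.card_le_cliqueNum (tc := hcl)
  · refine (Set.eq_univ_of_forall fun y => ?_).symm
    obtain ⟨k₀, hk₀⟩ := hKnt.nonempty
    obtain ⟨p⟩ := hG.preconnected y k₀
    obtain ⟨z, hz, hr⟩ := exists_near_reflTransGen p hk₀
    suffices h : ∃ k : K, Relation.ReflTransGen
        (fun u w => G.Adj u w ∧ w ≠ f k ∧ ¬ G.Adj (f k) w) k y by
      obtain ⟨k, hk⟩ := h
      simp only [Set.mem_iUnion, exists_prop]
      exact ⟨_, Finset.mem_image_of_mem _ (Finset.mem_univ k), (mem_mShadow_iff (hadj k)).2 hk⟩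
    have hmono : ∀ k ∈ K, Relation.ReflTransGen
        (fun u w => G.Adj u w ∧ w ≠ f k ∧ ¬ G.Adj (f k) w) z y := fun k hk =>
      Relation.ReflTransGen.mono (fun u w ⟨huw, hw, hwb⟩ => by
        have hfk := hf.apply_mem_iff.2 hk
        exact ⟨huw, fun e => hw (e ▸ hfk), hwb _ hfk⟩) _ _ hr
    by_cases hzK : z ∈ K
    · exact ⟨⟨z, hzK⟩, hmono z hzK⟩
    · obtain ⟨k₁, hk₁, hzk₁⟩ := hz.resolve_left hzK
      suffices h : ∃ k ∈ K, G.Adj k z ∧ ¬ G.Adj (f k) z by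
        obtain ⟨k, hk, h1, h2⟩ := h
        refine ⟨⟨k, hk⟩, .head ⟨h1, ?_, h2⟩ (hmono k hk)⟩
        rintro rfl
        exact hzK (hf.apply_mem_iff.2 hk)
      -- Otherwise adjacency to `z` passes from each member of `K` to its image under `f`, hence
      -- around the whole cycle, and adding `z` gives a larger clique.
      by_contra! hall
      have hadjall : ∀ k ∈ K, G.Adj k z := by
        intro k hk
        obtain ⟨m, -, rfl⟩ := hf.exists_pow_eq hk₁ hk
        have : ∀ m : ℕ, (f ^ m) k₁ ∈ K ∧ G.Adj ((f ^ m) k₁) z := by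
          intro m
          induction m with
          | zero => exact ⟨hk₁, hzk₁⟩
          | succ m ih =>
            rw [pow_succ', Equiv.Perm.mul_apply]
            exact ⟨hf.apply_mem_iff.2 ih.1, hall _ ih.1 ih.2⟩
        exact (this m).2
      have hins : G.IsClique ((insert z K : Finset V) : Set V) := by
        rw [Finset.coe_insert, isClique_insert]
        exact ⟨hcl, fun k hk _ => (hadjall k hk).symm⟩
      have := hK.maximum _ hins
      rw [Finset.card_insert_of_notMem hzK] at this
      omega

theorem exists_shadows [Finite V] [Nontrivial V] (hG : G.Connected) {H : Set V}
    (hH : H ∈ mHalfspaces G) :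
    ∃ S : Finset G.Dart, S.card ≤ G.cliqueNum ∧ H = (⋃ e ∈ S, mShadow G e.fst e.snd) ∧
      (H ≠ Set.univ → ∀ e ∈ S, e.fst ∈ H ∧ e.snd ∉ H) := by
  by_cases hne : H = Set.univ
  · subst hne
    obtain ⟨S, h1, h2⟩ := exists_shadows_univ hG
    exact ⟨S, h1, h2, fun h => (h rfl).elim⟩
  · obtain ⟨S, h1, h2, h3⟩ := exists_shadows_of_ne_univ hG hH hne
    exact ⟨S, h1, h2, fun _ => h3⟩

/-! ## The number of halfspaces -/

/-- Off the closed neighbourhoods of a cut edge, adjacent vertices have the same label. -/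
theorem mem_iff_of_adj {H : Set V} (h1 : G.IsClique (G.border H)) (h2 : G.IsClique (G.border Hᶜ))
    {a b : V} (ha : a ∈ H) (hb : b ∉ H) (hab : G.Adj a b) {u w : V} (huw : G.Adj u w)
    (hu : u ≠ a ∧ u ≠ b ∧ ¬ G.Adj a u ∧ ¬ G.Adj b u) : u ∈ H ↔ w ∈ H := by
  have haB : a ∈ G.border H := ⟨ha, b, hb, hab⟩
  have hbB : b ∈ G.border Hᶜ := ⟨hb, a, fun h => h ha, hab.symm⟩
  constructor
  · intro huH
    by_contra hw
    exact hu.2.2.1 (h1 haB ⟨huH, w, hw, huw⟩ hu.1.symm)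
  · intro hw
    by_contra huH
    exact hu.2.2.2 (h2 hbB ⟨huH, w, fun h => h hw, huw⟩ hu.2.1.symm)

/-- Halfspaces with a common cut edge are equal if they agree on the common neighbours. -/
theorem eq_of_agree (hG : G.Connected) {H H' : Set V} (hH : H ∈ mHalfspaces G)
    (hH' : H' ∈ mHalfspaces G) {a b : V} (hab : G.Adj a b) (ha : a ∈ H) (hb : b ∉ H)
    (ha' : a ∈ H') (hb' : b ∉ H')
    (h : ∀ v, G.Adj a v → G.Adj b v → (v ∈ H ↔ v ∈ H')) : H = H' := by
  obtain ⟨h1, h2⟩ := (mem_mHalfspaces_iff hG).1 hH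
  obtain ⟨h1', h2'⟩ := (mem_mHalfspaces_iff hG).1 hH'
  -- If `v` were outside `X`, then `b` and `v` would both be border vertices of the complement, by
  -- their common neighbour `a`, but they are not adjacent. The next claim is the mirror image.
  have hout : ∀ {X : Set V}, G.IsClique (G.border Xᶜ) → a ∈ X → b ∉ X →
      ∀ v, v ≠ b → G.Adj a v → ¬ G.Adj b v → v ∈ X := by
    intro X hX haX hbX v hvb hav hbv
    by_contra hv
    exact hbv (hX ⟨hbX, a, fun h => h haX, hab.symm⟩ ⟨hv, a, fun h => h haX, hav.symm⟩ hvb.symm)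
  have hin : ∀ {X : Set V}, G.IsClique (G.border X) → a ∈ X → b ∉ X →
      ∀ v, v ≠ a → G.Adj b v → ¬ G.Adj a v → v ∉ X := by
    intro X hX haX hbX v hva hbv hav hv
    exact hav (hX ⟨haX, b, hbX, hab⟩ ⟨hv, b, hbX, hbv.symm⟩ hva.symm)
  have key : ∀ {y x : V} (_ : G.Walk y x), x = a → (y ∈ H ↔ y ∈ H') := by
    intro y x p
    induction p with
    | nil => rintro rfl; exact iff_of_true ha ha'
    | @cons y y' x hyy p ih =>
      intro hx
      by_cases hya : y = a
      · subst hya; exact iff_of_true ha ha'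
      by_cases hyb : y = b
      · subst hyb; exact iff_of_false hb hb'
      by_cases hay : G.Adj a y <;> by_cases hby : G.Adj b y
      · exact h y hay hby
      · exact iff_of_true (hout h2 ha hb y hyb hay hby) (hout h2' ha' hb' y hyb hay hby)
      · exact iff_of_false (hin h1 ha hb y hya hby hay) (hin h1' ha' hb' y hya hby hay)
      -- Away from both ends of the edge, `y` has the label of its successor on the walk towards
      -- `a`, in both halfspaces.
      · rw [mem_iff_of_adj h1 h2 ha hb hab hyy ⟨hya, hyb, hay, hby⟩,
          mem_iff_of_adj h1' h2' ha' hb' hab hyy ⟨hya, hyb, hay, hby⟩]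
        exact ih hx
  ext y
  obtain ⟨p⟩ := hG.preconnected y a
  exact key p rfl

/-- Let `K` be a maximal clique of common neighbours of `a` and `b`. Any other common neighbour is
nonadjacent to some member of `K` and must have the opposite label, since vertices with the same
label would both be in the same border. So the trace on `K` determines the halfspace, and `K` has at
most ω vertices. -/
theorem ncard_separating_le [Finite V] (hG : G.Connected) {a b : V} (hab : G.Adj a b) :
    {H ∈ mHalfspaces G | a ∈ H ∧ b ∉ H}.ncard ≤ 2 ^ G.cliqueNum := by
  classical
  have := Fintype.ofFinite V
  obtain ⟨K, hKmax⟩ := (Set.toFinite {K : Finset V | G.IsClique (K : Set V) ∧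
    ∀ v ∈ K, G.Adj a v ∧ G.Adj b v}).exists_maximal ⟨∅, by simp⟩
  obtain ⟨hKc, hKn⟩ := hKmax.1
  have hcard : ((K.powerset : Finset (Finset V)) : Set (Finset V)).ncard ≤ 2 ^ G.cliqueNum := by
    rw [Set.ncard_coe_finset, Finset.card_powerset]
    exact Nat.pow_le_pow_right (by norm_num) (IsClique.card_le_cliqueNum (tc := hKc))
  refine (Set.ncard_le_ncard_of_injOn (fun H => K.filter (· ∈ H)) ?_ ?_).trans hcard
  · intro H _
    exact Finset.mem_coe.2 (Finset.mem_powerset.2 (Finset.filter_subset _ _))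
  · rintro H ⟨hH, ha, hb⟩ H' ⟨hH', ha', hb'⟩ heq
    have heqK : ∀ v ∈ K, (v ∈ H ↔ v ∈ H') := fun v hv => by
      have := congrArg (v ∈ ·) heq
      simpa [hv] using this
    have hopp : ∀ {X : Set V}, X ∈ mHalfspaces G → a ∈ X → b ∉ X → ∀ u v, u ≠ v → ¬ G.Adj u v →
        G.Adj a u → G.Adj b u → G.Adj a v → G.Adj b v → (u ∈ X ↔ v ∉ X) := by
      intro X hX haX hbX u v huv hnadj hau hbu hav hbv
      obtain ⟨h1, h2⟩ := (mem_mHalfspaces_iff hG).1 hX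
      constructor
      · intro hu hv
        exact hnadj (h1 ⟨hu, b, hbX, hbu.symm⟩ ⟨hv, b, hbX, hbv.symm⟩ huv)
      · intro hv
        by_contra hu
        exact hnadj (h2 ⟨hu, a, fun h => h haX, hau.symm⟩ ⟨hv, a, fun h => h haX, hav.symm⟩ huv)
    refine eq_of_agree hG hH hH' hab ha hb ha' hb' fun v hav hbv => ?_
    by_cases hvK : v ∈ K
    · exact heqK v hvK
    · obtain ⟨k, hk, hkv⟩ : ∃ k ∈ K, ¬ G.Adj v k := by
        by_contra! hall
        have hins : insert v K ≤ K := hKmax.2 (y := insert v K) ⟨by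
          rw [Finset.coe_insert, isClique_insert]
          exact ⟨hKc, fun k hk _ => hall k hk⟩, by
          simpa using ⟨⟨hav, hbv⟩, hKn⟩⟩ (Finset.subset_insert v K)
        exact hvK (hins (Finset.mem_insert_self v K))
      have hne : v ≠ k := fun e => hvK (e ▸ hk)
      obtain ⟨hak, hbk⟩ := hKn k hk
      rw [hopp hH ha hb v k hne hkv hav hbv hak hbk, hopp hH' ha' hb' v k hne hkv hav hbv hak hbk,
        heqK k hk]

theorem exists_adj_cut (hG : G.Connected) {H : Set V} (h1 : H ≠ ∅) (h2 : H ≠ Set.univ) :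
    ∃ a b, G.Adj a b ∧ a ∈ H ∧ b ∉ H := by
  obtain ⟨y, hy⟩ := Set.nonempty_iff_ne_empty.2 h1
  obtain ⟨x, hx⟩ := (Set.ne_univ_iff_exists_notMem H).1 h2
  obtain ⟨p⟩ := hG.preconnected x y
  obtain ⟨a, -, ha, b, hb, hab⟩ := p.exists_mem_border hx hy
  exact ⟨a, b, hab, ha, hb⟩

/-- Sum the previous bound over ordered pairs; the summand 2 accounts for the empty and the full
set, which cut no edge. -/
theorem ncard_mHalfspaces_le [Fintype V] (hG : G.Connected) :
    (mHalfspaces G).ncard ≤ 2 ^ G.cliqueNum * (Fintype.card V ^ 2 + 2) := by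
  classical
  let s : V × V → Set (Set V) := fun e =>
    if G.Adj e.1 e.2 then {H ∈ mHalfspaces G | e.1 ∈ H ∧ e.2 ∉ H} else ∅
  have hsub : mHalfspaces G ⊆ {∅, Set.univ} ∪ ⋃ e ∈ (Finset.univ : Finset (V × V)), s e := by
    intro H hH
    by_cases h1 : H = ∅
    · exact Or.inl (Or.inl h1)
    by_cases h2 : H = Set.univ
    · exact Or.inl (Or.inr h2)
    obtain ⟨a, b, hab, ha, hb⟩ := exists_adj_cut hG h1 h2
    refine Or.inr (Set.mem_iUnion₂.2 ⟨(a, b), Finset.mem_univ _, ?_⟩)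
    simp only [s, if_pos hab]
    exact ⟨hH, ha, hb⟩
  have hs : ∀ e, (s e).ncard ≤ 2 ^ G.cliqueNum := by
    intro e
    by_cases he : G.Adj e.1 e.2
    · simpa only [s, if_pos he] using ncard_separating_le hG he
    · simp [s, he]
  have hpow : 1 ≤ 2 ^ G.cliqueNum := Nat.one_le_two_pow
  calc (mHalfspaces G).ncard
      ≤ ({∅, Set.univ} ∪ ⋃ e ∈ (Finset.univ : Finset (V × V)), s e).ncard :=
        Set.ncard_le_ncard hsub (Set.toFinite _)
    _ ≤ ({∅, Set.univ} : Set (Set V)).ncard +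
        (⋃ e ∈ (Finset.univ : Finset (V × V)), s e).ncard := Set.ncard_union_le _ _
    _ ≤ 2 + ∑ e : V × V, (s e).ncard :=
        add_le_add ((Set.ncard_insert_le _ _).trans (by simp)) (Finset.set_ncard_biUnion_le _ _)
    _ ≤ 2 + ∑ e : V × V, 2 ^ G.cliqueNum := by gcongr with e; exact hs e
    _ = 2 + Fintype.card V ^ 2 * 2 ^ G.cliqueNum := by simp [sq]
    _ ≤ 2 ^ G.cliqueNum * (Fintype.card V ^ 2 + 2) := by nlinarith

end SimpleGraph

/-! ## Mistake bounds -/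

section Mistakes

variable {V : Type*}

theorem label_eq_true {H : Set V} {v : V} : label H v = true ↔ v ∈ H := by
  simp [label]

theorem mistakes_nil (H : Set V) (ys : List Bool) : mistakes H [] ys = 0 := by
  simp [mistakes]

theorem mistakes_cons (H : Set V) (v : V) (vs : List V) (y : Bool) (ys : List Bool) :
    mistakes H (v :: vs) (y :: ys) = mistakes H vs ys + if y ≠ label H v then 1 else 0 := by
  simp [mistakes, List.countP_cons]

/-- The weights of Winnow after a history. -/
noncomputable def winnowWeights {V ι : Type*} [Fintype ι] (φ : V → ι → Prop)
    (h : List (V × Bool)) : ι → ℕ :=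
  h.foldl (fun w q => winnowUpdate w (φ q.1) q.2) (fun _ => 1)

theorem winnowWeights_append {ι : Type*} [Fintype ι] (φ : V → ι → Prop) (h : List (V × Bool))
    (q : V × Bool) :
    winnowWeights φ (h ++ [q]) = winnowUpdate (winnowWeights φ h) (φ q.1) q.2 := by
  simp [winnowWeights]

/-- The potential of Winnow for the relevant features `S`. -/
noncomputable def winnowPotential {ι : Type*} [Fintype ι] (S : Finset ι) (w : ι → ℕ) : ℕ :=
  2 * Fintype.card ι * ∑ i ∈ S, (Nat.log 2 (Fintype.card ι) - Nat.log 2 (w i)) + 2 * ∑ i, w i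

open Classical in
-- Every mistake lowers the potential by at least the number N of features. On a wrong 1, more than
-- N/2 of weight is erased, and no relevant weight is touched because no relevant feature is active.
-- On a wrong 0, the active weight is at most N/2, so the weight term rises by at most N, while an
-- active relevant feature is doubled and the logarithmic term falls by at least 2N.
theorem winnowPotential_update {ι : Type*} [Fintype ι] {S : Finset ι} {w : ι → ℕ} {φ : ι → Prop}
    {y : Bool} (hw : ∀ i ∈ S, 1 ≤ w i ∧ w i ≤ Fintype.card ι) (hy : y = true ↔ ∃ i ∈ S, φ i) :
    (∀ i ∈ S, 1 ≤ winnowUpdate w φ y i ∧ winnowUpdate w φ y i ≤ Fintype.card ι) ∧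
      Fintype.card ι * (if winnowPredict w φ ≠ y then 1 else 0) +
        winnowPotential S (winnowUpdate w φ y) ≤ winnowPotential S w := by
  set N := Fintype.card ι with hN
  by_cases hp : winnowPredict w φ = y
  · have : winnowUpdate w φ y = w := by
      funext i
      simp [winnowUpdate, hp]
    rw [this]
    exact ⟨hw, by simp [hp]⟩
  cases y with
  | false =>
    have hS : ∀ i ∈ S, winnowUpdate w φ false i = w i := by
      intro i hi
      have : ¬ φ i := fun h => by simpa using hy.2 ⟨i, hi, h⟩
      simp [winnowUpdate, this]
    have hpred : N < 2 * ∑ i, if φ i then w i else 0 := by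
      simpa [winnowPredict] using hp
    refine ⟨fun i hi => by rw [hS i hi]; exact hw i hi, ?_⟩
    have hsum : ∑ i, winnowUpdate w φ false i + ∑ i, (if φ i then w i else 0) = ∑ i, w i := by
      rw [← Finset.sum_add_distrib]
      refine Finset.sum_congr rfl fun i _ => ?_
      by_cases h : φ i <;> simp [winnowUpdate, h, hp]
    have hlog : ∑ i ∈ S, (Nat.log 2 N - Nat.log 2 (winnowUpdate w φ false i)) =
        ∑ i ∈ S, (Nat.log 2 N - Nat.log 2 (w i)) :=
      Finset.sum_congr rfl fun i hi => by rw [hS i hi]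
    unfold winnowPotential
    rw [← hN, hlog, if_pos hp]
    omega
  | true =>
    obtain ⟨j, hj, hφj⟩ := hy.1 rfl
    have hpred : 2 * ∑ i, (if φ i then w i else 0) ≤ N := by
      simpa [winnowPredict] using hp
    -- A doubled weight still does not exceed N. This keeps the truncated differences of logarithms
    -- in the potential genuine.
    have hact : ∀ i, φ i → 2 * w i ≤ N := by
      intro i hi
      have : (if φ i then w i else 0) ≤ ∑ i, if φ i then w i else 0 :=
        Finset.single_le_sum (f := fun i => if φ i then w i else 0) (fun _ _ => Nat.zero_le _)
          (Finset.mem_univ i)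
      rw [if_pos hi] at this
      omega
    have hval : ∀ i, winnowUpdate w φ true i = if φ i then 2 * w i else w i := by
      intro i
      by_cases h : φ i <;> simp [winnowUpdate, h, hp]
    refine ⟨fun i hi => ?_, ?_⟩
    · rw [hval]
      have := hw i hi
      split_ifs with h
      · have := hact i h
        omega
      · exact this
    have hsum : ∑ i, winnowUpdate w φ true i = ∑ i, w i + ∑ i, (if φ i then w i else 0) := by
      rw [← Finset.sum_add_distrib]
      refine Finset.sum_congr rfl fun i _ => ?_
      rw [hval]
      split_ifs <;> omega
    have hterm : ∀ i ∈ S, φ i → Nat.log 2 N - Nat.log 2 (winnowUpdate w φ true i) + 1 ≤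
        Nat.log 2 N - Nat.log 2 (w i) := by
      intro i hi h
      have h1 : Nat.log 2 (2 * w i) = Nat.log 2 (w i) + 1 := by
        rw [mul_comm, Nat.log_mul_base (by norm_num) (by have := hw i hi; omega)]
      have h2 : Nat.log 2 (2 * w i) ≤ Nat.log 2 N := Nat.log_mono_right (hact i h)
      rw [hval, if_pos h]
      omega
    have hlog : ∑ i ∈ S, (Nat.log 2 N - Nat.log 2 (winnowUpdate w φ true i)) <
        ∑ i ∈ S, (Nat.log 2 N - Nat.log 2 (w i)) := by
      refine Finset.sum_lt_sum (fun i hi => ?_) ⟨j, hj, hterm j hj hφj⟩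
      by_cases h : φ i
      · exact (Nat.le_succ _).trans (hterm i hi h)
      · rw [hval, if_neg h]
    unfold winnowPotential
    rw [← hN, if_pos hp, hsum]
    have := Nat.mul_le_mul_left (2 * N) hlog
    rw [Nat.succ_eq_add_one, mul_add] at this
    change N * 1 + (2 * N * _ + _) ≤ 2 * N * _ + _
    omega

theorem winnow_mistakes_aux {ι : Type*} [Fintype ι] (φ : V → ι → Prop) {H : Set V} {S : Finset ι}
    (hH : ∀ v, v ∈ H ↔ ∃ i ∈ S, φ v i) : ∀ (vs : List V) (h : List (V × Bool)),
    (∀ i ∈ S, 1 ≤ winnowWeights φ h i ∧ winnowWeights φ h i ≤ Fintype.card ι) →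
    Fintype.card ι * mistakes H vs ((winnow φ).predictions H h vs) ≤
      winnowPotential S (winnowWeights φ h)
  | [], h, _ => by simp [mistakes_nil]
  | v :: vs, h, hw => by
    obtain ⟨h1, h2⟩ := winnowPotential_update (φ := φ v) (y := label H v) hw
      (label_eq_true.trans (hH v))
    rw [← winnowWeights_append φ h (v, label H v)] at h1 h2
    have ih := winnow_mistakes_aux φ hH vs _ h1
    rw [PredictionRule.predictions, mistakes_cons, mul_add]
    have : winnow φ h v = winnowPredict (winnowWeights φ h) (φ v) := rfl
    rw [this]
    omega

/-- The mistake bound of Winnow for a disjunction of the features in `S`. -/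
theorem winnow_mistakes_le {ι : Type*} [Fintype ι] [Nonempty ι] (φ : V → ι → Prop) {H : Set V}
    {S : Finset ι} (hH : ∀ v, v ∈ H ↔ ∃ i ∈ S, φ v i) (vs : List V) :
    mistakes H vs ((winnow φ).predictions H [] vs) ≤
      2 * (S.card * Nat.log 2 (Fintype.card ι)) + 2 := by
  have hN : 0 < Fintype.card ι := Fintype.card_pos
  have h := winnow_mistakes_aux φ hH vs [] (fun i _ => ⟨le_rfl, hN⟩)
  -- With unit weights the logarithms vanish and the total weight is the number of features.
  have hpot : winnowPotential S (winnowWeights φ []) =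
      Fintype.card ι * (2 * (S.card * Nat.log 2 (Fintype.card ι)) + 2) := by
    simp [winnowPotential, winnowWeights]
    ring
  rw [hpot] at h
  exact Nat.le_of_mul_le_mul_left h hN

/-! ### Halving -/

theorem versionSpace_append (𝓗 : Set (Set V)) (h : List (V × Bool)) (v : V) (y : Bool) :
    versionSpace 𝓗 (h ++ [(v, y)]) = {H ∈ versionSpace 𝓗 h | label H v = y} := by
  ext H
  simp only [versionSpace, List.mem_append, List.mem_singleton, Set.mem_ofPred_eq]
  constructor
  · rintro ⟨h1, h2⟩
    exact ⟨⟨h1, fun q hq => h2 q (Or.inl hq)⟩, h2 _ (Or.inr rfl)⟩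
  · rintro ⟨⟨h1, h2⟩, h3⟩
    refine ⟨h1, ?_⟩
    rintro q (hq | rfl)
    · exact h2 q hq
    · exact h3

/-- A mistake means that at least half of the version space voted wrongly and is discarded, while
the target always survives. -/
theorem halving_mistakes_aux [Finite V] (𝓗 : Set (Set V)) {H : Set V} : ∀ (vs : List V)
    (h : List (V × Bool)), H ∈ versionSpace 𝓗 h →
    2 ^ mistakes H vs ((halving 𝓗).predictions H h vs) ≤ (versionSpace 𝓗 h).ncard
  | [], h, hH => by
    rw [mistakes_nil, pow_zero, Nat.one_le_iff_ne_zero, ← Nat.pos_iff_ne_zero, Set.ncard_pos]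
    exact ⟨H, hH⟩
  | v :: vs, h, hH => by
    have hH' : H ∈ versionSpace 𝓗 (h ++ [(v, label H v)]) := by
      rw [versionSpace_append]
      exact ⟨hH, rfl⟩
    have ih := halving_mistakes_aux 𝓗 vs _ hH'
    rw [PredictionRule.predictions, mistakes_cons]
    have hle : (versionSpace 𝓗 (h ++ [(v, label H v)])).ncard ≤ (versionSpace 𝓗 h).ncard := by
      refine Set.ncard_le_ncard ?_ (Set.toFinite _)
      rw [versionSpace_append]
      exact Set.sep_subset _ _
    by_cases hp : halving 𝓗 h v = label H v
    · rw [if_neg (not_not.2 hp), add_zero]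
      exact ih.trans hle
    · rw [if_pos hp, pow_succ]
      have hsplit : {X ∈ versionSpace 𝓗 h | v ∈ X}.ncard + {X ∈ versionSpace 𝓗 h | v ∉ X}.ncard =
          (versionSpace 𝓗 h).ncard := by
        have := Set.ncard_inter_add_ncard_sdiff_eq_ncard (versionSpace 𝓗 h) {X | v ∈ X}
          (Set.toFinite _)
        exact this
      rw [versionSpace_append] at ih
      by_cases hv : v ∈ H
      · have hl : label H v = true := label_eq_true.2 hv
        rw [hl] at hp ih
        simp only [halving, decide_eq_true_eq, not_le] at hp
        simp only [label_eq_true] at ih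
        rw [hl]
        omega
      · have hl : label H v = false := by
          rw [← Bool.not_eq_true, label_eq_true]
          exact hv
        rw [hl] at hp ih
        simp only [halving, decide_eq_false_iff_not, not_not] at hp
        have hset : {X ∈ versionSpace 𝓗 h | label X v = false} =
            {X ∈ versionSpace 𝓗 h | v ∉ X} := by
          ext X
          simp [← label_eq_true]
        rw [hset] at ih
        rw [hl]
        omega

theorem halving_mistakes_le [Finite V] {𝓗 : Set (Set V)} {H : Set V} (hH : H ∈ 𝓗) (vs : List V) :
    2 ^ mistakes H vs ((halving 𝓗).predictions H [] vs) ≤ 𝓗.ncard := by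
  have h0 : versionSpace 𝓗 [] = 𝓗 := by simp [versionSpace]
  simpa only [h0] using halving_mistakes_aux 𝓗 vs [] (h0.symm ▸ hH)

end Mistakes

/-! ### The bounds for halfspaces -/

theorem SimpleGraph.Connected.one_le_cliqueNum {V : Type*} [Finite V] {G : SimpleGraph V}
    (hG : G.Connected) : 1 ≤ G.cliqueNum := by
  have := Fintype.ofFinite V
  obtain ⟨v⟩ := hG.nonempty
  have : G.IsClique (({v} : Finset V) : Set V) := by simp
  simpa using SimpleGraph.IsClique.card_le_cliqueNum (tc := this)

theorem SimpleGraph.cliqueNum_le_card {V : Type*} [Fintype V] (G : SimpleGraph V) :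
    G.cliqueNum ≤ Fintype.card V := by
  obtain ⟨s, hs⟩ := G.exists_isNClique_cliqueNum
  rw [← hs.card_eq]
  exact Finset.card_le_univ s

theorem shadowWinnow_mistakes_le {n : ℕ} {G : SimpleGraph (Fin n)} (hn : 2 ≤ n)
    (hG : G.Connected) {H : Set (Fin n)} (hH : H ∈ mHalfspaces G) (vs : List (Fin n)) :
    (mistakes H vs ((shadowWinnow G).predictions H [] vs) : ℝ) ≤
      6 / Real.log 2 * ((G.cliqueNum : ℝ) * Real.log n) := by
  classical
  have : Nontrivial (Fin n) := Fin.nontrivial_iff_two_le.2 hn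
  obtain ⟨S, hS, hHS, -⟩ := SimpleGraph.exists_shadows hG hH
  have : Nonempty G.Dart := by
    obtain ⟨u⟩ := hG.nonempty
    obtain ⟨v, hv⟩ := hG.preconnected.exists_adj_of_nontrivial u
    exact ⟨⟨(u, v), hv⟩⟩
  have hm := winnow_mistakes_le (fun (v : Fin n) (e : G.Dart) => v ∈ mShadow G e.fst e.snd)
    (H := H) (S := S) (fun v => by rw [hHS]; simp) vs
  have hcard : Fintype.card G.Dart ≤ n ^ 2 := by
    have := Fintype.card_le_of_injective (fun e : G.Dart => e.toProd)
      SimpleGraph.Dart.toProd_injective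
    simpa [sq] using this
  have hlog2 : 0 < Real.log 2 := Real.log_pos (by norm_num)
  have hlogn : Real.log 2 ≤ Real.log n :=
    Real.log_le_log (by norm_num) (by exact_mod_cast hn)
  have hlog : (Nat.log 2 (Fintype.card G.Dart) : ℝ) * Real.log 2 ≤ 2 * Real.log n := by
    have h1 : 2 ^ Nat.log 2 (Fintype.card G.Dart) ≤ n ^ 2 :=
      (Nat.pow_log_le_self 2 Fintype.card_ne_zero).trans hcard
    have h2 := Real.log_le_log (by positivity)
      (show ((2 : ℝ) ^ Nat.log 2 (Fintype.card G.Dart)) ≤ (n : ℝ) ^ 2 by exact_mod_cast h1)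
    simpa [Real.log_pow] using h2
  have hω : (1 : ℝ) ≤ G.cliqueNum := by exact_mod_cast hG.one_le_cliqueNum
  have hSω : (S.card : ℝ) ≤ G.cliqueNum := by exact_mod_cast hS
  have hm' : (mistakes H vs ((shadowWinnow G).predictions H [] vs) : ℝ) ≤
      2 * (S.card * Nat.log 2 (Fintype.card G.Dart)) + 2 := by exact_mod_cast hm
  refine hm'.trans ?_
  rw [div_mul_eq_mul_div, le_div_iff₀ hlog2]
  have h3 : (S.card : ℝ) * (Nat.log 2 (Fintype.card G.Dart) * Real.log 2) ≤
      G.cliqueNum * (2 * Real.log n) := by gcongr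
  -- The logarithm of the number of features contributes 4 to the constant 6; this inequality
  -- absorbs the additive term of Winnow's bound into the remaining 2.
  have h4 : Real.log 2 ≤ G.cliqueNum * Real.log n := by nlinarith
  nlinarith

theorem halving_mHalfspaces_mistakes_le {n : ℕ} {G : SimpleGraph (Fin n)}
    (hG : G.Connected) {H : Set (Fin n)} (hH : H ∈ mHalfspaces G) (vs : List (Fin n)) :
    (mistakes H vs ((halving (mHalfspaces G)).predictions H [] vs) : ℝ) ≤
      5 / Real.log 2 * ((G.cliqueNum : ℝ) + Real.log ((n : ℝ) / (G.cliqueNum : ℝ))) := by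
  have hm := (halving_mistakes_le hH vs).trans (SimpleGraph.ncard_mHalfspaces_le hG)
  set m := mistakes H vs ((halving (mHalfspaces G)).predictions H [] vs)
  have hω : 1 ≤ G.cliqueNum := hG.one_le_cliqueNum
  have hωn : G.cliqueNum ≤ n := by simpa using G.cliqueNum_le_card
  rw [Fintype.card_fin] at hm
  have hn : 1 ≤ n := hω.trans hωn
  -- The two extra factors of 2 come from n² + 2 ≤ 4n².
  have hm2 : (2 : ℝ) ^ m ≤ 2 ^ (G.cliqueNum + 2) * (n : ℝ) ^ 2 := by
    have : 2 ^ m ≤ 2 ^ (G.cliqueNum + 2) * n ^ 2 := by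
      refine hm.trans ?_
      rw [pow_add, mul_assoc]
      gcongr
      nlinarith
    exact_mod_cast this
  have hωR : (1 : ℝ) ≤ G.cliqueNum := by exact_mod_cast hω
  have hωnR : (G.cliqueNum : ℝ) ≤ n := by exact_mod_cast hωn
  have hn0 : (0 : ℝ) < n := by linarith
  have hlog := Real.log_le_log (by positivity) hm2
  rw [Real.log_mul (by positivity) (by positivity), Real.log_pow, Real.log_pow, Real.log_pow]
    at hlog
  have hlog2 : 0 < Real.log 2 := Real.log_pos (by norm_num)
  have hlog2' : Real.log 2 ≤ 1 := by have := Real.log_two_lt_d9; linarith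
  have hdiv : Real.log n = Real.log ((n : ℝ) / G.cliqueNum) + Real.log G.cliqueNum := by
    rw [Real.log_div (by positivity) (by positivity)]
    ring
  -- Together with `hdiv` this trades log n for log (n/ω) at the price of a multiple of ω.
  have hlogω : Real.log G.cliqueNum ≤ G.cliqueNum - 1 := Real.log_le_sub_one_of_pos (by linarith)
  have hnn : 0 ≤ Real.log ((n : ℝ) / G.cliqueNum) :=
    Real.log_nonneg (by rw [le_div_iff₀ (by linarith)]; linarith)
  rw [div_mul_eq_mul_div, le_div_iff₀ hlog2]
  push_cast at hlog
  nlinarith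

/-! ## Reasoning about programs -/

@[simp] theorem Store.setReg_reg (s : Store) (x k y : ℕ) :
    (s.setReg x k).reg y = if y = x then k else s.reg y := by
  simp [Store.setReg, Function.update_apply]

@[simp] theorem Store.setReg_arr (s : Store) (x k : ℕ) : (s.setReg x k).arr = s.arr := rfl

@[simp] theorem Store.setArr_reg (s : Store) (a i k : ℕ) : (s.setArr a i k).reg = s.reg := rfl

@[simp] theorem Store.setArr_arr (s : Store) (a i k b j : ℕ) :
    (s.setArr a i k).arr b j = if b = a ∧ j = i then k else s.arr b j := by
  by_cases h : b = a
  · subst h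
    simp [Store.setArr, Function.update_apply]
  · simp [Store.setArr, h]

attribute [simp] Expr.eval

/-- Conjunction of conditions. -/
def Expr.conj (e f : Expr) : Expr := .sub e (.sub e f)

/-- Negation of a condition. -/
def Expr.neg (e : Expr) : Expr := .sub (.lit 1) e

/-- The condition that two expressions have the same value. -/
def Expr.same (e f : Expr) : Expr := .neg (.add (.sub e f) (.sub f e))

-- With truncated subtraction, `e - (e - f)` is the minimum of the two values.
@[simp] theorem Expr.eval_conj (s : Store) (e f : Expr) :
    (Expr.conj e f).eval s = 0 ↔ e.eval s = 0 ∨ f.eval s = 0 := by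
  simp only [Expr.conj, Expr.eval]
  omega

@[simp] theorem Expr.eval_neg (s : Store) (e : Expr) :
    (Expr.neg e).eval s = 0 ↔ e.eval s ≠ 0 := by
  simp only [Expr.neg, Expr.eval]
  omega

@[simp] theorem Expr.eval_same (s : Store) (e f : Expr) :
    (Expr.same e f).eval s = 0 ↔ e.eval s ≠ f.eval s := by
  simp only [Expr.same, Expr.eval_neg, Expr.eval]
  omega

/-- The condition that the value of `e` is below that of `f`. -/
def Expr.less (e f : Expr) : Expr := .sub f e

@[simp] theorem Expr.eval_less (s : Store) (e f : Expr) :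
    (Expr.less e f).eval s = 0 ↔ f.eval s ≤ e.eval s := by
  simp only [Expr.less, Expr.eval]
  omega

/-- The matrix entry `a[r[x] + y]`, where `r` holds the offsets of the rows. -/
def Expr.entry (a r : ℕ) (x y : Expr) : Expr := .get a (.add (.get r x) y)

@[simp] theorem Expr.eval_entry (s : Store) (a r : ℕ) (x y : Expr) :
    (Expr.entry a r x y).eval s = s.arr a (s.arr r (x.eval s) + y.eval s) := rfl

namespace Program

/-- Conditional execution. -/
def when (e : Expr) (c : Program) : Program := .ite e c .skip

/-- The loop running `c` for all values of the register `x` below the value of the register `b`. -/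
def forr (x b : ℕ) (c : Program) : Program :=
  .seq (.setReg x (.lit 0))
    (.while (.sub (.reg b) (.reg x)) (.seq c (.setReg x (.add (.reg x) (.lit 1)))))

/-- The registers that a program may write. -/
def wr : Program → List ℕ
  | .skip => []
  | .setReg x _ => [x]
  | .setArr _ _ _ => []
  | .seq c d => c.wr ++ d.wr
  | .ite _ c d => c.wr ++ d.wr
  | .while _ c => c.wr

/-- The arrays that a program may write. -/
def wa : Program → List ℕ
  | .skip => []
  | .setReg _ _ => []
  | .setArr a _ _ => [a]
  | .seq c d => c.wa ++ d.wa
  | .ite _ c d => c.wa ++ d.wa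
  | .while _ c => c.wa

/-- The condition of a loop bounded by the register `20`, which counts hypotheses. -/
def isBig : Expr → Bool
  | .sub (.reg b) _ => b == 20
  | _ => false

/-- A time bound, if loops bounded by the register `20` make at most `M` iterations and all others
at most `N`. -/
def time (N M : ℕ) : Program → ℕ
  | .skip => 1
  | .setReg _ e => e.cost + 1
  | .setArr _ i e => i.cost + e.cost + 1
  | .seq c d => c.time N M + d.time N M
  | .ite e c d => e.cost + 1 + c.time N M + d.time N M
  | .while e c => ((if isBig e then M else N) + 1) * (e.cost + 1 + c.time N M)

/-- The nesting depth of loops bounded by the register `20`. -/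
def depth : Program → ℕ
  | .skip => 0
  | .setReg _ _ => 0
  | .setArr _ _ _ => 0
  | .seq c d => max c.depth d.depth
  | .ite _ c d => max c.depth d.depth
  | .while e c => c.depth + if isBig e then 1 else 0

/-- Factors of `M` multiply only through nesting, so `M` enters with the nesting depth as exponent.
Depth one gives time linear in the number of hypotheses, and `M = 0` gives a plain polynomial. -/
theorem exists_time_le : ∀ c : Program,
    ∃ p : Polynomial ℕ, ∀ N M, c.time N M ≤ (M + 1) ^ c.depth * p.eval N
  | .skip => ⟨1, by simp [time, depth]⟩
  | .setReg x e => ⟨Polynomial.C (e.cost + 1), by simp [time, depth]⟩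
  | .setArr a i e => ⟨Polynomial.C (i.cost + e.cost + 1), by simp [time, depth]⟩
  | .seq c d => by
    obtain ⟨p, hp⟩ := exists_time_le c
    obtain ⟨q, hq⟩ := exists_time_le d
    refine ⟨p + q, fun N M => ?_⟩
    rw [time, depth, Polynomial.eval_add, mul_add]
    exact add_le_add ((hp N M).trans (Nat.mul_le_mul_right _ (by gcongr <;> simp)))
      ((hq N M).trans (Nat.mul_le_mul_right _ (by gcongr <;> simp)))
  | .ite e c d => by
    obtain ⟨p, hp⟩ := exists_time_le c
    obtain ⟨q, hq⟩ := exists_time_le d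
    refine ⟨Polynomial.C (e.cost + 1) + p + q, fun N M => ?_⟩
    rw [time, depth, Polynomial.eval_add, Polynomial.eval_add, Polynomial.eval_C, mul_add, mul_add]
    refine add_le_add (add_le_add ?_ ?_) ?_
    · exact Nat.le_mul_of_pos_left _ (Nat.pow_pos (Nat.succ_pos _))
    · exact (hp N M).trans (Nat.mul_le_mul_right _ (by gcongr <;> simp))
    · exact (hq N M).trans (Nat.mul_le_mul_right _ (by gcongr <;> simp))
  | .while e c => by
    obtain ⟨p, hp⟩ := exists_time_le c
    have h1 : ∀ N M, e.cost + 1 + c.time N M ≤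
        (M + 1) ^ c.depth * (Polynomial.C (e.cost + 1) + p).eval N := fun N M => by
      rw [Polynomial.eval_add, Polynomial.eval_C, mul_add]
      exact add_le_add (Nat.le_mul_of_pos_left _ (Nat.pow_pos (Nat.succ_pos _))) (hp N M)
    by_cases hb : isBig e = true
    · refine ⟨Polynomial.C (e.cost + 1) + p, fun N M => ?_⟩
      rw [time, depth, if_pos hb, if_pos hb, pow_succ']
      rw [mul_assoc]
      exact Nat.mul_le_mul_left _ (h1 N M)
    · refine ⟨(Polynomial.X + 1) * (Polynomial.C (e.cost + 1) + p), fun N M => ?_⟩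
      rw [time, depth, if_neg hb, if_neg hb, add_zero, Polynomial.eval_mul, mul_left_comm]
      simpa using Nat.mul_le_mul_left (N + 1) (h1 N M)

end Program

/-- The stores `s` and `s'` agree off the registers and arrays written by `c`. -/
structure Frame (c : Program) (s s' : Store) : Prop where
  reg : ∀ r, r ∉ c.wr → s'.reg r = s.reg r
  arr : ∀ a, a ∉ c.wa → s'.arr a = s.arr a

/-- This allows invariants to mention only what a loop changes: the rest is recovered from the
syntactic write sets. -/
theorem Exec.frame {c : Program} {s s' : Store} {t : ℕ} (h : Exec c s t s') : Frame c s s' := by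
  induction h with
  | skip s => exact ⟨fun _ _ => rfl, fun _ _ => rfl⟩
  | setReg x e s => exact ⟨fun r hr => by simp_all [Program.wr], fun _ _ => rfl⟩
  | setArr a i e s =>
    refine ⟨fun _ _ => rfl, fun b hb => ?_⟩
    funext j
    simp_all [Program.wa]
  | seq _ _ ih1 ih2 =>
    constructor <;> intro r hr <;> simp only [Program.wr, Program.wa, List.mem_append, not_or] at hr
    · rw [ih2.reg r hr.2, ih1.reg r hr.1]
    · rw [ih2.arr r hr.2, ih1.arr r hr.1]
  | ite_true _ _ ih =>
    constructor <;> intro r hr <;> simp only [Program.wr, Program.wa, List.mem_append, not_or] at hr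
    · exact ih.reg r hr.1
    · exact ih.arr r hr.1
  | ite_false _ _ ih =>
    constructor <;> intro r hr <;> simp only [Program.wr, Program.wa, List.mem_append, not_or] at hr
    · exact ih.reg r hr.2
    · exact ih.arr r hr.2
  | while_true _ _ _ ih1 ih2 =>
    exact ⟨fun r hr => by rw [ih2.reg r hr, ih1.reg r hr], fun r hr => by
      rw [ih2.arr r hr, ih1.arr r hr]⟩
  | while_false _ => exact ⟨fun _ _ => rfl, fun _ _ => rfl⟩

/-- The program `c`, started in `s`, halts within its time bound in a store satisfying `Q`. -/
def Runs (N M : ℕ) (c : Program) (s : Store) (Q : Store → Prop) : Prop :=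
  ∃ t s', Exec c s t s' ∧ t ≤ c.time N M ∧ Q s'

namespace Runs

variable {N M : ℕ} {s : Store} {Q : Store → Prop}

theorem mono {c : Program} {P : Store → Prop} (h : Runs N M c s P)
    (hPQ : ∀ s', Frame c s s' → P s' → Q s') : Runs N M c s Q := by
  obtain ⟨t, s', h1, h2, h3⟩ := h
  exact ⟨t, s', h1, h2, hPQ s' h1.frame h3⟩

theorem skip (h : Q s) : Runs N M .skip s Q := ⟨1, s, .skip s, le_rfl, h⟩

theorem setReg {x : ℕ} {e : Expr} (h : Q (s.setReg x (e.eval s))) : Runs N M (.setReg x e) s Q :=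
  ⟨_, _, .setReg x e s, le_rfl, h⟩

theorem setArr {a : ℕ} {i e : Expr} (h : Q (s.setArr a (i.eval s) (e.eval s))) :
    Runs N M (.setArr a i e) s Q :=
  ⟨_, _, .setArr a i e s, le_rfl, h⟩

theorem seq {c d : Program} (h : Runs N M c s fun s' => Runs N M d s' Q) :
    Runs N M (.seq c d) s Q := by
  obtain ⟨t, s', h1, h2, t', s'', h3, h4, h5⟩ := h
  exact ⟨_, _, .seq h1 h3, add_le_add h2 h4, h5⟩

theorem ite {e : Expr} {c d : Program} (h1 : e.eval s ≠ 0 → Runs N M c s Q)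
    (h2 : e.eval s = 0 → Runs N M d s Q) : Runs N M (.ite e c d) s Q := by
  by_cases h : e.eval s = 0
  · obtain ⟨t, s', h3, h4, h5⟩ := h2 h
    refine ⟨_, _, .ite_false h h3, ?_, h5⟩
    rw [Program.time]
    omega
  · obtain ⟨t, s', h3, h4, h5⟩ := h1 h
    refine ⟨_, _, .ite_true h h3, ?_, h5⟩
    rw [Program.time]
    omega

theorem when {e : Expr} {c : Program} (h1 : e.eval s ≠ 0 → Runs N M c s Q)
    (h2 : e.eval s = 0 → Q s) : Runs N M (.when e c) s Q :=
  ite h1 fun h => skip (h2 h)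

/-- The rule for loops, with the invariant `I`. -/
theorem forr {x b : ℕ} {c : Program} (I : ℕ → Store → Prop) (hx : x ∉ c.wr) (hb : b ∉ c.wr)
    (hxb : x ≠ b) (hK : s.reg b ≤ if b = 20 then M else N) (h0 : I 0 (s.setReg x 0))
    (hs : ∀ k s₁, k < s.reg b → Frame (.forr x b c) s s₁ → s₁.reg x = k → I k s₁ →
      Runs N M c s₁ fun s₂ => I (k + 1) (s₂.setReg x (k + 1)))
    (hq : ∀ s₁, Frame (.forr x b c) s s₁ → I (s.reg b) s₁ → Q s₁) :
    Runs N M (.forr x b c) s Q := by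
  set e : Expr := .sub (.reg b) (.reg x) with he
  set d : Program := .seq c (.setReg x (.add (.reg x) (.lit 1))) with hd
  have hbig : (if Program.isBig e then M else N) = if b = 20 then M else N := by
    simp [Program.isBig, he]
  -- Induction on the number `m` of iterations still to come, with `k` already completed.
  have key : ∀ m k s₁, s.reg b = k + m → Frame (.forr x b c) s s₁ → s₁.reg x = k → I k s₁ →
      ∃ t s', Exec (.while e d) s₁ t s' ∧ t ≤ (m + 1) * (e.cost + 1 + d.time N M) ∧
        I (s.reg b) s' := by
    intro m
    induction m with
    | zero =>
      intro k s₁ hk hF hxk hI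
      have hb' : s₁.reg b = s.reg b := hF.reg b (by simp [Program.forr, Program.wr, hb, hxb.symm])
      refine ⟨_, s₁, .while_false ?_, ?_, ?_⟩
      · simp [he, hb', hxk, hk]
      · rw [zero_add, one_mul]
        exact Nat.le_add_right _ _
      · rw [hk]
        exact hI
    | succ m ih =>
      intro k s₁ hk hF hxk hI
      have hb' : s₁.reg b = s.reg b := hF.reg b (by simp [Program.forr, Program.wr, hb, hxb.symm])
      obtain ⟨t, s₂, h1, h2, h3⟩ := hs k s₁ (by omega) hF hxk hI
      have hx2 : s₂.reg x = k := by rw [h1.frame.reg x hx, hxk]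
      -- The increment costs three steps for its expression and one for the assignment.
      have hex : Exec d s₁ (t + 4) (s₂.setReg x (k + 1)) := by
        have := Exec.seq h1 (.setReg x (.add (.reg x) (.lit 1)) s₂)
        simpa [Expr.cost, hx2] using this
      have hF2 : Frame (.forr x b c) s (s₂.setReg x (k + 1)) := by
        have hF' := hex.frame
        constructor
        · intro r hr
          rw [← hF.reg r hr]
          exact hF'.reg r fun h => hr (by simpa [Program.forr, Program.wr, hd] using Or.inr h)
        · intro a ha
          rw [← hF.arr a ha]
          exact hF'.arr a fun h => ha (by simpa [Program.forr, Program.wa, hd] using h)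
      obtain ⟨t', s', h4, h5, h6⟩ := ih (k + 1) _ (by omega) hF2 (by simp) h3
      refine ⟨_, s', .while_true ?_ hex h4, ?_, h6⟩
      · simp only [he, Expr.eval, hb', hxk]
        omega
      · have : d.time N M = c.time N M + 4 := rfl
        rw [add_mul (m + 1), one_mul]
        omega
  have hF0 : Frame (.forr x b c) s (s.setReg x 0) := by
    constructor
    · intro r hr
      have : r ≠ x := fun h => hr (by simp [Program.forr, Program.wr, h])
      simp [this]
    · intro a _
      rfl
  obtain ⟨t, s', h1, h2, h3⟩ := key (s.reg b) 0 (s.setReg x 0) (by simp) hF0 (by simp) h0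
  have hexec : Exec (.forr x b c) s (2 + t) s' := .seq (.setReg x (.lit 0) s) h1
  refine ⟨_, s', hexec, ?_, hq s' hexec.frame h3⟩
  have : (Program.forr x b c).time N M =
    2 + ((if Program.isBig e then M else N) + 1) * (e.cost + 1 + d.time N M) := rfl
  rw [this, hbig]
  refine Nat.add_le_add_left (h2.trans (Nat.mul_le_mul_right _ ?_)) 2
  omega

end Runs

/-! ### Learners with an invariant -/

theorem OnlineLearner.rounds_of_invariant {n : ℕ} {A : OnlineLearner} {H : Set (Fin n)} {B : ℕ}
    {P : PredictionRule (Fin n)} (Inv : List (Fin n × Bool) → Store → Prop)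
    (hstep : ∀ h s (v : Fin n), Inv h s → ∃ t₁ s₁ t₂ s₂, Exec A.predict (s.setReg 1 v) t₁ s₁ ∧
      Exec A.update (s₁.setReg 1 (label H v).toNat) t₂ s₂ ∧ t₁ + t₂ ≤ B ∧
      decide (s₁.reg 1 ≠ 0) = P h v ∧ Inv (h ++ [(v, label H v)]) s₂) :
    ∀ (vs : List (Fin n)) (h : List (Fin n × Bool)) (s : Store), Inv h s →
      A.Rounds H B s vs (P.predictions H h vs)
  | [], _, s, _ => .nil s
  | v :: vs, h, s, hs => by
    obtain ⟨t₁, s₁, t₂, s₂, h1, h2, h3, h4, h5⟩ := hstep h s v hs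
    rw [PredictionRule.predictions, ← h4]
    exact .cons h1 h2 h3 (rounds_of_invariant Inv hstep vs _ s₂ h5)

/-! ## Matrices in memory -/

theorem mul_add_inj {K i j i' j' : ℕ} (hj : j < K) (hj' : j' < K) :
    i * K + j = i' * K + j' ↔ i = i' ∧ j = j' := by
  constructor
  · intro h
    have h1 := congrArg (· / K) h
    have h2 := congrArg (· % K) h
    have hK : 0 < K := by omega
    simp only [mul_comm _ K, Nat.mul_add_div hK, Nat.mul_add_mod, Nat.div_eq_of_lt hj,
      Nat.div_eq_of_lt hj', Nat.mod_eq_of_lt hj, Nat.mod_eq_of_lt hj', add_zero] at h1 h2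
    exact ⟨h1, h2⟩
  · rintro ⟨rfl, rfl⟩
    rfl

/-- The Boolean matrix with `K` columns stored in the array `a`. -/
def Store.ent (s : Store) (a K i j : ℕ) : Prop := s.arr a (i * K + j) ≠ 0

@[simp] theorem Store.ent_setReg (s : Store) (x k a K i j : ℕ) :
    (s.setReg x k).ent a K i j ↔ s.ent a K i j := Iff.rfl

theorem Store.ent_setArr {s : Store} {a K i j i' j' : ℕ} (hj : j < K) (hj' : j' < K) :
    (s.setArr a (i * K + j) 1).ent a K i' j' ↔ s.ent a K i' j' ∨ (i' = i ∧ j' = j) := by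
  simp only [Store.ent, Store.setArr_arr, true_and, mul_add_inj hj' hj]
  split_ifs with h <;> simp [h]

theorem Frame.trans {c d : Program} {s s₁ s₂ : Store} (h : Frame c s s₁) (h' : Frame d s₁ s₂)
    (hr : d.wr ⊆ c.wr) (ha : d.wa ⊆ c.wa) : Frame c s s₂ :=
  ⟨fun r hr' => by rw [h'.reg r fun h => hr' (hr h), h.reg r hr'], fun a ha' => by
    rw [h'.arr a fun h => ha' (ha h), h.arr a ha']⟩

attribute [simp] Program.wr Program.wa Program.forr Program.when

namespace Program

/-- Writes the multiples of the register `d` into the array `r`. -/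
def rows (r d b x : ℕ) : Program :=
  .forr x b (.setArr r (.add (.reg x) (.lit 1)) (.add (.get r (.reg x)) (.reg d)))

/-- Writes the value of `v` into those entries of the square matrix `a`, of dimension given by the
register `d`, for which the condition `e` holds. -/
def fill (a r d i j : ℕ) (e v : Expr) : Program :=
  .forr i d (.forr j d (.when e (.setArr a (.add (.get r (.reg i)) (.reg j)) v)))

/-- Replaces the square matrix in the array `2` by its transitive closure. -/
def closure (r d : ℕ) : Program :=
  .forr 11 d (.forr 12 d (.forr 13 d (.when
    (.conj (.entry 2 r (.reg 12) (.reg 11)) (.entry 2 r (.reg 11) (.reg 13)))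
    (.setArr 2 (.add (.get r (.reg 12)) (.reg 13)) (.lit 1)))))

/-- Adds to the register `x` all `v` for which the condition `e` holds. -/
def sum (x d i j : ℕ) (e v : Expr) : Program :=
  .forr i d (.forr j d (.when e (.setReg x (.add (.reg x) v))))

end Program

namespace Runs

variable {N M : ℕ} {s : Store}

/-- The machine has no multiplication, so the offsets of matrix rows are tabulated by repeated
addition, each entry being obtained from the previous one. -/
theorem rows {r d b x : ℕ} (hdx : d ≠ x) (hbx : b ≠ x) (h0 : s.arr r 0 = 0) (hb20 : b ≠ 20)
    (hb : s.reg b ≤ N) :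
    Runs N M (.rows r d b x) s fun s' => ∀ k ≤ s.reg b, s'.arr r k = k * s.reg d := by
  refine forr (fun m s₁ => ∀ k ≤ m, s₁.arr r k = k * s.reg d) (by simp) (by simp) hbx.symm
    (by simp [hb20, hb]) ?_ ?_ ?_
  · intro k hk
    obtain rfl : k = 0 := by omega
    simp [h0]
  · intro m s₁ hm hF hx hI
    refine setArr ?_
    have hd : s₁.reg d = s.reg d := hF.reg d (by simp [hdx])
    intro k hk
    simp only [Expr.eval, Store.setReg_arr, Store.setArr_arr, hx, true_and, hd]
    split_ifs with h
    · rw [h, hI m le_rfl, Nat.succ_mul]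
    · exact hI k (by omega)
  · intro s₁ _ h
    exact h

/-- When the turn of a cell comes it still holds its initial value, and the premise on `e` and `v`
may use this. Doubling the weights in place depends on it. -/
theorem fill {a r d i j : ℕ} {e v : Expr} (P : ℕ → ℕ → ℕ → Prop) (har : a ≠ r) (hij : i ≠ j)
    (hdi : d ≠ i) (hdj : d ≠ j) (hd20 : d ≠ 20) (hN : s.reg d ≤ N)
    (hr : ∀ k < s.reg d, s.arr r k = k * s.reg d)
    (he : ∀ k l s₁, k < s.reg d → l < s.reg d → Frame (.fill a r d i j e v) s s₁ → s₁.reg i = k →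
      s₁.reg j = l → s₁.arr a (k * s.reg d + l) = s.arr a (k * s.reg d + l) →
      (e.eval s₁ ≠ 0 → P k l (v.eval s₁)) ∧
      (e.eval s₁ = 0 → P k l (s.arr a (k * s.reg d + l)))) :
    Runs N M (.fill a r d i j e v) s fun s' =>
      ∀ k < s.reg d, ∀ l < s.reg d, P k l (s'.arr a (k * s.reg d + l)) := by
  set K := s.reg d with hK
  -- Cells before (k,l) in lexicographic order are finished, all others are untouched.
  let J : ℕ → ℕ → Store → Prop := fun k l s₁ => ∀ k' < K, ∀ l' < K,
    ((k' < k ∨ (k' = k ∧ l' < l)) → P k' l' (s₁.arr a (k' * K + l'))) ∧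
    (¬ (k' < k ∨ (k' = k ∧ l' < l)) → s₁.arr a (k' * K + l') = s.arr a (k' * K + l'))
  refine forr (fun m s₁ => J m 0 s₁) (by simp [hij]) (by simp [hdj]) hdi.symm
    (by simpa [hd20] using hN) (fun k _ l _ => ⟨by omega, fun _ => rfl⟩) ?_ fun s₁ _ h k hk l hl => (h k hk l hl).1 (Or.inl hk)
  intro k s₁ hk hF hi hI
  have hd1 : s₁.reg d = K := hF.reg d (by simp [hdi, hdj])
  refine forr (fun m s₂ => J k m s₂) (by simp) (by simp) hdj.symm
    (by simp [hd20, hd1, hN]) hI ?_ ?_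
  · intro l s₂ hl hF2 hj h1
    rw [hd1] at hl
    have hF' : Frame (.fill a r d i j e v) s s₂ := hF.trans hF2 (by simp) (by simp)
    have hi2 : s₂.reg i = k := by rw [hF2.reg i (by simp [hij]), hi]
    have hr2 : s₂.arr r k = k * K := by rw [hF'.arr r (by simp [Program.fill, har.symm]), hr k hk]
    have hcell := (h1 k hk l hl).2 (by omega)
    obtain ⟨he1, he2⟩ := he k l s₂ hk hl hF' hi2 hj hcell
    refine when (fun h => setArr ?_) fun h => ?_
    · intro k' hk' l' hl'
      simp only [Expr.eval, hi2, hj, hr2, Store.setReg_arr, Store.setArr_arr, true_and]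
      by_cases heq : k' = k ∧ l' = l
      · obtain ⟨rfl, rfl⟩ := heq
        rw [if_pos rfl]
        exact ⟨fun _ => he1 h, by omega⟩
      · rw [if_neg (by rwa [mul_add_inj hl' hl])]
        exact ⟨fun hlt => (h1 k' hk' l' hl').1 (by omega), fun hlt =>
          (h1 k' hk' l' hl').2 (by omega)⟩
    · intro k' hk' l' hl'
      rw [Store.setReg_arr]
      by_cases heq : k' = k ∧ l' = l
      · obtain ⟨rfl, rfl⟩ := heq
        rw [hcell]
        exact ⟨fun _ => he2 h, by omega⟩
      · exact ⟨fun hlt => (h1 k' hk' l' hl').1 (by omega), fun hlt =>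
          (h1 k' hk' l' hl').2 (by omega)⟩
  · intro s₂ hF2 h1 k' hk' l' hl'
    rw [hd1] at h1
    exact ⟨fun hlt => (h1 k' hk' l' hl').1 (by omega), fun hlt =>
      (h1 k' hk' l' hl').2 (by omega)⟩

theorem sum {x d i j : ℕ} {e v : Expr} (P : ℕ → ℕ → Prop) [∀ k l, Decidable (P k l)]
    (f : ℕ → ℕ → ℕ) (hij : i ≠ j) (hxi : x ≠ i) (hxj : x ≠ j) (hdi : d ≠ i)
    (hdj : d ≠ j) (hdx : d ≠ x) (hd20 : d ≠ 20) (hN : s.reg d ≤ N)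
    (he : ∀ k l s₁, k < s.reg d → l < s.reg d → Frame (.sum x d i j e v) s s₁ → s₁.reg i = k →
      s₁.reg j = l → (e.eval s₁ ≠ 0 ↔ P k l) ∧ (P k l → v.eval s₁ = f k l)) :
    Runs N M (.sum x d i j e v) s fun s' => s'.reg x = s.reg x +
      ∑ k ∈ Finset.range (s.reg d), ∑ l ∈ Finset.range (s.reg d), if P k l then f k l else 0 := by
  refine forr (fun m s₁ => s₁.reg x = s.reg x +
    ∑ k ∈ Finset.range m, ∑ l ∈ Finset.range (s.reg d), if P k l then f k l else 0)
    (by simp [hij, hxi.symm]) (by simp [hdj, hdx]) hdi.symm (by simp [hd20, hN]) (by simp [hxi]) ?_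
    fun _ _ h => h
  intro k s₁ hk hF hi hI
  have hd1 : s₁.reg d = s.reg d := hF.reg d (by simp [hdi, hdj, hdx])
  refine forr (fun m s₂ => s₂.reg x = s₁.reg x +
    ∑ l ∈ Finset.range m, if P k l then f k l else 0) (by simp [hxj.symm]) (by simp [hdx]) hdj.symm
    (by simp [hd20, hd1, hN]) (by simp [hxj]) ?_ ?_
  · intro l s₂ hl hF2 hj h1
    rw [hd1] at hl
    have hF' : Frame (.sum x d i j e v) s s₂ := hF.trans hF2 (by simp) (by simp)
    have hi2 : s₂.reg i = k := by rw [hF2.reg i (by simp [hij, hxi.symm]), hi]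
    obtain ⟨he1, he2⟩ := he k l s₂ hk hl hF' hi2 hj
    refine when (fun h => setReg ?_) fun h => ?_
    · have hP := he1.1 h
      simp [hxj, Finset.sum_range_succ, hP, he2 hP, h1, add_assoc]
    · have hP : ¬ P k l := fun hP => he1.2 hP h
      simp [hxj, Finset.sum_range_succ, hP, h1]
  · intro s₂ hF2 h1
    rw [hd1] at h1
    simp [hxi, Finset.sum_range_succ, h1, hI, add_assoc]

/-- Warshall's algorithm. After `m` pivots the matrix contains the given arcs, is contained in
reachability, and is transitive through every intermediate index below `m`. The diagonal must be
present at the start to account for paths of length zero. -/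
theorem closure {r d : ℕ} (hr2 : r ≠ 2) (hd : d < 11) (hN : s.reg d ≤ N)
    (hr : ∀ k < s.reg d, s.arr r k = k * s.reg d) (hrefl : ∀ k < s.reg d, s.ent 2 (s.reg d) k k) :
    Runs N M (.closure r d) s fun s' => ∀ i < s.reg d, ∀ j < s.reg d,
      (s'.ent 2 (s.reg d) i j ↔ Relation.ReflTransGen
        (fun i j => i < s.reg d ∧ j < s.reg d ∧ s.ent 2 (s.reg d) i j) i j) := by
  set K := s.reg d with hK
  set R := Relation.ReflTransGen (fun i j => i < K ∧ j < K ∧ s.ent 2 K i j) with hR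
  have hd11 : d ≠ 11 := by omega
  have hd12 : d ≠ 12 := by omega
  have hd13 : d ≠ 13 := by omega
  have hd20 : d ≠ 20 := by omega
  refine forr (fun m s₁ => (∀ i < K, ∀ j < K, s.ent 2 K i j → s₁.ent 2 K i j) ∧
    (∀ i < K, ∀ j < K, s₁.ent 2 K i j → R i j) ∧
    ∀ p < m, ∀ i < K, ∀ j < K, s₁.ent 2 K i p → s₁.ent 2 K p j → s₁.ent 2 K i j)
    (by simp) (by simp [hd12, hd13]) hd11.symm (by simpa [hd20] using hN) ?_ ?_ ?_
  · exact ⟨fun _ _ _ _ h => h, fun i hi j hj h => .single ⟨hi, hj, h⟩, by simp⟩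
  · rintro k s₁ hk hF h11 ⟨h1, h2, h3⟩
    have hd1 : s₁.reg d = K := hF.reg d (by simp [hd11, hd12, hd13])
    have hr1 : ∀ k < K, s₁.arr r k = k * K := fun k hk => by rw [hF.arr r (by simp [hr2]), hr k hk]
    let J : ℕ → ℕ → Store → Prop := fun i j s₂ =>
      (∀ i' < K, ∀ j' < K, s₁.ent 2 K i' j' → s₂.ent 2 K i' j') ∧
      (∀ i' < K, ∀ j' < K, s₂.ent 2 K i' j' →
        s₁.ent 2 K i' j' ∨ (s₁.ent 2 K i' k ∧ s₁.ent 2 K k j')) ∧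
      ∀ i' < K, ∀ j' < K, (i' < i ∨ (i' = i ∧ j' < j)) → s₁.ent 2 K i' k → s₁.ent 2 K k j' →
        s₂.ent 2 K i' j'
    have main : Runs N M (.forr 12 d (.forr 13 d (.when
        (.conj (.entry 2 r (.reg 12) (.reg 11)) (.entry 2 r (.reg 11) (.reg 13)))
        (.setArr 2 (.add (.get r (.reg 12)) (.reg 13)) (.lit 1))))) s₁ (J K 0) := by
      refine forr (fun m s₂ => J m 0 s₂) (by simp) (by simp [hd13]) hd12.symm
        (by simpa [hd20, hd1] using hN) ?_ ?_ ?_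
      · exact ⟨fun _ _ _ _ h => h, fun _ _ _ _ h => Or.inl h, by omega⟩
      · intro i s₂ hi hF2 h12 hJ
        have hd2 : s₂.reg d = K := by rw [hF2.reg d (by simp [hd12, hd13]), hd1]
        refine forr (fun m s₃ => J i m s₃) (by simp) (by simp) hd13.symm
          (by simpa [hd20, hd2] using hN) hJ ?_ ?_
        · intro j s₃ hj hF3 h13' hJ3
          rw [hd1] at hi
          rw [hd2] at hj
          obtain ⟨g1, g2, g3⟩ := hJ3
          have h12' : s₃.reg 12 = i := by rw [hF3.reg 12 (by simp), h12]
          have h11' : s₃.reg 11 = k := by rw [hF3.reg 11 (by simp), hF2.reg 11 (by simp), h11]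
          have hr3 : ∀ k < K, s₃.arr r k = k * K := fun k hk => by
            rw [hF3.arr r (by simp [hr2]), hF2.arr r (by simp [hr2]), hr1 k hk]
          -- The truth values in the row and column of the pivot do not change during its stage, so
          -- the update in place reads the same values as from a copy.
          have e1 : s₃.ent 2 K i k ↔ s₁.ent 2 K i k :=
            ⟨fun h => (g2 i hi k hk h).elim id And.left, g1 i hi k hk⟩
          have e2 : s₃.ent 2 K k j ↔ s₁.ent 2 K k j :=
            ⟨fun h => (g2 k hk j hj h).elim id And.right, g1 k hk j hj⟩
          have hc : (Expr.conj (.entry 2 r (.reg 12) (.reg 11))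
              (.entry 2 r (.reg 11) (.reg 13))).eval s₃ ≠ 0 ↔
              s₁.ent 2 K i k ∧ s₁.ent 2 K k j := by
            rw [← e1, ← e2]
            simp [Store.ent, h11', h12', h13', hr3 i hi, hr3 k hk]
          refine when (fun h => setArr ?_) fun h => ?_
          · obtain ⟨c1, c2⟩ := hc.1 h
            simp only [J, Expr.eval, h12', h13', hr3 i hi, Store.ent_setReg]
            refine ⟨fun i' hi' j' hj' h => (Store.ent_setArr hj hj').2 (Or.inl (g1 i' hi' j' hj' h)),
              fun i' hi' j' hj' h => ?_, fun i' hi' j' hj' hlt a1 a2 =>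
              (Store.ent_setArr hj hj').2 ?_⟩
            · rcases (Store.ent_setArr hj hj').1 h with h | ⟨rfl, rfl⟩
              · exact g2 i' hi' j' hj' h
              · exact Or.inr ⟨c1, c2⟩
            · by_cases heq : i' = i ∧ j' = j
              · exact Or.inr heq
              · exact Or.inl (g3 i' hi' j' hj' (by omega) a1 a2)
          · refine ⟨g1, g2, fun i' hi' j' hj' hlt a1 a2 => ?_⟩
            by_cases heq : i' = i ∧ j' = j
            · obtain ⟨rfl, rfl⟩ := heq
              exact (hc.2 ⟨a1, a2⟩ h).elim
            · exact g3 i' hi' j' hj' (by omega) a1 a2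
        · rintro s₃ hF3 ⟨g1, g2, g3⟩
          rw [hd2] at g3
          exact ⟨g1, g2, fun i' hi' j' hj' hlt => g3 i' hi' j' hj' (by omega)⟩
      · intro s₂ _ h
        rwa [hd1] at h
    refine main.mono ?_
    rintro s₂ - ⟨g1, g2, g3⟩
    have g3' : ∀ i' < K, ∀ j' < K, s₁.ent 2 K i' k → s₁.ent 2 K k j' → s₂.ent 2 K i' j' :=
      fun i' hi' j' hj' => g3 i' hi' j' hj' (Or.inl hi')
    refine ⟨fun i hi j hj h => g1 i hi j hj (h1 i hi j hj h), fun i hi j hj h => ?_, ?_⟩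
    · rcases g2 i hi j hj h with h | ⟨ha, hb⟩
      · exact h2 i hi j hj h
      · exact (h2 i hi k hk ha).trans (h2 k hk j hj hb)
    · intro p hp i hi j hj a1 a2
      change s₂.ent 2 K i j
      rcases Nat.lt_succ_iff_lt_or_eq.1 hp with hp | rfl
      · have hpK : p < K := hp.trans hk
        rcases g2 i hi p hpK a1 with b1 | ⟨b1, b2⟩ <;> rcases g2 p hpK j hj a2 with c1 | ⟨c1, c2⟩
        · exact g1 i hi j hj (h3 p hp i hi j hj b1 c1)
        · exact g3' i hi j hj (h3 p hp i hi k hk b1 c1) c2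
        · exact g3' i hi j hj b1 (h3 p hp k hk j hj b2 c1)
        · exact g3' i hi j hj b1 c2
      · refine g3' i hi j hj ?_ ?_
        · exact (g2 i hi p hk a1).elim id And.left
        · exact (g2 p hk j hj a2).elim id And.right
  · rintro s₁ - ⟨h1, h2, h3⟩ i hi j hj
    refine ⟨h2 i hi j hj, fun h => ?_⟩
    induction h with
    | refl => exact h1 i hi i hi (hrefl i hi)
    | tail _ hbc ih => exact h3 _ hbc.1 i hi _ hj (ih hbc.1) (h1 _ hbc.1 _ hj hbc.2.2)

end Runs

/-! ## The Winnow learner -/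

theorem ent_inputStore {n : ℕ} {G : SimpleGraph (Fin n)} (i j : Fin n) :
    (inputStore G).ent 0 n i j ↔ G.Adj i j := by
  simp only [Store.ent, inputStore, true_and, ne_eq, ite_eq_right_iff, one_ne_zero, imp_false,
    not_not]
  constructor
  · rintro ⟨i', j', h, heq⟩
    obtain ⟨h1, h2⟩ := (mul_add_inj j.2 j'.2).1 heq
    rwa [Fin.ext h1, Fin.ext h2]
  · exact fun h => ⟨i, j, h, rfl⟩

/-- The equality disjunct in `t` is the diagonal that the closure program requires; it is harmless
because the closure is reflexive anyway. -/
theorem reflTransGen_fin {n : ℕ} {r : Fin n → Fin n → Prop} {t : ℕ → ℕ → Prop}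
    (h : ∀ i j : Fin n, t i j ↔ i = j ∨ r i j) (i j : Fin n) :
    Relation.ReflTransGen (fun a b => a < n ∧ b < n ∧ t a b) i j ↔ Relation.ReflTransGen r i j := by
  constructor
  · intro hr
    suffices ∀ b, Relation.ReflTransGen (fun a b => a < n ∧ b < n ∧ t a b) (i : ℕ) b →
        ∀ hb : b < n, Relation.ReflTransGen r i ⟨b, hb⟩ from this j hr j.2
    intro b hb
    induction hb with
    | refl => exact fun _ => .refl
    | @tail b c _ hbc ih =>
      intro hc
      rcases (h ⟨b, hbc.1⟩ ⟨c, hc⟩).1 hbc.2.2 with heq | hr'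
      · exact heq ▸ ih hbc.1
      · exact (ih hbc.1).tail hr'
  · intro hr
    exact hr.lift (fun i : Fin n => (i : ℕ)) fun a b hab => ⟨a.2, b.2, (h a b).2 (Or.inr hab)⟩

namespace WinnowProgram

/-- Preprocessing: row offsets, initial weights, number of features. -/
def init : Program :=
  .seq (.rows 1 0 0 6) <| .seq (.fill 4 1 0 6 7 (.lit 1) (.lit 1)) <|
    .sum 2 0 6 7 (.entry 0 1 (.reg 6) (.reg 7)) (.lit 1)

/-- The arcs whose reachability gives the shadows of the edges at the vertex in register `8`. -/
def arc : Expr :=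
  .add (.same (.reg 6) (.reg 7)) (.conj (.entry 0 1 (.reg 6) (.reg 7))
    (.neg (.add (.entry 0 1 (.reg 8) (.reg 7)) (.same (.reg 8) (.reg 7)))))

/-- Computes the active features at the vertex in register `3`. -/
def active : Program :=
  .forr 8 0 <| .seq (.fill 2 1 0 6 7 (.lit 1) arc) <| .seq (.closure 1 0) <|
    .forr 6 0 (.setArr 3 (.add (.get 1 (.reg 6)) (.reg 8))
      (.conj (.entry 0 1 (.reg 6) (.reg 8)) (.entry 2 1 (.reg 6) (.reg 3))))

/-- The prediction. -/
def predict : Program :=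
  .seq (.setReg 3 (.reg 1)) <| .seq active <| .seq (.setReg 4 (.lit 0)) <|
    .seq (.sum 4 0 6 7 (.entry 3 1 (.reg 6) (.reg 7)) (.entry 4 1 (.reg 6) (.reg 7))) <|
    .seq (.setReg 5 (.sub (.add (.reg 4) (.reg 4)) (.reg 2))) (.setReg 1 (.reg 5))

/-- The update of the weights after a mistake. -/
def update : Program :=
  .when (.neg (.same (.neg (.reg 5)) (.neg (.reg 1)))) <| .ite (.reg 1)
    (.fill 4 1 0 6 7 (.entry 3 1 (.reg 6) (.reg 7))
      (.add (.entry 4 1 (.reg 6) (.reg 7)) (.entry 4 1 (.reg 6) (.reg 7))))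
    (.fill 4 1 0 6 7 (.entry 3 1 (.reg 6) (.reg 7)) (.lit 0))

variable {n : ℕ} {G : SimpleGraph (Fin n)}

/-- The store holds the graph and the row offsets. -/
structure Base (G : SimpleGraph (Fin n)) (s : Store) : Prop where
  size : s.reg 0 = n
  adj : s.arr 0 = (inputStore G).arr 0
  row : ∀ k < n, s.arr 1 k = k * n

theorem Base.ent {s : Store} (h : Base G s) (i j : Fin n) : s.ent 0 n i j ↔ G.Adj i j := by
  rw [← ent_inputStore, Store.ent, Store.ent, h.adj]

theorem Base.entry {s : Store} (h : Base G s) {a : ℕ} {x y : Expr} (hx : x.eval s < n) :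
    (Expr.entry a 1 x y).eval s = s.arr a (x.eval s * n + y.eval s) := by
  rw [Expr.eval_entry, h.row _ hx]

theorem Base.frame {s s' : Store} {c : Program} (h : Base G s) (hF : Frame c s s')
    (h0 : 0 ∉ c.wr) (ha : 0 ∉ c.wa ∧ 1 ∉ c.wa) : Base G s' :=
  ⟨by rw [hF.reg 0 h0, h.size], by rw [hF.arr 0 ha.1, h.adj], by rw [hF.arr 1 ha.2]; exact h.row⟩

/-- The features of a vertex. -/
def feature (G : SimpleGraph (Fin n)) (v : Fin n) (e : G.Dart) : Prop := v ∈ mShadow G e.fst e.snd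

/-- For each `x`, one closure of the arcs that avoid entering `x` and its neighbours decides
membership of `v` in z/x for all neighbours z at once, by `mem_mShadow_iff`. -/
theorem runs_active {s : Store} {M : ℕ} (hB : Base G s) (v : Fin n) (hv : s.reg 3 = v) :
    Runs n M active s fun s' => ∀ z x : Fin n, s'.ent 3 n z x ↔ G.Adj z x ∧ v ∈ mShadow G z x := by
  refine .forr (fun m s₁ => ∀ z x : Fin n, (x : ℕ) < m →
    (s₁.ent 3 n z x ↔ G.Adj z x ∧ v ∈ mShadow G z x))
    (by simp [Program.fill, Program.closure]) (by simp [Program.fill, Program.closure]) (by simp)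
    (by simp [hB.size]) (by simp) ?_ ?_
  · intro k s₁ hk hF h8 hI
    rw [hB.size] at hk
    have hB1 : Base G s₁ := hB.frame hF (by simp [Program.fill, Program.closure])
      (by simp [Program.fill, Program.closure])
    have hv1 : s₁.reg 3 = v := by rw [hF.reg 3 (by simp [Program.fill, Program.closure]), hv]
    let x : Fin n := ⟨k, hk⟩
    let r : Fin n → Fin n → Prop := fun u w => G.Adj u w ∧ w ≠ x ∧ ¬ G.Adj x w
    refine .seq ((Runs.fill (fun i j c => ∀ (hi : i < n) (hj : j < n),
      c ≠ 0 ↔ (⟨i, hi⟩ : Fin n) = ⟨j, hj⟩ ∨ r ⟨i, hi⟩ ⟨j, hj⟩) (by simp) (by simp) (by simp) (by simp)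
      (by simp) (by rw [hB1.size]) (by rw [hB1.size]; exact hB1.row) ?_).mono ?_)
    · intro i j s₂ hi hj hF2 h6 h7 _
      refine ⟨fun _ hi hj => ?_, fun h => by simp at h⟩
      have hB2 : Base G s₂ := hB1.frame hF2 (by simp [Program.fill]) (by simp [Program.fill])
      have h8' : s₂.reg 8 = k := by rw [hF2.reg 8 (by simp [Program.fill]), h8]
      have e1 := hB2.ent ⟨i, hi⟩ ⟨j, hj⟩
      have e2 := hB2.ent x ⟨j, hj⟩
      simp only [Store.ent] at e1 e2
      have e3 := hB2.row i hi
      have e4 := hB2.row k hk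
      have e5 : (⟨j, hj⟩ : Fin n) ≠ x ↔ j ≠ k := by simp [x]
      simp only [r, arc, ← e1, ← e2, e5, Fin.mk.injEq, x]
      simp only [Expr.eval, ne_eq, Nat.add_eq_zero_iff, Expr.eval_same, Expr.eval_conj,
        Expr.eval_neg, Expr.eval_entry, h6, h7, h8', e3, e4]
      grind
    · intro s₂ hF2 hT
      have hB2 : Base G s₂ := hB1.frame hF2 (by simp [Program.fill]) (by simp [Program.fill])
      have hT' : ∀ i j : Fin n, s₂.ent 2 n i j ↔ i = j ∨ r i j := fun i j => by
        have := hT i (by rw [hB1.size]; exact i.2) j (by rw [hB1.size]; exact j.2) i.2 j.2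
        rwa [hB1.size] at this
      refine .seq ((Runs.closure (by simp) (by simp) (by rw [hB2.size]) (by rw [hB2.size]; exact hB2.row)
        (by rw [hB2.size]; exact fun k hk => (hT' ⟨k, hk⟩ ⟨k, hk⟩).2 (Or.inl rfl))).mono ?_)
      intro s₃ hF3 hC
      rw [hB2.size] at hC
      have hB3 : Base G s₃ := hB2.frame hF3 (by simp [Program.closure]) (by simp [Program.closure])
      have hv3 : s₃.reg 3 = v := by
        rw [hF3.reg 3 (by simp [Program.closure]), hF2.reg 3 (by simp [Program.fill]), hv1]
      have h83 : s₃.reg 8 = k := by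
        rw [hF3.reg 8 (by simp [Program.closure]), hF2.reg 8 (by simp [Program.fill]), h8]
      have hI3 : ∀ z x : Fin n, (x : ℕ) < k → (s₃.ent 3 n z x ↔ G.Adj z x ∧ v ∈ mShadow G z x) := by
        intro z x hx
        rw [← hI z x hx, Store.ent, Store.ent, hF3.arr 3 (by simp [Program.closure]),
          hF2.arr 3 (by simp [Program.fill])]
      have hC' : ∀ z : Fin n, G.Adj z x → (s₃.ent 2 n z v ↔ v ∈ mShadow G z x) := by
        intro z hzx
        rw [SimpleGraph.mem_mShadow_iff hzx, hC z z.2 v v.2]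
        exact reflTransGen_fin hT' z v
      refine .forr (fun m s₄ => ∀ z x : Fin n, ((x : ℕ) < k ∨ ((x : ℕ) = k ∧ (z : ℕ) < m)) →
        (s₄.ent 3 n z x ↔ G.Adj z x ∧ v ∈ mShadow G z x)) (by simp) (by simp) (by simp)
        (by simp [hB3.size]) (by simpa using hI3) ?_ ?_
      · intro z s₄ hz hF4 h6 hI4
        rw [hB3.size] at hz
        have hB4 : Base G s₄ := hB3.frame hF4 (by simp) (by simp)
        have h84 : s₄.reg 8 = k := by rw [hF4.reg 8 (by simp), h83]
        have hv4 : s₄.reg 3 = v := by rw [hF4.reg 3 (by simp), hv3]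
        refine .setArr ?_
        intro z' x' hlt
        simp only [Store.ent, Store.setReg_arr, Store.setArr_arr, true_and, Expr.eval, h6, h84,
          hB4.row z hz, mul_add_inj x'.2 hk]
        by_cases heq : (z' : ℕ) = z ∧ (x' : ℕ) = k
        · rw [if_pos heq]
          obtain rfl : z' = ⟨z, hz⟩ := Fin.ext heq.1
          obtain rfl : x' = x := Fin.ext heq.2
          have e1 := hB4.ent ⟨z, hz⟩ x
          have e2 : s₄.ent 2 n z v ↔ s₃.ent 2 n z v := by
            rw [Store.ent, Store.ent, hF4.arr 2 (by simp)]
          have e3 := hC' ⟨z, hz⟩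
          have e4 := hB4.row z hz
          simp only [← e2] at e3
          simp only [Store.ent, x] at e1 e3
          simp only [ne_eq, Expr.eval_conj, Expr.eval_entry, Expr.eval, h6, h84, hv4, e4]
          rw [← e1] at e3 ⊢
          tauto
        · rw [if_neg heq]
          exact hI4 z' x' (by omega)
      · intro s₄ _ h z x hx
        rw [hB3.size] at h
        exact h z x (by have := z.2; omega)
  · intro s₁ _ h z x
    rw [hB.size] at h
    exact h z x x.2

open Classical in
-- The program sums over all pairs of vertices, whereas features are oriented edges; nonadjacent
-- pairs contribute nothing.
theorem sum_dart (f : ℕ → ℕ → ℕ) (P : ℕ → ℕ → Prop) (hP : ∀ i j : Fin n, P i j → G.Adj i j) :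
    ∑ e : G.Dart, (if P e.fst e.snd then f e.fst e.snd else 0) =
      ∑ k ∈ Finset.range n, ∑ l ∈ Finset.range n, if P k l then f k l else 0 := by
  rw [← Fin.sum_univ_eq_sum_range fun k => ∑ l ∈ Finset.range n, if P k l then f k l else 0]
  simp_rw [fun k : ℕ => (Fin.sum_univ_eq_sum_range (fun l => if P k l then f k l else 0) n).symm]
  rw [← Fintype.sum_prod_type' fun k l : Fin n => if P k l then f k l else 0]
  refine Finset.sum_of_injOn (fun e : G.Dart => e.toProd)
    SimpleGraph.Dart.toProd_injective.injOn (by simp) ?_ (by simp)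
  rintro ⟨i, j⟩ - hij
  refine if_neg fun h => hij ⟨⟨(i, j), hP i j h⟩, by simp, rfl⟩

open Classical in
/-- The invariant between the rounds. -/
structure Inv (G : SimpleGraph (Fin n)) (h : List (Fin n × Bool)) (s : Store) : Prop
    extends Base G s where
  count : s.reg 2 = Fintype.card G.Dart
  weight : ∀ e : G.Dart, s.arr 4 (e.fst * n + e.snd) = winnowWeights (feature G) h e

open Classical in
theorem runs_init {M : ℕ} : Runs n M init (inputStore G) (Inv G []) := by
  have hn : (inputStore G).reg 0 = n := by simp [inputStore]
  refine .seq ((Runs.rows (by simp) (by simp) (by simp [inputStore]) (by simp) (by rw [hn])).mono ?_)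
  intro s₁ hF1 h1
  have hB1 : Base G s₁ := ⟨by rw [hF1.reg 0 (by simp [Program.rows]), hn],
    hF1.arr 0 (by simp [Program.rows]), fun k hk => by rw [h1 k (by omega), hn]⟩
  refine .seq ((Runs.fill (fun _ _ c => c = 1) (by simp) (by simp) (by simp) (by simp) (by simp)
    (by rw [hB1.size]) (by rw [hB1.size]; exact hB1.row) (by simp)).mono ?_)
  intro s₂ hF2 h2
  have hB2 : Base G s₂ := hB1.frame hF2 (by simp [Program.fill]) (by simp [Program.fill])
  rw [hB1.size] at h2
  refine (Runs.sum (fun k l => s₂.ent 0 n k l) (fun _ _ => 1) (by simp) (by simp) (by simp) (by simp)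
    (by simp) (by simp) (by simp) (by rw [hB2.size]) ?_).mono ?_
  · intro k l s₃ hk hl hF3 h6 h7
    have hB3 : Base G s₃ := hB2.frame hF3 (by simp [Program.sum]) (by simp [Program.sum])
    rw [hB2.size] at hk
    refine ⟨?_, by simp⟩
    rw [hB3.entry (by simpa [h6] using hk), Store.ent, hF3.arr 0 (by simp [Program.sum])]
    simp [h6, h7]
  · intro s₃ hF3 h3
    have hB3 : Base G s₃ := hB2.frame hF3 (by simp [Program.sum]) (by simp [Program.sum])
    refine ⟨hB3, ?_, fun e => ?_⟩
    · rw [h3, hF2.reg 2 (by simp [Program.fill]), hF1.reg 2 (by simp [Program.rows]), hB2.size,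
        ← sum_dart (G := G) (fun _ _ => 1) _ fun i j h => (hB2.ent i j).1 h]
      have : ∀ e : G.Dart, s₂.ent 0 n e.fst e.snd := fun e => (hB2.ent _ _).2 e.adj
      simp [this, inputStore]
    · rw [hF3.arr 4 (by simp [Program.sum]), h2 _ e.fst.2 _ e.snd.2]
      simp [winnowWeights]

open Classical in
-- The label will overwrite register `1`, so the prediction is also kept in register `5` and the
-- active features remain in array `3`; the update needs both.
theorem runs_predict {M : ℕ} {h : List (Fin n × Bool)} {s : Store} (hI : Inv G h s) (v : Fin n) :
    Runs n M predict (s.setReg 1 v) fun s' => Inv G h s' ∧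
      (s'.reg 1 ≠ 0 ↔ shadowWinnow G h v = true) ∧
      (s'.reg 5 ≠ 0 ↔ shadowWinnow G h v = true) ∧
      ∀ z x : Fin n, s'.ent 3 n z x ↔ G.Adj z x ∧ v ∈ mShadow G z x := by
  refine .seq (.setReg (.seq ((runs_active (G := G) (n := n) (v := v) ?_ ?_).mono ?_)))
  · exact ⟨by simp [hI.size], by simp [hI.adj], by simpa using hI.row⟩
  · simp
  intro s₁ hF1 hA
  refine .seq (.setReg ?_)
  rw [Expr.eval]
  have hact : Program.wr active = [8, 6, 7, 7, 6, 11, 12, 13, 13, 12, 11, 6, 6, 8] := rfl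
  have hacta : Program.wa active = [2, 2, 3] := rfl
  have hI1 : Inv G h (s₁.setReg 4 0) := by
    constructor
    · constructor
      · simp [hF1.reg 0 (by simp [hact]), hI.size]
      · simp [hF1.arr 0 (by simp [hacta]), hI.adj]
      · simpa [hF1.arr 1 (by simp [hacta])] using hI.row
    · simp [hF1.reg 2 (by simp [hact]), hI.count]
    · simpa [hF1.arr 4 (by simp [hacta])] using hI.weight
  refine .seq ((Runs.sum (fun k l => s₁.ent 3 n k l) (fun k l => s.arr 4 (k * n + l)) (by simp)
    (by simp) (by simp) (by simp) (by simp) (by simp) (by simp) (by rw [hI1.size]) ?_).mono ?_)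
  · intro k l s₂ hk hl hF2 h6 h7
    have hB2 : Base G s₂ := hI1.toBase.frame hF2 (by simp [Program.sum]) (by simp [Program.sum])
    rw [hI1.size] at hk
    rw [hB2.entry (by simpa [h6] using hk), hB2.entry (by simpa [h6] using hk), Store.ent,
      hF2.arr 3 (by simp [Program.sum]), hF2.arr 4 (by simp [Program.sum])]
    simp [h6, h7, hF1.arr 4 (by simp [hacta])]
  intro s₂ hF2 h2
  refine .seq (.setReg (.setReg ?_))
  have hsum : s₂.reg 4 = ∑ e : G.Dart, if feature G v e then winnowWeights (feature G) h e else 0 := by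
    rw [h2, hI1.size, ← sum_dart (G := G) (fun k l => s.arr 4 (k * n + l)) _
      fun i j h => ((hA i j).1 h).1]
    simp only [Store.setReg_reg, if_true, zero_add]
    refine Finset.sum_congr rfl fun e _ => ?_
    have : s₁.ent 3 n e.fst e.snd ↔ feature G v e := by
      rw [hA]
      exact and_iff_right e.adj
    simp only [this, hI.weight]
  have hcnt : s₂.reg 2 = Fintype.card G.Dart := by
    rw [hF2.reg 2 (by simp [Program.sum]), hI1.count]
  -- The truncated difference is positive exactly when the active weight exceeds half the number of
  -- features.
  have hpred : (s₂.reg 4 + s₂.reg 4 - s₂.reg 2 ≠ 0 ↔ shadowWinnow G h v = true) := by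
    have : shadowWinnow G h v = winnowPredict (winnowWeights (feature G) h) (feature G v) := rfl
    rw [this, winnowPredict, decide_eq_true_eq, ← hsum, hcnt]
    omega
  have hB2 : Base G s₂ := hI1.toBase.frame hF2 (by simp [Program.sum]) (by simp [Program.sum])
  refine ⟨⟨⟨by simp [hB2.size], by simp [hB2.adj], by simpa using hB2.row⟩, by simp [hcnt], ?_⟩,
    by simpa using hpred, by simpa using hpred, fun z x => ?_⟩
  · intro e
    simp [hF2.arr 4 (by simp [Program.sum]), hI1.weight]
  · simp only [Store.ent_setReg]
    rw [← hA, Store.ent, Store.ent, hF2.arr 3 (by simp [Program.sum])]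
    rfl

open Classical in
theorem runs_update {M : ℕ} {h : List (Fin n × Bool)} {s : Store} (hI : Inv G h s) (v : Fin n)
    (y : Bool) (h5 : s.reg 5 ≠ 0 ↔ shadowWinnow G h v = true)
    (h3 : ∀ z x : Fin n, s.ent 3 n z x ↔ G.Adj z x ∧ v ∈ mShadow G z x) :
    Runs n M update (s.setReg 1 y.toNat) (Inv G (h ++ [(v, y)])) := by
  have hp : shadowWinnow G h v = winnowPredict (winnowWeights (feature G) h) (feature G v) := rfl
  -- Negating both registers reduces them to truth values: register `5` may hold any positive
  -- number.
  have hm : (Expr.neg (.same (.neg (.reg 5)) (.neg (.reg 1)))).eval (s.setReg 1 y.toNat) ≠ 0 ↔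
      winnowPredict (winnowWeights (feature G) h) (feature G v) ≠ y := by
    rw [← hp]
    simp only [ne_eq, Expr.eval_neg, not_not, Expr.eval_same]
    simp only [Expr.neg, Expr.eval, Store.setReg_reg, if_true, OfNat.ofNat_ne_one, if_false]
    cases y <;> cases hw : shadowWinnow G h v <;> simp [hw] at h5 ⊢ <;> omega
  have hB : Base G (s.setReg 1 y.toNat) := ⟨by simp [hI.size], by simp [hI.adj], by simpa using hI.row⟩
  have hfill : ∀ u : Expr, (∀ k l s₁, k < n → Frame (.fill 4 1 0 6 7 (.entry 3 1 (.reg 6) (.reg 7)) u)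
      (s.setReg 1 y.toNat) s₁ → s₁.reg 6 = k → s₁.reg 7 = l →
      s₁.arr 4 (k * n + l) = s.arr 4 (k * n + l) →
      u.eval s₁ = if y then 2 * s.arr 4 (k * n + l) else 0) →
      winnowPredict (winnowWeights (feature G) h) (feature G v) ≠ y →
      Runs n M (.fill 4 1 0 6 7 (.entry 3 1 (.reg 6) (.reg 7)) u) (s.setReg 1 y.toNat)
        (Inv G (h ++ [(v, y)])) := by
    intro u hu hne
    refine (Runs.fill (fun k l c => (s.ent 3 n k l → c = if y then 2 * s.arr 4 (k * n + l) else 0) ∧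
      (¬ s.ent 3 n k l → c = s.arr 4 (k * n + l))) (by simp) (by simp) (by simp) (by simp) (by simp)
      (by rw [hB.size]) (by rw [hB.size]; exact hB.row) ?_).mono ?_
    · intro k l s₁ hk hl hF h6 h7 hcell
      have hB1 : Base G s₁ := hB.frame hF (by simp [Program.fill]) (by simp [Program.fill])
      rw [hB.size] at hk hl hcell ⊢
      rw [hB1.entry (by simpa [h6] using hk)]
      simp only [Expr.eval, h6, h7, hF.arr 3 (by simp [Program.fill]), Store.setReg_arr]
      refine ⟨fun he => ⟨fun _ => hu k l s₁ hk hF h6 h7 hcell, fun hne => (hne he).elim⟩,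
        fun he => ⟨fun hne => (hne he).elim, fun _ => trivial⟩⟩
    · intro s₁ hF h1
      have hB1 : Base G s₁ := hB.frame hF (by simp [Program.fill]) (by simp [Program.fill])
      refine ⟨hB1, ?_, fun e => ?_⟩
      · simp [hF.reg 2 (by simp [Program.fill]), hI.count]
      · rw [hB.size] at h1
        obtain ⟨h1, h2⟩ := h1 e.fst e.fst.2 e.snd e.snd.2
        have hent : s.ent 3 n e.fst e.snd ↔ feature G v e := by
          rw [h3]
          exact and_iff_right e.adj
        rw [hent] at h1 h2
        rw [winnowWeights_append, winnowUpdate]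
        by_cases hf : feature G v e
        · rw [if_pos ⟨hne, hf⟩, h1 hf, hI.weight]
        · rw [h2 hf, if_neg fun h => hf h.2, hI.weight]
  refine .when (fun he => .ite (fun hy => ?_) fun hy => ?_) fun he => ?_
  · refine hfill _ ?_ (hm.1 he)
    intro k l s₁ hk hF h6 h7 hcell
    have hB1 : Base G s₁ := hB.frame hF (by simp [Program.fill]) (by simp [Program.fill])
    have hy' : y = true := by cases y <;> simp_all
    have := hB1.entry (a := 4) (x := .reg 6) (y := .reg 7) (by simpa [h6] using hk)
    rw [hy', if_pos rfl, ← hcell]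
    simp only [Expr.eval, this, h6, h7]
    omega
  · refine hfill _ ?_ (hm.1 he)
    intro k l s₁ hk hF h6 h7 hcell
    have hy' : y = false := by cases y <;> simp_all
    simp [hy']
  · refine ⟨hB, by simp [hI.count], fun e => ?_⟩
    have : ¬ winnowPredict (winnowWeights (feature G) h) (feature G v) ≠ y := fun hne => hm.2 hne he
    rw [winnowWeights_append, winnowUpdate, if_neg fun h => this h.1]
    exact hI.weight e

/-- The learner. -/
def learner : OnlineLearner := ⟨init, predict, update⟩

end WinnowProgram

theorem exists_winnow_learner : ∃ (A : OnlineLearner) (p : Polynomial ℕ),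
    ∀ (n : ℕ) (G : SimpleGraph (Fin n)) (H : Set (Fin n)) (vs : List (Fin n)),
      A.Plays G H (p.eval n) vs ((shadowWinnow G).predictions H [] vs) := by
  obtain ⟨p₁, h1⟩ := Program.exists_time_le WinnowProgram.init
  obtain ⟨p₂, h2⟩ := Program.exists_time_le WinnowProgram.predict
  obtain ⟨p₃, h3⟩ := Program.exists_time_le WinnowProgram.update
  refine ⟨WinnowProgram.learner, p₁ + p₂ + p₃, fun n G H vs => ?_⟩
  -- No loop of this learner is bounded by the register `20`, so `M = 0` is admissible and the power
  -- of `M + 1` disappears.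
  have h1 := h1 n 0
  have h2 := h2 n 0
  have h3 := h3 n 0
  simp only [zero_add, one_pow, one_mul] at h1 h2 h3
  simp only [Polynomial.eval_add]
  obtain ⟨t, s, he, ht, hs⟩ := WinnowProgram.runs_init (G := G) (M := 0)
  refine ⟨t, s, he, by omega, OnlineLearner.rounds_of_invariant (WinnowProgram.Inv G) ?_ vs [] s hs⟩
  intro h s v hs
  obtain ⟨t₁, s₁, e1, ht1, hI1, hp1, hp5, hA⟩ := WinnowProgram.runs_predict (M := 0) hs v
  obtain ⟨t₂, s₂, e2, ht2, hI2⟩ :=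
    WinnowProgram.runs_update (M := 0) hI1 v (label H v) hp5 hA
  refine ⟨t₁, s₁, t₂, s₂, e1, e2, by omega, ?_, hI2⟩
  rw [Bool.eq_iff_iff, decide_eq_true_eq]
  exact hp1

/-! ## Two-satisfiability

The literals of `n` variables are the numbers below `2 * n`: the number `v < n` stands for the
variable `v`, and `n + v` for its negation. -/

namespace TwoSat

/-- The negation of a literal. -/
def neg (n l : ℕ) : ℕ := if l < n then n + l else l - n

/-- The value of a literal under the assignment `σ`. -/
def val (n : ℕ) (σ : Set ℕ) (l : ℕ) : Prop := if l < n then l ∈ σ else l - n ∉ σ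

open Classical in
/-- The true one of the two literals of a variable. -/
noncomputable def lit (n : ℕ) (σ : Set ℕ) (v : ℕ) : ℕ := if v ∈ σ then v else n + v

variable {n : ℕ} {σ τ : Set ℕ} {T : ℕ → ℕ → Prop}

theorem neg_lt {l : ℕ} (h : l < 2 * n) : neg n l < 2 * n := by
  unfold neg
  split_ifs <;> omega

theorem neg_neg {l : ℕ} (h : l < 2 * n) : neg n (neg n l) = l := by
  unfold neg
  split_ifs <;> omega

theorem val_neg {l : ℕ} (h : l < 2 * n) : val n σ (neg n l) ↔ ¬ val n σ l := by
  unfold neg val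
  by_cases hl : l < n
  · simp [hl]
  · have : l - n < n := by omega
    simp [hl, this]

theorem val_of_lt {v : ℕ} (h : v < n) : val n σ v ↔ v ∈ σ := by simp [val, h]

theorem val_add (v : ℕ) : val n σ (n + v) ↔ v ∉ σ := by simp [val]

theorem neg_of_lt {v : ℕ} (h : v < n) : neg n v = n + v := by simp [neg, h]

theorem neg_add (v : ℕ) : neg n (n + v) = v := by simp [neg]

theorem lit_lt {v : ℕ} (h : v < n) : lit n σ v < 2 * n := by
  unfold lit
  split_ifs <;> omega

theorem val_lit {v : ℕ} (h : v < n) : val n σ (lit n σ v) := by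
  unfold lit
  split_ifs with hv
  · rwa [val_of_lt h]
  · rwa [val_add]

theorem exists_lit_eq {l : ℕ} (h : l < 2 * n) (hv : val n σ l) : ∃ v < n, l = lit n σ v := by
  unfold val at hv
  split_ifs at hv with hl
  · exact ⟨l, hl, by simp [lit, hv]⟩
  · exact ⟨l - n, by omega, by simp [lit, hv]; omega⟩

theorem lit_congr {v : ℕ} (h : v ∈ σ ↔ v ∈ τ) : lit n σ v = lit n τ v := by
  classical exact if_congr h rfl rfl

/-- The implications `T` are closed: transitive, closed under contraposition, and satisfiable. -/
structure Closed (n : ℕ) (T : ℕ → ℕ → Prop) : Prop where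
  trans : ∀ x < 2 * n, ∀ y < 2 * n, ∀ z < 2 * n, T x y → T y z → T x z
  skew : ∀ x < 2 * n, ∀ y < 2 * n, T x y → T (neg n y) (neg n x)
  sat : ∀ v < n, ¬ (T v (n + v) ∧ T (n + v) v)

/-- The assignment `σ` of the first `i` variables satisfies `T`. -/
def Consistent (n : ℕ) (T : ℕ → ℕ → Prop) (i : ℕ) (σ : Set ℕ) : Prop :=
  ∀ u < i, ∀ w < i, ¬ T (lit n σ u) (neg n (lit n σ w))

/-- The literal `l` can be added to the assignment `σ` of the first `i` variables. -/
def Addable (n : ℕ) (T : ℕ → ℕ → Prop) (i : ℕ) (σ : Set ℕ) (l : ℕ) : Prop :=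
  ¬ T l (neg n l) ∧ ∀ j < i, ¬ T (lit n σ j) (neg n l)

theorem consistent_congr {i : ℕ} (h : ∀ v < i, (v ∈ σ ↔ v ∈ τ)) :
    Consistent n T i σ ↔ Consistent n T i τ := by
  unfold Consistent
  refine forall₂_congr fun u hu => forall₂_congr fun w hw => ?_
  rw [lit_congr (h u hu), lit_congr (h w hw)]

theorem addable_congr {i l : ℕ} (h : ∀ v < i, (v ∈ σ ↔ v ∈ τ)) :
    Addable n T i σ l ↔ Addable n T i τ l := by
  unfold Addable
  refine and_congr_right fun _ => forall₂_congr fun u hu => ?_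
  rw [lit_congr (h u hu)]

/-- By contraposition, a conflict between the new literal and an old one is visible as an
implication starting at the old one, so `Addable` tests only this direction. -/
theorem Closed.consistent_succ (hT : Closed n T) {i : ℕ} (hi : i < n) :
    Consistent n T (i + 1) σ ↔ Consistent n T i σ ∧ Addable n T i σ (lit n σ i) := by
  constructor
  · intro h
    exact ⟨fun u hu w hw => h u (by omega) w (by omega), h i (by omega) i (by omega),
      fun j hj => h j (by omega) i (by omega)⟩
  · rintro ⟨h1, h2, h3⟩ u hu w hw
    rcases Nat.lt_succ_iff_lt_or_eq.1 hu with hu | rfl <;>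
      rcases Nat.lt_succ_iff_lt_or_eq.1 hw with hw | rfl
    · exact h1 u hu w hw
    · exact h3 u hu
    · intro h
      have hw' : lit n σ w < 2 * n := lit_lt (by omega)
      have := hT.skew _ (lit_lt hi) _ (neg_lt hw') h
      rw [neg_neg hw'] at this
      exact h3 w hw this
    · exact h2

/-- There are no dead ends. Each literal of the variable could be blocked by itself or by an old
true literal. If both block themselves, they imply each other, against satisfiability; in the other
three cases transitivity and contraposition lead from an old true literal to the negation of an old
true literal. -/
theorem Closed.addable_or (hT : Closed n T) {i : ℕ} (hi : i < n) (hσ : Consistent n T i σ) :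
    Addable n T i σ i ∨ Addable n T i σ (n + i) := by
  by_contra! h
  obtain ⟨h1, h2⟩ := h
  have hi2 : i < 2 * n := by omega
  have hi3 : n + i < 2 * n := by omega
  rw [Addable, neg_of_lt hi, Classical.not_and_iff_not_or_not, not_not] at h1
  rw [Addable, neg_add, Classical.not_and_iff_not_or_not, not_not] at h2
  push Not at h1 h2
  rcases h1 with h1 | ⟨j, hj, h1⟩ <;> rcases h2 with h2 | ⟨m, hm, h2⟩
  · exact hT.sat i hi ⟨h1, h2⟩
  · have hm' : lit n σ m < 2 * n := lit_lt (by omega)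
    have h3 := hT.skew _ hm' _ hi2 h2
    rw [neg_of_lt hi] at h3
    exact hσ m hm m hm (hT.trans _ hm' _ hi2 _ (neg_lt hm') h2
      (hT.trans _ hi2 _ hi3 _ (neg_lt hm') h1 h3))
  · have hj' : lit n σ j < 2 * n := lit_lt (by omega)
    have h3 := hT.skew _ hj' _ hi3 h1
    rw [neg_add] at h3
    exact hσ j hj j hj (hT.trans _ hj' _ hi3 _ (neg_lt hj') h1
      (hT.trans _ hi3 _ hi2 _ (neg_lt hj') h2 h3))
  · have hj' : lit n σ j < 2 * n := lit_lt (by omega)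
    have hm' : lit n σ m < 2 * n := lit_lt (by omega)
    have h3 := hT.skew _ hm' _ hi2 h2
    rw [neg_of_lt hi] at h3
    exact hσ j hj m hm (hT.trans _ hj' _ hi3 _ (neg_lt hm') h1 h3)

/-- Greedy assignment of the remaining variables, without backtracking, by `addable_or`. -/
theorem Closed.exists_extension (hT : Closed n T) {i : ℕ} (hi : i ≤ n) (hσ : Consistent n T i σ) :
    ∃ τ, (∀ v < i, (v ∈ τ ↔ v ∈ σ)) ∧ Consistent n T n τ := by
  induction hm : n - i generalizing i σ with
  | zero =>
    obtain rfl : i = n := by omega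
    exact ⟨σ, fun _ _ => Iff.rfl, hσ⟩
  | succ m ih =>
    have hin : i < n := by omega
    suffices h : ∃ τ, (∀ v < i, (v ∈ τ ↔ v ∈ σ)) ∧ Consistent n T (i + 1) τ by
      obtain ⟨τ, h1, h2⟩ := h
      obtain ⟨ρ, h3, h4⟩ := ih (by omega) h2 (by omega)
      exact ⟨ρ, fun v hv => (h3 v (by omega)).trans (h1 v hv), h4⟩
    rcases hT.addable_or hin hσ with h | h
    · have hagree : ∀ v < i, (v ∈ insert i σ ↔ v ∈ σ) := fun v hv => by
        simp [show v ≠ i by omega]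
      refine ⟨insert i σ, hagree, hT.consistent_succ hin |>.2
        ⟨(consistent_congr hagree).2 hσ, ?_⟩⟩
      rw [addable_congr hagree]
      simpa [lit] using h
    · have hagree : ∀ v < i, (v ∈ σ \ {i} ↔ v ∈ σ) := fun v hv => by
        simp [show v ≠ i by omega]
      refine ⟨σ \ {i}, hagree, hT.consistent_succ hin |>.2
        ⟨(consistent_congr hagree).2 hσ, ?_⟩⟩
      rw [addable_congr hagree]
      simpa [lit] using h

/-- The implications given by a set of forbidden pairs of literals. -/
def Imp (n : ℕ) (F : ℕ → ℕ → Prop) (x y : ℕ) : Prop := x = y ∨ F x (neg n y) ∨ F (neg n y) x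

/-- Their reflexive transitive closure. -/
def Reach (n : ℕ) (F : ℕ → ℕ → Prop) : ℕ → ℕ → Prop :=
  Relation.ReflTransGen fun x y => x < 2 * n ∧ y < 2 * n ∧ Imp n F x y

variable {F : ℕ → ℕ → Prop}

theorem reach_skew {x y : ℕ} (h : Reach n F x y) : Reach n F (neg n y) (neg n x) := by
  induction h with
  | refl => exact .refl
  | tail _ hbc ih =>
    refine .head ⟨neg_lt hbc.2.1, neg_lt hbc.1, ?_⟩ ih
    rw [Imp, neg_neg hbc.1]
    rcases hbc.2.2 with h | h | h
    · exact Or.inl (by rw [h])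
    · exact Or.inr (Or.inr h)
    · exact Or.inr (Or.inl h)

theorem val_of_reach (hσ : ∀ x < 2 * n, ∀ y < 2 * n, F x y → ¬ (val n σ x ∧ val n σ y)) {x y : ℕ}
    (h : Reach n F x y) (hx : val n σ x) : val n σ y := by
  induction h with
  | refl => exact hx
  | tail _ hbc ih =>
    rcases hbc.2.2 with h | h | h
    · exact h ▸ ih
    · by_contra hy
      exact hσ _ hbc.1 _ (neg_lt hbc.2.1) h ⟨ih, (val_neg hbc.2.1).2 hy⟩
    · by_contra hy
      exact hσ _ (neg_lt hbc.2.1) _ hbc.1 h ⟨(val_neg hbc.2.1).2 hy, ih⟩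

/-- A forbidden pair is a one-step implication from one literal to the negation of the other;
conversely, if no forbidden pair is true, then implications lead from true literals only to true
ones. -/
theorem consistent_iff : Consistent n (Reach n F) n σ ↔
    ∀ x < 2 * n, ∀ y < 2 * n, F x y → ¬ (val n σ x ∧ val n σ y) := by
  constructor
  · rintro h x hx y hy hF ⟨h1, h2⟩
    obtain ⟨u, hu, rfl⟩ := exists_lit_eq hx h1
    obtain ⟨w, hw, rfl⟩ := exists_lit_eq hy h2
    refine h u hu w hw (.single ⟨hx, neg_lt hy, Or.inr (Or.inl ?_)⟩)
    rwa [neg_neg hy]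
  · intro h u hu w hw hr
    have := val_of_reach h hr (val_lit hu)
    rw [val_neg (lit_lt hw)] at this
    exact this (val_lit hw)

theorem closed_reach (h : ∀ v < n, ¬ (Reach n F v (n + v) ∧ Reach n F (n + v) v)) :
    Closed n (Reach n F) :=
  ⟨fun _ _ _ _ _ _ h1 h2 => h1.trans h2, fun _ _ _ _ => reach_skew, h⟩

/-- Without satisfiability there is no consistent assignment. -/
theorem not_consistent {v : ℕ} (hv : v < n) (h : T v (n + v) ∧ T (n + v) v) :
    ¬ Consistent n T n σ := by
  intro hc
  have := hc v hv v hv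
  by_cases hσ : v ∈ σ
  · simp only [lit, hσ, if_true, neg_of_lt hv] at this
    exact this h.1
  · simp only [lit, hσ, if_false, neg_add] at this
    exact this h.2

end TwoSat

/-! ### Halfspaces with a given first cut edge -/

namespace CutEdge

open TwoSat

/-- Adjacency of vertices given as numbers. -/
def A {n : ℕ} (G : SimpleGraph (Fin n)) (u w : ℕ) : Prop :=
  ∃ (hu : u < n) (hw : w < n), G.Adj ⟨u, hu⟩ ⟨w, hw⟩

variable {n : ℕ} {G : SimpleGraph (Fin n)}

theorem A.symm {u w : ℕ} (h : A G u w) : A G w u := ⟨h.2.1, h.1, h.2.2.symm⟩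

theorem A_coe {u w : Fin n} : A G u w ↔ G.Adj u w := by simp [A]

/-- Two edges that cannot both be cut by a halfspace containing their first ends only. -/
def Bad (G : SimpleGraph (Fin n)) (u w u' w' : ℕ) : Prop :=
  (u ≠ u' ∧ ¬ A G u u') ∨ (w ≠ w' ∧ ¬ A G w w')

/-- The vertices on the side of `a` whenever the edge from `a` to `b` is cut. -/
def Forced (G : SimpleGraph (Fin n)) (a b u : ℕ) : Prop :=
  u = a ∨ (A G a u ∧ u ≠ b ∧ ¬ A G b u)

/-- The edge from `u` to `w` comes before that from `a` to `b`. -/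
def Before (u w a b : ℕ) : Prop := u < a ∨ (u = a ∧ w < b)

/-- The vertex set given by a set of numbers. -/
def toFin (n : ℕ) (σ : Set ℕ) : Set (Fin n) := {v | (v : ℕ) ∈ σ}

/-- The two border conditions fail exactly through pairs of cut edges. Such a clause still involves
up to four vertices. -/
theorem mem_mHalfspaces_toFin (hG : G.Connected) {σ : Set ℕ} :
    toFin n σ ∈ mHalfspaces G ↔ ∀ u w u' w', A G u w → A G u' w' → Bad G u w u' w' →
      ¬ (u ∈ σ ∧ w ∉ σ ∧ u' ∈ σ ∧ w' ∉ σ) := by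
  rw [SimpleGraph.mem_mHalfspaces_iff hG]
  constructor
  · rintro ⟨h1, h2⟩ u w u' w' ⟨hu, hw, huw⟩ ⟨hu', hw', huw'⟩ hbad ⟨m1, m2, m3, m4⟩
    rcases hbad with ⟨hne, hadj⟩ | ⟨hne, hadj⟩
    · exact hadj ⟨hu, hu', h1 ⟨m1, ⟨w, hw⟩, m2, huw⟩ ⟨m3, ⟨w', hw'⟩, m4, huw'⟩
        (by simpa using hne)⟩
    · exact hadj ⟨hw, hw', h2 ⟨m2, ⟨u, hu⟩, fun h => h m1, huw.symm⟩
        ⟨m4, ⟨u', hu'⟩, fun h => h m3, huw'.symm⟩ (by simpa using hne)⟩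
  · intro h
    constructor
    · rintro u ⟨hu, w, hw, huw⟩ u' ⟨hu', w', hw', huw'⟩ hne
      by_contra hadj
      exact h u w u' w' (A_coe.2 huw) (A_coe.2 huw')
        (Or.inl ⟨fun e => hne (Fin.ext e), fun h => hadj (A_coe.1 h)⟩) ⟨hu, hw, hu', hw'⟩
    · rintro w ⟨hw, u, hu, huw⟩ w' ⟨hw', u', hu', huw'⟩ hne
      by_contra hadj
      exact h u w u' w' (A_coe.2 huw.symm) (A_coe.2 huw'.symm)
        (Or.inr ⟨fun e => hne (Fin.ext e), fun h => hadj (A_coe.1 h)⟩)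
        ⟨not_not.1 hu, hw, not_not.1 hu', hw'⟩

/-- The edge from `a` to `b` is the first edge leaving `σ`. -/
def FirstCut (G : SimpleGraph (Fin n)) (a b : ℕ) (σ : Set ℕ) : Prop :=
  a ∈ σ ∧ b ∉ σ ∧ ∀ u w, A G u w → Before u w a b → ¬ (u ∈ σ ∧ w ∉ σ)

/-- The forbidden pairs of literals that come from a pair of edges. -/
def PairForbidden (G : SimpleGraph (Fin n)) (a b u w u' w' x y : ℕ) : Prop :=
  A G u w ∧ A G u' w' ∧ Bad G u w u' w' ∧
    ((Forced G a b u' ∧ Forced G b a w' ∧ x = u ∧ y = n + w) ∨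
      (Forced G b a w ∧ Forced G b a w' ∧ x = u ∧ y = u') ∨
      (Forced G a b u ∧ Forced G a b u' ∧ x = n + w ∧ y = n + w') ∨
      (Forced G b a w ∧ Forced G a b u' ∧ x = u ∧ y = n + w'))

/-- The pairs of literals that are forbidden for halfspaces with first cut edge from `a` to `b`. -/
def Forbidden (G : SimpleGraph (Fin n)) (a b x y : ℕ) : Prop :=
  (x = n + a ∧ y = n + a) ∨ (x = b ∧ y = b) ∨
    (∃ u w, A G u w ∧ Before u w a b ∧ x = u ∧ y = n + w) ∨
    ∃ u w u' w', PairForbidden G a b u w u' w' x y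

/-- Cutting the edge from `a` to `b` fixes the labels of all forced vertices, so a clause from two
edges shrinks to two literals when two of its vertices are forced. These shortened clauses suffice.
By comparison with that edge, the inner ends of cut edges are `a` or adjacent to it, and the outer
ends are `b` or adjacent to it. Two incompatible edges can then be replaced by edges that each have
a forced end. -/
theorem forbidden_iff (hG : G.Connected) {a b : ℕ} (hab : A G a b) {σ : Set ℕ} :
    (∀ x < 2 * n, ∀ y < 2 * n, Forbidden G a b x y → ¬ (val n σ x ∧ val n σ y)) ↔
      toFin n σ ∈ mHalfspaces G ∧ FirstCut G a b σ := by
  rw [mem_mHalfspaces_toFin hG]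
  obtain ⟨ha, hb, -⟩ := id hab
  constructor
  · intro h
    have haσ : a ∈ σ := by
      by_contra haσ
      exact h (n + a) (by omega) (n + a) (by omega) (Or.inl ⟨rfl, rfl⟩)
        ⟨(val_add a).2 haσ, (val_add a).2 haσ⟩
    have hbσ : b ∉ σ := fun hbσ => h b (by omega) b (by omega) (Or.inr (Or.inl ⟨rfl, rfl⟩))
      ⟨(val_of_lt hb).2 hbσ, (val_of_lt hb).2 hbσ⟩
    have hp : ∀ {u w u' w' x y}, PairForbidden G a b u w u' w' x y →
        ¬ (val n σ x ∧ val n σ y) := by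
      intro u w u' w' x y hp
      refine h x ?_ y ?_ (Or.inr (Or.inr (Or.inr ⟨u, w, u', w', hp⟩)))
      all_goals
        obtain ⟨⟨h1, h2, -⟩, ⟨h3, h4, -⟩, -, hc⟩ := hp
        omega
    have fa : Forced G a b a := Or.inl rfl
    have fb : Forced G b a b := Or.inl rfl
    -- Every cut edge is compatible with the edge from `a` to `b`: here `a` and `b` are the forced
    -- vertices.
    have near : ∀ {u w}, A G u w → u ∈ σ → w ∉ σ → ¬ Bad G u w a b := fun huw hu hw hbad =>
      hp ⟨huw, hab, hbad, Or.inl ⟨fa, fb, rfl, rfl⟩⟩ ⟨(val_of_lt huw.1).2 hu, (val_add _).2 hw⟩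
    refine ⟨?_, haσ, hbσ, ?_⟩
    · rintro u w u' w' huw huw' hbad ⟨hu, hw, hu', hw'⟩
      have n1 := near huw hu hw
      have n2 := near huw' hu' hw'
      rcases hbad with ⟨hne, hadj⟩ | ⟨hne, hadj⟩
      · have hua : u ≠ a := by
          rintro rfl
          exact n2 (Or.inl ⟨hne.symm, fun h => hadj h.symm⟩)
        have hua' : u' ≠ a := by
          rintro rfl
          exact n1 (Or.inl ⟨hne, hadj⟩)
        have au : A G u a := by
          by_contra h
          exact n1 (Or.inl ⟨hua, h⟩)
        have au' : A G u' a := by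
          by_contra h
          exact n2 (Or.inl ⟨hua', h⟩)
        have hub : u ≠ b := fun e => hbσ (e ▸ hu)
        have hub' : u' ≠ b := fun e => hbσ (e ▸ hu')
        have v1 := (val_of_lt (n := n) huw.1).2 hu
        have v2 := (val_of_lt (n := n) huw'.1).2 hu'
        have v3 := (val_add (n := n) w).2 hw
        have v4 := (val_add (n := n) w').2 hw'
        -- An inner end adjacent to `b` is paired with `b` instead of its own outer end; one not
        -- adjacent to `b` is itself forced. Either way one literal per edge remains. The case of
        -- outer ends below is the mirror image.
        by_cases c : A G u b <;> by_cases c' : A G u' b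
        · exact hp ⟨c, c', Or.inl ⟨hne, hadj⟩, Or.inr (Or.inl ⟨fb, fb, rfl, rfl⟩)⟩ ⟨v1, v2⟩
        · have f' : Forced G a b u' := Or.inr ⟨au'.symm, hub', fun h => c' h.symm⟩
          exact hp ⟨c, huw', Or.inl ⟨hne, hadj⟩, Or.inr (Or.inr (Or.inr ⟨fb, f', rfl, rfl⟩))⟩
            ⟨v1, v4⟩
        · have f : Forced G a b u := Or.inr ⟨au.symm, hub, fun h => c h.symm⟩
          exact hp ⟨c', huw, Or.inl ⟨hne.symm, fun h => hadj h.symm⟩,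
            Or.inr (Or.inr (Or.inr ⟨fb, f, rfl, rfl⟩))⟩ ⟨v2, v3⟩
        · have f : Forced G a b u := Or.inr ⟨au.symm, hub, fun h => c h.symm⟩
          have f' : Forced G a b u' := Or.inr ⟨au'.symm, hub', fun h => c' h.symm⟩
          exact hp ⟨huw, huw', Or.inl ⟨hne, hadj⟩, Or.inr (Or.inr (Or.inl ⟨f, f', rfl, rfl⟩))⟩
            ⟨v3, v4⟩
      · have hwb : w ≠ b := by
          rintro rfl
          exact n2 (Or.inr ⟨hne.symm, fun h => hadj h.symm⟩)
        have hwb' : w' ≠ b := by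
          rintro rfl
          exact n1 (Or.inr ⟨hne, hadj⟩)
        have bw : A G w b := by
          by_contra h
          exact n1 (Or.inr ⟨hwb, h⟩)
        have bw' : A G w' b := by
          by_contra h
          exact n2 (Or.inr ⟨hwb', h⟩)
        have hwa : w ≠ a := fun e => hw (e ▸ haσ)
        have hwa' : w' ≠ a := fun e => hw' (e ▸ haσ)
        have v1 := (val_of_lt (n := n) huw.1).2 hu
        have v2 := (val_of_lt (n := n) huw'.1).2 hu'
        have v3 := (val_add (n := n) w).2 hw
        have v4 := (val_add (n := n) w').2 hw'
        by_cases c : A G w a <;> by_cases c' : A G w' a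
        · exact hp ⟨c.symm, c'.symm, Or.inr ⟨hne, hadj⟩,
            Or.inr (Or.inr (Or.inl ⟨fa, fa, rfl, rfl⟩))⟩ ⟨v3, v4⟩
        · have f' : Forced G b a w' := Or.inr ⟨bw'.symm, hwa', fun h => c' h.symm⟩
          exact hp ⟨huw', c.symm, Or.inr ⟨hne.symm, fun h => hadj h.symm⟩,
            Or.inr (Or.inr (Or.inr ⟨f', fa, rfl, rfl⟩))⟩ ⟨v2, v3⟩
        · have f : Forced G b a w := Or.inr ⟨bw.symm, hwa, fun h => c h.symm⟩
          exact hp ⟨huw, c'.symm, Or.inr ⟨hne, hadj⟩,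
            Or.inr (Or.inr (Or.inr ⟨f, fa, rfl, rfl⟩))⟩ ⟨v1, v4⟩
        · have f : Forced G b a w := Or.inr ⟨bw.symm, hwa, fun h => c h.symm⟩
          have f' : Forced G b a w' := Or.inr ⟨bw'.symm, hwa', fun h => c' h.symm⟩
          exact hp ⟨huw, huw', Or.inr ⟨hne, hadj⟩, Or.inr (Or.inl ⟨f, f', rfl, rfl⟩)⟩ ⟨v1, v2⟩
    · rintro u w huw hbef ⟨hu, hw⟩
      obtain ⟨hun, hwn, -⟩ := id huw
      exact h u (by omega) (n + w) (by omega) (Or.inr (Or.inr (Or.inl ⟨u, w, huw, hbef, rfl, rfl⟩)))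
        ⟨(val_of_lt hun).2 hu, (val_add w).2 hw⟩
  · rintro ⟨h, haσ, hbσ, hfirst⟩ x - y - hF ⟨hx, hy⟩
    have fin : ∀ {u}, Forced G a b u → u ∈ σ := by
      rintro u (rfl | ⟨h1, h2, h3⟩)
      · exact haσ
      · by_contra hu
        exact h a u a b h1 hab (Or.inr ⟨h2, fun h => h3 h.symm⟩) ⟨haσ, hu, haσ, hbσ⟩
    have fout : ∀ {w}, Forced G b a w → w ∉ σ := by
      rintro w (rfl | ⟨h1, h2, h3⟩)
      · exact hbσ
      · intro hw
        exact h w b a b h1.symm hab (Or.inl ⟨h2, fun h => h3 h.symm⟩) ⟨hw, hbσ, haσ, hbσ⟩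
    rcases hF with ⟨rfl, -⟩ | ⟨rfl, -⟩ | ⟨u, w, huw, hbef, rfl, rfl⟩ |
      ⟨u, w, u', w', huw, huw', hbad, hc⟩
    · exact (val_add a).1 hx haσ
    · exact hbσ ((val_of_lt hb).1 hx)
    · exact hfirst _ _ huw hbef ⟨(val_of_lt huw.1).1 hx, (val_add w).1 hy⟩
    · have := h u w u' w' huw huw' hbad
      rcases hc with ⟨f1, f2, rfl, rfl⟩ | ⟨f1, f2, rfl, rfl⟩ | ⟨f1, f2, rfl, rfl⟩ |
        ⟨f1, f2, rfl, rfl⟩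
      · exact this ⟨(val_of_lt huw.1).1 hx, (val_add w).1 hy, fin f1, fout f2⟩
      · exact this ⟨(val_of_lt huw.1).1 hx, fout f1, (val_of_lt huw'.1).1 hy, fout f2⟩
      · exact this ⟨fin f1, (val_add w).1 hx, fin f2, (val_add w').1 hy⟩
      · exact this ⟨(val_of_lt huw.1).1 hx, fout f1, fin f2, (val_add w').1 hy⟩

theorem FirstCut.unique {a b a' b' : ℕ} (hab : A G a b) (hab' : A G a' b') {σ : Set ℕ}
    (h : FirstCut G a b σ) (h' : FirstCut G a' b' σ) : a = a' ∧ b = b' := by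
  have h1 : ¬ Before a b a' b' := fun hb => h'.2.2 a b hab hb ⟨h.1, h.2.1⟩
  have h2 : ¬ Before a' b' a b := fun hb => h.2.2 a' b' hab' hb ⟨h'.1, h'.2.1⟩
  unfold Before at h1 h2
  omega

/-- Minimise the first end of a cut edge, then the second. With uniqueness, each nontrivial
halfspace is listed for exactly one edge. -/
theorem exists_firstCut (hG : G.Connected) {σ : Set ℕ} (h1 : toFin n σ ≠ ∅)
    (h2 : toFin n σ ≠ Set.univ) : ∃ a b, A G a b ∧ FirstCut G a b σ := by
  classical
  obtain ⟨a, b, hab, ha, hb⟩ := SimpleGraph.exists_adj_cut hG h1 h2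
  have hex : ∃ a b, A G a b ∧ a ∈ σ ∧ b ∉ σ := ⟨a, b, A_coe.2 hab, ha, hb⟩
  have hex' := Nat.find_spec hex
  have hs := Nat.find_spec hex'
  refine ⟨Nat.find hex, Nat.find hex', hs.1, hs.2.1, hs.2.2, ?_⟩
  rintro u w huw (hlt | ⟨rfl, hlt⟩) ⟨hu, hw⟩
  · exact Nat.find_min hex hlt ⟨w, huw, hu, hw⟩
  · exact Nat.find_min hex' hlt ⟨huw, hu, hw⟩

end CutEdge

/-! ### Growing the list of partial solutions variable by variable -/

namespace TwoSat

variable {n : ℕ} {T : ℕ → ℕ → Prop}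

/-- The consistent assignments of the first `i` variables. -/
def solutions (n : ℕ) (T : ℕ → ℕ → Prop) (i : ℕ) : Set (Set ℕ) :=
  {σ | σ ⊆ Set.Iio i ∧ Consistent n T i σ}

theorem finite_solutions (i : ℕ) : (solutions n T i).Finite :=
  (Set.finite_Iio i).powerset.subset fun _ h => h.1

theorem solutions_zero : solutions n T 0 = {∅} := by
  ext σ
  constructor
  · intro h
    exact Set.subset_eq_empty (fun v hv => by simpa using h.1 hv) rfl
  · rintro rfl
    exact ⟨by simp, fun u hu => by omega⟩

theorem agree_inter (i : ℕ) (σ : Set ℕ) : ∀ v < i, (v ∈ σ ∩ Set.Iio i ↔ v ∈ σ) := fun v hv => by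
  simp [hv]

/-- Every partial solution is the restriction of a full one, by `exists_extension`. Hence no
intermediate list is longer than the final one, which keeps the time linear in the number of
halfspaces. -/
theorem Closed.ncard_solutions_le (hT : Closed n T) {i : ℕ} (hi : i ≤ n) :
    (solutions n T i).ncard ≤ (solutions n T n).ncard := by
  have hsub : solutions n T i ⊆ (fun σ => σ ∩ Set.Iio i) '' solutions n T n := by
    rintro σ ⟨h1, h2⟩
    obtain ⟨τ, h3, h4⟩ := hT.exists_extension hi h2
    refine ⟨τ ∩ Set.Iio n, ⟨Set.inter_subset_right, (consistent_congr (agree_inter n τ)).2 h4⟩, ?_⟩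
    ext v
    simp only [Set.mem_inter_iff, Set.mem_Iio]
    constructor
    · rintro ⟨⟨h5, -⟩, h6⟩
      exact (h3 v h6).1 h5
    · intro hv
      have hvi : v < i := h1 hv
      exact ⟨⟨(h3 v hvi).2 hv, by omega⟩, hvi⟩
  exact (Set.ncard_le_ncard hsub ((finite_solutions n).image _)).trans
    (Set.ncard_image_le (finite_solutions n))

theorem Closed.mem_solutions_succ (hT : Closed n T) {i : ℕ} (hi : i < n) {Y : Set ℕ} :
    Y ∈ solutions n T (i + 1) ↔ Y ⊆ Set.Iio (i + 1) ∧ Y ∩ Set.Iio i ∈ solutions n T i ∧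
      (i ∈ Y → Addable n T i (Y ∩ Set.Iio i) i) ∧
      (i ∉ Y → Addable n T i (Y ∩ Set.Iio i) (n + i)) := by
  have hc := consistent_congr (n := n) (T := T) (agree_inter i Y)
  have ha : ∀ l, Addable n T i (Y ∩ Set.Iio i) l ↔ Addable n T i Y l := fun l =>
    addable_congr (agree_inter i Y)
  constructor
  · rintro ⟨h1, h2⟩
    obtain ⟨h3, h4⟩ := (hT.consistent_succ hi).1 h2
    refine ⟨h1, ⟨Set.inter_subset_right, hc.2 h3⟩, fun h => ?_, fun h => ?_⟩
    · rw [ha]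
      simpa [lit, h] using h4
    · rw [ha]
      simpa [lit, h] using h4
  · rintro ⟨h1, h2, h3, h4⟩
    refine ⟨h1, (hT.consistent_succ hi).2 ⟨hc.1 h2.2, ?_⟩⟩
    by_cases h : i ∈ Y
    · have := h3 h
      rw [ha] at this
      simpa [lit, h] using this
    · have := h4 h
      rw [ha] at this
      simpa [lit, h] using this

/-- Splitting a bijection between rows and assignments by the value of the next variable. -/
theorem Closed.bijOn_split (hT : Closed n T) {i : ℕ} (hi : i < n) {g f f' : ℕ → Set ℕ} {S₀ M₀ k : ℕ}
    {P P' : Set ℕ} (hg : Set.BijOn g (Set.Ico S₀ M₀) (solutions n T i)) (hk : k ∈ Set.Ico S₀ M₀)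
    (hP : Set.BijOn f P {Y ∈ solutions n T (i + 1) | ∃ r ∈ Set.Ico S₀ k, Y ∩ Set.Iio i = g r})
    (hkP : k ∉ P) (hf : Set.EqOn f f' P)
    (hcase : (Addable n T i (g k) i ∧ Addable n T i (g k) (n + i) ∧
        ∃ m, m ∉ P ∧ m ≠ k ∧ P' = insert m (insert k P) ∧ f' k = insert i (g k) ∧ f' m = g k) ∨
      (Addable n T i (g k) i ∧ ¬ Addable n T i (g k) (n + i) ∧ P' = insert k P ∧
        f' k = insert i (g k)) ∨
      (¬ Addable n T i (g k) i ∧ Addable n T i (g k) (n + i) ∧ P' = insert k P ∧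
        f' k = g k)) :
    Set.BijOn f' P'
      {Y ∈ solutions n T (i + 1) | ∃ r ∈ Set.Ico S₀ (k + 1), Y ∩ Set.Iio i = g r} := by
  have hgk := hg.mapsTo hk
  have hgi : g k ⊆ Set.Iio i := hgk.1
  have hP' := hP.congr hf
  have hex : ∀ {Y : Set ℕ}, (∃ r ∈ Set.Ico S₀ (k + 1), Y ∩ Set.Iio i = g r) ↔
      (∃ r ∈ Set.Ico S₀ k, Y ∩ Set.Iio i = g r) ∨ Y ∩ Set.Iio i = g k := by
    intro Y
    constructor
    · rintro ⟨r, ⟨h1, h2⟩, h3⟩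
      rcases Nat.lt_succ_iff_lt_or_eq.1 h2 with h | rfl
      · exact Or.inl ⟨r, ⟨h1, h⟩, h3⟩
      · exact Or.inr h3
    · rintro (⟨r, ⟨h1, h2⟩, h3⟩ | h)
      · exact ⟨r, ⟨h1, by omega⟩, h3⟩
      · exact ⟨k, ⟨hk.1, by omega⟩, h⟩
  -- Rows are distinct, so an extension of row `k` is not an extension of an earlier row.
  have hnew : ∀ {Y : Set ℕ}, Y ∩ Set.Iio i = g k → Y ∉ {Y ∈ solutions n T (i + 1) |
      ∃ r ∈ Set.Ico S₀ k, Y ∩ Set.Iio i = g r} := by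
    rintro Y hY ⟨-, r, ⟨h1, h2⟩, h3⟩
    have := hg.injOn ⟨h1, h2.trans hk.2⟩ hk (h3.symm.trans hY)
    omega
  have hti : insert i (g k) ∩ Set.Iio i = g k := by
    ext v
    simp only [Set.mem_inter_iff, Set.mem_insert_iff, Set.mem_Iio]
    constructor
    · rintro ⟨rfl | h, h'⟩
      · omega
      · exact h
    · exact fun h => ⟨Or.inr h, hgi h⟩
  have htk : g k ∩ Set.Iio i = g k := Set.inter_eq_left.2 hgi
  have hik : i ∉ g k := fun h => by simpa using hgi h
  have hsub1 : insert i (g k) ⊆ Set.Iio (i + 1) := by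
    rintro v (rfl | hv)
    · simp
    · exact Nat.lt_succ_of_lt (hgi hv)
  have hsub2 : g k ⊆ Set.Iio (i + 1) := fun v hv => Nat.lt_succ_of_lt (hgi hv)
  have hmem1 : insert i (g k) ∈ solutions n T (i + 1) ↔ Addable n T i (g k) i := by
    rw [hT.mem_solutions_succ hi, hti]
    constructor
    · rintro ⟨-, -, h, -⟩
      exact h (Set.mem_insert _ _)
    · exact fun h => ⟨hsub1, hgk, fun _ => h, fun h => (h (Set.mem_insert _ _)).elim⟩
  have hmem2 : g k ∈ solutions n T (i + 1) ↔ Addable n T i (g k) (n + i) := by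
    rw [hT.mem_solutions_succ hi, htk]
    constructor
    · rintro ⟨-, -, -, h⟩
      exact h hik
    · exact fun h => ⟨hsub2, hgk, fun h => (hik h).elim, fun _ => h⟩
  have htwo : ∀ {Y : Set ℕ}, Y ∈ solutions n T (i + 1) → Y ∩ Set.Iio i = g k →
      Y = insert i (g k) ∨ Y = g k := by
    intro Y hY hYk
    by_cases h : i ∈ Y
    · left
      ext v
      rw [Set.mem_insert_iff, ← hYk, Set.mem_inter_iff, Set.mem_Iio]
      constructor
      · intro hv
        have : v < i + 1 := hY.1 hv
        by_cases hvi : v = i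
        · exact Or.inl hvi
        · exact Or.inr ⟨hv, by omega⟩
      · rintro (rfl | h')
        · exact h
        · exact h'.1
    · right
      rw [← hYk]
      ext v
      rw [Set.mem_inter_iff, Set.mem_Iio]
      constructor
      · intro hv
        have h1 : v < i + 1 := hY.1 hv
        have h2 : v ≠ i := fun e => h (e ▸ hv)
        exact ⟨hv, by omega⟩
      · exact And.left
  -- If both values are possible, row `k` takes the value 1 and a new row `m` the value 0; otherwise
  -- row `k` takes the only possible value.
  rcases hcase with ⟨h1, h2, m, hmP, hmk, rfl, h3, h4⟩ | ⟨h1, h2, rfl, h3⟩ | ⟨h1, h2, rfl, h3⟩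
  · have b1 := hP'.insert (a := k) (by rw [h3]; exact hnew hti)
    have b2 := b1.insert (a := m) (by
      rw [h3, h4, Set.mem_insert_iff, not_or]
      exact ⟨fun e => hik (e ▸ Set.mem_insert _ _), hnew htk⟩)
    convert b2 using 1
    ext Y
    rw [h3, h4, Set.mem_insert_iff, Set.mem_insert_iff]
    constructor
    · rintro ⟨hY, h⟩
      rcases hex.1 h with h | h
      · exact Or.inr (Or.inr ⟨hY, h⟩)
      · rcases htwo hY h with h | h
        · exact Or.inr (Or.inl h)
        · exact Or.inl h
    · rintro (rfl | rfl | ⟨hY, h⟩)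
      · exact ⟨hmem2.2 h2, hex.2 (Or.inr htk)⟩
      · exact ⟨hmem1.2 h1, hex.2 (Or.inr hti)⟩
      · exact ⟨hY, hex.2 (Or.inl h)⟩
  · have b1 := hP'.insert (a := k) (by rw [h3]; exact hnew hti)
    convert b1 using 1
    ext Y
    rw [h3, Set.mem_insert_iff]
    constructor
    · rintro ⟨hY, h⟩
      rcases hex.1 h with h | h
      · exact Or.inr ⟨hY, h⟩
      · rcases htwo hY h with h | rfl
        · exact Or.inl h
        · exact (h2 (hmem2.1 hY)).elim
    · rintro (rfl | ⟨hY, h⟩)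
      · exact ⟨hmem1.2 h1, hex.2 (Or.inr hti)⟩
      · exact ⟨hY, hex.2 (Or.inl h)⟩
  · have b1 := hP'.insert (a := k) (by rw [h3]; exact hnew htk)
    convert b1 using 1
    ext Y
    rw [h3, Set.mem_insert_iff]
    constructor
    · rintro ⟨hY, h⟩
      rcases hex.1 h with h | h
      · exact Or.inr ⟨hY, h⟩
      · rcases htwo hY h with rfl | h
        · exact (h1 (hmem1.1 hY)).elim
        · exact Or.inl h
    · rintro (rfl | ⟨hY, h⟩)
      · exact ⟨hmem2.2 h2, hex.2 (Or.inr htk)⟩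
      · exact ⟨hY, hex.2 (Or.inl h)⟩

end TwoSat

/-! ### Programs enumerating the solutions of a closed 2-SAT instance -/

namespace HalvingProgram

open TwoSat

/-- Decides which values of the variable in register `6` can be added to the row in register `7`;
the answers for the values `1` and `0` are put into the registers `8` and `9`. -/
def check : Program :=
  .seq (.setReg 8 (.neg (.entry 2 4 (.reg 6) (.add (.reg 0) (.reg 6))))) <|
  .seq (.setReg 9 (.neg (.entry 2 4 (.add (.reg 0) (.reg 6)) (.reg 6)))) <|
    .forr 10 6 <|
      .seq (.ite (.entry 9 8 (.reg 7) (.reg 10)) (.setReg 14 (.reg 10))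
        (.setReg 14 (.add (.reg 0) (.reg 10)))) <|
      .seq (.when (.entry 2 4 (.reg 14) (.add (.reg 0) (.reg 6))) (.setReg 8 (.lit 0)))
        (.when (.entry 2 4 (.reg 14) (.reg 6)) (.setReg 9 (.lit 0)))

/-- Appends a copy of the row in register `7`, with the value `0` of the variable in
register `6`. -/
def append : Program :=
  .seq (.setArr 8 (.add (.reg 21) (.lit 1)) (.add (.get 8 (.reg 21)) (.reg 0))) <|
  .seq (.forr 10 6 (.setArr 9 (.add (.get 8 (.reg 21)) (.reg 10))
    (.entry 9 8 (.reg 7) (.reg 10)))) <|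
  .seq (.setArr 9 (.add (.get 8 (.reg 21)) (.reg 6)) (.lit 0))
    (.setReg 21 (.add (.reg 21) (.lit 1)))

/-- Extends the row in register `7` by the variable in register `6` in all consistent ways. -/
def extend : Program :=
  .seq check <| .ite (.reg 8)
    (.seq (.when (.reg 9) append) (.setArr 9 (.add (.get 8 (.reg 7)) (.reg 6)) (.lit 1)))
    (.setArr 9 (.add (.get 8 (.reg 7)) (.reg 6)) (.lit 0))

/-- Appends all consistent assignments to the list of rows. -/
def enumerate : Program :=
  .seq (.setReg 5 (.reg 21)) <|
  .seq (.setArr 8 (.add (.reg 21) (.lit 1)) (.add (.get 8 (.reg 21)) (.reg 0))) <|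
  .seq (.setReg 21 (.add (.reg 21) (.lit 1))) <|
    .forr 6 0 <| .seq (.setReg 20 (.reg 21)) <|
      .forr 7 20 (.when (.neg (.less (.reg 7) (.reg 5))) extend)

/-- The part of the row `r` on the first `i` variables. -/
def pre (n : ℕ) (s : Store) (i r : ℕ) : Set ℕ := {v | v < i ∧ s.ent 9 n r v}

/-- The part of the store used by the enumeration, for the implications `T`. -/
structure Env (n : ℕ) (T : ℕ → ℕ → Prop) (s : Store) : Prop where
  size : s.reg 0 = n
  row : ∀ k < 2 * n, s.arr 4 k = k * (2 * n)
  imp : ∀ x < 2 * n, ∀ y < 2 * n, (s.ent 2 (2 * n) x y ↔ T x y)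
  offset : ∀ k ≤ s.reg 21, s.arr 8 k = k * n

variable {n : ℕ} {T : ℕ → ℕ → Prop} {s : Store} {N M : ℕ}

theorem Env.eval_imp (h : Env n T s) {x y : Expr} (hx : x.eval s < 2 * n) (hy : y.eval s < 2 * n) :
    (Expr.entry 2 4 x y).eval s ≠ 0 ↔ T (x.eval s) (y.eval s) := by
  rw [← h.imp _ hx _ hy, Expr.eval_entry, h.row _ hx]
  rfl

theorem Env.eval_row (h : Env n T s) {x y : Expr} (hx : x.eval s ≤ s.reg 21) :
    (Expr.entry 9 8 x y).eval s ≠ 0 ↔ s.ent 9 n (x.eval s) (y.eval s) := by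
  rw [Expr.eval_entry, h.offset _ hx]
  rfl

theorem Env.frame {s' : Store} {c : Program} (h : Env n T s) (hF : Frame c s s')
    (h0 : 0 ∉ c.wr ∧ 21 ∉ c.wr) (ha : 2 ∉ c.wa ∧ 4 ∉ c.wa ∧ 8 ∉ c.wa) : Env n T s' :=
  ⟨by rw [hF.reg 0 h0.1, h.size], by rw [hF.arr 4 ha.2.1]; exact h.row,
    by unfold Store.ent; rw [hF.arr 2 ha.1]; exact h.imp,
    by rw [hF.arr 8 ha.2.2, hF.reg 21 h0.2]; exact h.offset⟩

theorem runs_check (hE : Env n T s) {i k : ℕ} (hi : i < n) (hn : n ≤ N) (h6 : s.reg 6 = i)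
    (h7 : s.reg 7 = k) (hk : k < s.reg 21) :
    Runs N M check s fun s' => (s'.reg 8 ≠ 0 ↔ Addable n T i (pre n s i k) i) ∧
      (s'.reg 9 ≠ 0 ↔ Addable n T i (pre n s i k) (n + i)) := by
  have h1 : (Expr.entry 2 4 (.reg 6) (.add (.reg 0) (.reg 6))).eval s ≠ 0 ↔ T i (n + i) := by
    rw [hE.eval_imp (by simp [h6]; omega) (by simp [h6, hE.size]; omega)]
    simp [h6, hE.size]
  refine .seq (.setReg (.seq (.setReg ?_)))
  set s₁ := s.setReg 8 ((Expr.neg (.entry 2 4 (.reg 6) (.add (.reg 0) (.reg 6)))).eval s) with hs1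
  have hE1 : Env n T s₁ := ⟨by simp [hs1, hE.size], hE.row, hE.imp, by simpa [hs1] using hE.offset⟩
  have h2 : (Expr.entry 2 4 (.add (.reg 0) (.reg 6)) (.reg 6)).eval s₁ ≠ 0 ↔ T (n + i) i := by
    rw [hE1.eval_imp (by simp [hs1, h6, hE.size]; omega) (by simp [hs1, h6]; omega)]
    simp [hs1, h6, hE.size]
  set s₂ := s₁.setReg 9 ((Expr.neg (.entry 2 4 (.add (.reg 0) (.reg 6)) (.reg 6))).eval s₁) with hs2
  have hE2 : Env n T s₂ :=
    ⟨by simp [hs2, hE1.size], hE1.row, hE1.imp, by simpa [hs2] using hE1.offset⟩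
  have r6 : s₂.reg 6 = i := by simp [hs2, hs1, h6]
  have r7 : s₂.reg 7 = k := by simp [hs2, hs1, h7]
  have r21 : s₂.reg 21 = s.reg 21 := by simp [hs2, hs1]
  have r8 : s₂.reg 8 ≠ 0 ↔ ¬ T i (n + i) := by
    rw [← h1]
    simp only [hs2, hs1, Store.setReg_reg, if_true, ne_eq, not_not]
    simp
  have r9 : s₂.reg 9 ≠ 0 ↔ ¬ T (n + i) i := by
    rw [← h2]
    simp only [hs2, Store.setReg_reg, if_true, ne_eq, Expr.eval_neg, not_not]
  have harr : s₂.arr = s.arr := rfl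
  refine .forr (fun m s₃ =>
    (s₃.reg 8 ≠ 0 ↔ ¬ T i (n + i) ∧ ∀ j < m, ¬ T (lit n (pre n s i k) j) (n + i)) ∧
    (s₃.reg 9 ≠ 0 ↔ ¬ T (n + i) i ∧ ∀ j < m, ¬ T (lit n (pre n s i k) j) i))
    (by simp) (by simp) (by simp) (by simp [r6]; omega) (by simpa using ⟨r8, r9⟩) ?_ ?_
  · intro j s₃ hj hF h10 ⟨h8, h9⟩
    rw [r6] at hj
    have hE3 : Env n T s₃ := hE2.frame hF (by simp) (by simp)
    have q6 : s₃.reg 6 = i := by rw [hF.reg 6 (by simp), r6]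
    have q7 : s₃.reg 7 = k := by rw [hF.reg 7 (by simp), r7]
    have q21 : s₃.reg 21 = s.reg 21 := by rw [hF.reg 21 (by simp), r21]
    have hrow : (Expr.entry 9 8 (.reg 7) (.reg 10)).eval s₃ ≠ 0 ↔ j ∈ pre n s i k := by
      rw [hE3.eval_row (by simp only [Expr.eval, q7, q21]; omega)]
      simp only [Expr.eval, q7, h10, pre, Set.mem_ofPred_eq, hj, true_and, Store.ent,
        hF.arr 9 (by simp), harr]
    set l := lit n (pre n s i k) j with hl
    have hl2 : l < 2 * n := lit_lt (by omega)
    suffices h : Runs N M (.seq (.when (.entry 2 4 (.reg 14) (.add (.reg 0) (.reg 6)))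
        (.setReg 8 (.lit 0))) (.when (.entry 2 4 (.reg 14) (.reg 6)) (.setReg 9 (.lit 0))))
        (s₃.setReg 14 l) fun s₄ =>
        (s₄.reg 8 ≠ 0 ↔ s₃.reg 8 ≠ 0 ∧ ¬ T l (n + i)) ∧ (s₄.reg 9 ≠ 0 ↔ s₃.reg 9 ≠ 0 ∧ ¬ T l i) by
      have h' := h.mono (Q := fun s₄ =>
        ((s₄.setReg 10 (j + 1)).reg 8 ≠ 0 ↔
          ¬ T i (n + i) ∧ ∀ j' < j + 1, ¬ T (lit n (pre n s i k) j') (n + i)) ∧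
        ((s₄.setReg 10 (j + 1)).reg 9 ≠ 0 ↔
          ¬ T (n + i) i ∧ ∀ j' < j + 1, ¬ T (lit n (pre n s i k) j') i)) (by
        rintro s₄ - ⟨g1, g2⟩
        simp only [Store.setReg_reg, Nat.reduceEqDiff, if_false, g1, g2, h8, h9, and_assoc,
          Nat.forall_lt_succ_right, ← hl, and_self])
      refine .seq (.ite (fun hc => .setReg ?_) fun hc => .setReg ?_)
      · have : l = j := by simp [hl, lit, hrow.1 hc]
        rw [this] at h'
        simpa only [Expr.eval, h10] using h'
      · have : l = n + j := by simp [hl, lit, mt hrow.2 (not_not.2 hc)]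
        rw [this] at h'
        simpa only [Expr.eval, h10, hE3.size] using h'
    have hE4 : Env n T (s₃.setReg 14 l) :=
      ⟨by simp [hE3.size], hE3.row, hE3.imp, by simpa using hE3.offset⟩
    have c1 : (Expr.entry 2 4 (.reg 14) (.add (.reg 0) (.reg 6))).eval (s₃.setReg 14 l) ≠ 0 ↔
        T l (n + i) := by
      rw [hE4.eval_imp (by simpa using hl2) (by simp [q6, hE3.size]; omega)]
      simp [q6, hE3.size]
    have hc2 : ∀ s₄ : Store, Env n T s₄ → s₄.reg 14 = l → s₄.reg 6 = i →
        ((Expr.entry 2 4 (.reg 14) (.reg 6)).eval s₄ ≠ 0 ↔ T l i) := by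
      intro s₄ hE4 g1 g2
      rw [hE4.eval_imp (by simpa [g1] using hl2) (by simp [g2]; omega)]
      simp [g1, g2]
    refine .seq (.when (fun hc => .setReg ?_) fun hc => ?_)
    · have hE5 : Env n T ((s₃.setReg 14 l).setReg 8 0) :=
        ⟨by simp [hE3.size], hE3.row, hE3.imp, by simpa using hE3.offset⟩
      have c2 := hc2 _ hE5 (by simp) (by simp [q6])
      have hT := c1.1 hc
      refine .when (fun hc => .setReg ?_) fun hc => ?_
      · have := c2.1 hc
        simp [hT, this]
      · have : ¬ T l i := fun h => c2.2 h hc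
        simp [hT, this]
    · have c2 := hc2 _ hE4 (by simp) (by simp [q6])
      have hT : ¬ T l (n + i) := fun h => c1.2 h hc
      refine .when (fun hc => .setReg ?_) fun hc => ?_
      · have := c2.1 hc
        simp [hT, this]
      · have : ¬ T l i := fun h => c2.2 h hc
        simp [hT, this]
  · rintro s₃ - ⟨h8, h9⟩
    rw [r6] at h8 h9
    rw [h8, h9, Addable, Addable, neg_of_lt hi, neg_add]
    exact ⟨Iff.rfl, Iff.rfl⟩

end HalvingProgram

namespace HalvingProgram

open TwoSat

variable {n : ℕ} {T : ℕ → ℕ → Prop} {s : Store} {N M : ℕ}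

theorem ent_setArr_of_ne {a b r v r' v' c : ℕ} (hv : v < n) (hv' : v' < n)
    (h : ¬ (a = b ∧ r' = r ∧ v' = v)) :
    (s.setArr a (r * n + v) c).ent b n r' v' ↔ s.ent b n r' v' := by
  simp only [Store.ent, Store.setArr_arr, mul_add_inj hv' hv]
  rw [if_neg fun h' => h ⟨h'.1.symm, h'.2⟩]

theorem ent_setArr_self {a r v c : ℕ} : (s.setArr a (r * n + v) c).ent a n r v ↔ c ≠ 0 := by
  simp [Store.ent]

theorem Env.setArr (hE : Env n T s) (p c : ℕ) : Env n T (s.setArr 9 p c) :=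
  ⟨hE.size, by simpa using hE.row, by simpa [Store.ent] using hE.imp, by simpa using hE.offset⟩

theorem Env.setReg (hE : Env n T s) {x c : ℕ} (h0 : x ≠ 0) (h21 : x ≠ 21) : Env n T (s.setReg x c) :=
  ⟨by simp [h0.symm, hE.size], hE.row, hE.imp, by simpa [h21.symm] using hE.offset⟩

theorem runs_append (hE : Env n T s) {i k : ℕ} (hi : i < n) (hn : n ≤ N) (h6 : s.reg 6 = i)
    (h7 : s.reg 7 = k) (hk : k < s.reg 21) :
    Runs N M append s fun s' => Env n T s' ∧ s'.reg 21 = s.reg 21 + 1 ∧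
      (∀ r < s.reg 21, ∀ v < n, (s'.ent 9 n r v ↔ s.ent 9 n r v)) ∧
      (∀ v < i, (s'.ent 9 n (s.reg 21) v ↔ s.ent 9 n k v)) ∧ ¬ s'.ent 9 n (s.reg 21) i := by
  set m := s.reg 21 with hm
  refine .seq (.setArr ?_)
  -- Offsets are kept for one index beyond the last row, so the address of the row to be appended is
  -- always known; appending must therefore supply the offset after that.
  have hoff : ∀ j, j ≤ m + 1 →
      (if j = m + 1 then (Expr.add (.get 8 (.reg 21)) (.reg 0)).eval s else s.arr 8 j) = j * n := by
    intro j hj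
    split_ifs with h
    · simp only [Expr.eval, ← hm, hE.offset m le_rfl, hE.size, h, Nat.succ_mul]
    · exact hE.offset j (by omega)
  set s₁ := s.setArr 8 ((Expr.add (.reg 21) (.lit 1)).eval s)
    ((Expr.add (.get 8 (.reg 21)) (.reg 0)).eval s) with hs1
  have hoff1 : ∀ j ≤ m + 1, s₁.arr 8 j = j * n := by
    intro j hj
    rw [← hoff j hj, hs1, Store.setArr_arr]
    simp only [true_and, Expr.eval, ← hm]
  have hE1 : Env n T s₁ := ⟨hE.size, by simpa [hs1] using hE.row, by
    simpa [hs1, Store.ent] using hE.imp, fun j hj => hoff1 j (hj.trans (Nat.le_succ _))⟩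
  have hreg1 : s₁.reg = s.reg := rfl
  have h91 : ∀ r v, s₁.ent 9 n r v ↔ s.ent 9 n r v := by simp [hs1, Store.ent]
  refine .seq (.forr (fun j s₂ => (∀ r < m, ∀ v < n, (s₂.ent 9 n r v ↔ s₁.ent 9 n r v)) ∧
    ∀ v < j, (s₂.ent 9 n m v ↔ s₁.ent 9 n k v)) (by simp) (by simp) (by simp)
    (by simp [hreg1, h6]; omega) (by simp) ?_ ?_)
  · rintro j s₂ hj hF h10 ⟨g1, g2⟩
    rw [hreg1, h6] at hj
    have hE2 : Env n T s₂ := ⟨by rw [hF.reg 0 (by simp), hE1.size],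
      by rw [hF.arr 4 (by simp)]; exact hE1.row,
      by unfold Store.ent; rw [hF.arr 2 (by simp)]; exact hE1.imp,
      by rw [hF.arr 8 (by simp), hF.reg 21 (by simp)]; exact hE1.offset⟩
    have r7 : s₂.reg 7 = k := by rw [hF.reg 7 (by simp), hreg1, h7]
    have r21 : s₂.reg 21 = m := by rw [hF.reg 21 (by simp), hreg1]
    have hread : (Expr.entry 9 8 (.reg 7) (.reg 10)).eval s₂ ≠ 0 ↔ s₁.ent 9 n k j := by
      rw [hE2.eval_row (by simp only [Expr.eval, r7, r21]; omega)]
      simp only [Expr.eval, r7, h10]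
      exact g1 k hk j (by omega)
    refine .setArr ?_
    have haddr : (Expr.add (.get 8 (.reg 21)) (.reg 10)).eval s₂ = m * n + j := by
      simp only [Expr.eval, r21, h10, hE2.offset m r21.ge]
    rw [haddr]
    simp only [Store.ent_setReg]
    refine ⟨fun r hr v hv => ?_, fun v hv => ?_⟩
    · rw [ent_setArr_of_ne (by omega) hv (by omega), g1 r hr v hv]
    · rcases Nat.lt_succ_iff_lt_or_eq.1 hv with hv | rfl
      · rw [ent_setArr_of_ne (by omega) (by omega) (by omega), g2 v hv]
      · rw [ent_setArr_self, hread]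
  · rintro s₂ hF ⟨g1, g2⟩
    rw [hreg1, h6] at g2
    have r6 : s₂.reg 6 = i := by rw [hF.reg 6 (by simp), hreg1, h6]
    have r21 : s₂.reg 21 = m := by rw [hF.reg 21 (by simp), hreg1]
    have hoff2 : ∀ j ≤ m + 1, s₂.arr 8 j = j * n := by rw [hF.arr 8 (by simp)]; exact hoff1
    refine .seq (.setArr (.setReg ?_))
    have haddr : (Expr.add (.get 8 (.reg 21)) (.reg 6)).eval s₂ = m * n + i := by
      simp only [Expr.eval, r21, r6, hoff2 m (Nat.le_succ m)]
    rw [haddr]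
    simp only [Store.ent_setReg]
    refine ⟨⟨?_, ?_, ?_, ?_⟩, by simp [r21], fun r hr v hv => ?_, fun v hv => ?_, ?_⟩
    · simp [hF.reg 0 (by simp), hreg1, hE.size]
    · simpa [hF.arr 4 (by simp)] using hE1.row
    · simpa [Store.ent, hF.arr 2 (by simp)] using hE1.imp
    · simpa [r21] using hoff2
    · rw [ent_setArr_of_ne hi hv (by omega), g1 r hr v hv, h91]
    · rw [ent_setArr_of_ne hi (by omega) (by omega), g2 v hv, h91]
    · rw [ent_setArr_self]
      simp

theorem runs_extend (hT : Closed n T) (hE : Env n T s) {i k : ℕ} (hi : i < n) (hn : n ≤ N)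
    (h6 : s.reg 6 = i) (h7 : s.reg 7 = k) (hk : k < s.reg 21)
    (hc : Consistent n T i (pre n s i k)) :
    Runs N M extend s fun s' => Env n T s' ∧
      (∀ r < s.reg 21, r ≠ k → ∀ v < n, (s'.ent 9 n r v ↔ s.ent 9 n r v)) ∧
      (∀ v < i, (s'.ent 9 n k v ↔ s.ent 9 n k v)) ∧
      ((Addable n T i (pre n s i k) i ∧ Addable n T i (pre n s i k) (n + i) ∧
          s'.reg 21 = s.reg 21 + 1 ∧ s'.ent 9 n k i ∧
          (∀ v < i, (s'.ent 9 n (s.reg 21) v ↔ s.ent 9 n k v)) ∧ ¬ s'.ent 9 n (s.reg 21) i) ∨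
        (Addable n T i (pre n s i k) i ∧ ¬ Addable n T i (pre n s i k) (n + i) ∧
          s'.reg 21 = s.reg 21 ∧ s'.ent 9 n k i) ∨
        (¬ Addable n T i (pre n s i k) i ∧ Addable n T i (pre n s i k) (n + i) ∧
          s'.reg 21 = s.reg 21 ∧ ¬ s'.ent 9 n k i)) := by
  refine .seq ((runs_check hE hi hn h6 h7 hk).mono ?_)
  rintro s₁ hF ⟨h8, h9⟩
  have hE1 : Env n T s₁ := hE.frame hF (by simp [check]) (by simp [check])
  have r6 : s₁.reg 6 = i := by rw [hF.reg 6 (by simp [check]), h6]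
  have r7 : s₁.reg 7 = k := by rw [hF.reg 7 (by simp [check]), h7]
  have r21 : s₁.reg 21 = s.reg 21 := by rw [hF.reg 21 (by simp [check])]
  have h91 : ∀ r v, s₁.ent 9 n r v ↔ s.ent 9 n r v := by
    intro r v
    rw [Store.ent, hF.arr 9 (by simp [check])]
    rfl
  refine .ite (fun c8 => ?_) fun c8 => ?_
  · have a1 := h8.1 c8
    suffices h : ∀ s₂, Env n T s₂ → s₂.reg 6 = i → s₂.reg 7 = k → s.reg 21 ≤ s₂.reg 21 →
        (∀ r < s.reg 21, ∀ v < n, (s₂.ent 9 n r v ↔ s.ent 9 n r v)) →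
        ((Addable n T i (pre n s i k) (n + i) ∧ s₂.reg 21 = s.reg 21 + 1 ∧
          (∀ v < i, (s₂.ent 9 n (s.reg 21) v ↔ s.ent 9 n k v)) ∧ ¬ s₂.ent 9 n (s.reg 21) i) ∨
        (¬ Addable n T i (pre n s i k) (n + i) ∧ s₂.reg 21 = s.reg 21)) →
        Runs N M (.setArr 9 (.add (.get 8 (.reg 7)) (.reg 6)) (.lit 1)) s₂ _ by
      refine .seq (.when (fun c9 => ?_) fun c9 => ?_)
      · refine (runs_append hE1 hi hn r6 r7 (by omega)).mono ?_
        rintro s₂ hF2 ⟨g1, g2, g3, g4, g5⟩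
        rw [r21] at g2 g3 g4 g5
        refine h s₂ g1 ?_ ?_ (by omega) (fun r hr v hv => (g3 r hr v hv).trans (h91 r v))
          (Or.inl ⟨h9.1 c9, g2, fun v hv => (g4 v hv).trans (h91 k v), g5⟩)
        · rw [hF2.reg 6 (by simp [append]), r6]
        · rw [hF2.reg 7 (by simp [append]), r7]
      · exact h s₁ hE1 r6 r7 (by omega) (fun r _ v _ => h91 r v)
          (Or.inr ⟨fun h => h9.2 h c9, r21⟩)
    intro s₂ hE2 q6 q7 q21 hrow hcase
    refine .setArr ?_
    have haddr : (Expr.add (.get 8 (.reg 7)) (.reg 6)).eval s₂ = k * n + i := by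
      simp only [Expr.eval, q6, q7, hE2.offset k (by omega)]
    rw [haddr]
    refine ⟨hE2.setArr _ _, fun r hr hne v hv => ?_, fun v hv => ?_, ?_⟩
    · rw [ent_setArr_of_ne hi hv (by omega), hrow r hr v hv]
    · rw [ent_setArr_of_ne hi (by omega) (by omega), hrow k hk v (by omega)]
    · rcases hcase with ⟨b1, b2, b3, b4⟩ | ⟨b1, b2⟩
      · refine Or.inl ⟨a1, b1, b2, ent_setArr_self.2 (by simp), fun v hv => ?_, ?_⟩
        · rw [ent_setArr_of_ne hi (by omega) (by omega), b3 v hv]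
        · rwa [ent_setArr_of_ne hi hi (by omega)]
      · exact Or.inr (Or.inl ⟨a1, b1, b2, ent_setArr_self.2 (by simp)⟩)
  · have a1 : ¬ Addable n T i (pre n s i k) i := fun h => h8.2 h c8
    -- Since there are no dead ends, the value 0 is possible here without looking at its flag, and
    -- no row is ever deleted.
    have a2 := (hT.addable_or hi hc).resolve_left a1
    refine .setArr ?_
    have haddr : (Expr.add (.get 8 (.reg 7)) (.reg 6)).eval s₁ = k * n + i := by
      simp only [Expr.eval, r6, r7, hE1.offset k (by omega)]
    rw [haddr]
    refine ⟨hE1.setArr _ _, fun r hr hne v hv => ?_, fun v hv => ?_,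
      Or.inr (Or.inr ⟨a1, a2, r21, ?_⟩)⟩
    · rw [ent_setArr_of_ne hi hv (by omega), h91]
    · rw [ent_setArr_of_ne hi (by omega) (by omega), h91]
    · rw [ent_setArr_self]
      simp

theorem pre_congr {s s' : Store} {i r r' : ℕ} (h : ∀ v < i, (s'.ent 9 n r' v ↔ s.ent 9 n r v)) :
    pre n s' i r' = pre n s i r := by
  ext v
  exact and_congr_right fun hv => h v hv

theorem pre_succ_of_ent {s s' : Store} {i r r' : ℕ}
    (h : ∀ v < i, (s'.ent 9 n r' v ↔ s.ent 9 n r v)) (hi : s'.ent 9 n r' i) :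
    pre n s' (i + 1) r' = insert i (pre n s i r) := by
  ext v
  simp only [pre, Set.mem_ofPred_eq, Set.mem_insert_iff]
  constructor
  · rintro ⟨h1, h2⟩
    rcases Nat.lt_succ_iff_lt_or_eq.1 h1 with h3 | h3
    · exact Or.inr ⟨h3, (h v h3).1 h2⟩
    · exact Or.inl h3
  · rintro (rfl | ⟨h1, h2⟩)
    · exact ⟨by omega, hi⟩
    · exact ⟨by omega, (h v h1).2 h2⟩

theorem pre_succ_of_not_ent {s s' : Store} {i r r' : ℕ}
    (h : ∀ v < i, (s'.ent 9 n r' v ↔ s.ent 9 n r v)) (hi : ¬ s'.ent 9 n r' i) :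
    pre n s' (i + 1) r' = pre n s i r := by
  ext v
  simp only [pre, Set.mem_ofPred_eq]
  constructor
  · rintro ⟨h1, h2⟩
    rcases Nat.lt_succ_iff_lt_or_eq.1 h1 with h3 | rfl
    · exact ⟨h3, (h v h3).1 h2⟩
    · exact (hi h2).elim
  · rintro ⟨h1, h2⟩
    exact ⟨by omega, (h v h1).2 h2⟩

/-- One stage of the enumeration. -/
theorem runs_stage (hT : Closed n T) (hE : Env n T s) {i S₀ : ℕ} (hi : i < n) (hn : n ≤ N)
    (h6 : s.reg 6 = i) (h5 : s.reg 5 = S₀) (hS : S₀ ≤ s.reg 21)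
    (hM : S₀ + (solutions n T n).ncard ≤ M)
    (hg : Set.BijOn (pre n s i) (Set.Ico S₀ (s.reg 21)) (solutions n T i)) :
    Runs N M (.seq (.setReg 20 (.reg 21))
      (.forr 7 20 (.when (.neg (.less (.reg 7) (.reg 5))) extend))) s fun s' =>
      Env n T s' ∧ S₀ ≤ s'.reg 21 ∧
        Set.BijOn (pre n s' (i + 1)) (Set.Ico S₀ (s'.reg 21)) (solutions n T (i + 1)) ∧
        ∀ r < S₀, ∀ v < n, (s'.ent 9 n r v ↔ s.ent 9 n r v) := by
  set M₀ := s.reg 21 with hM0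
  -- The current rows above `S₀` are the partial solutions, at most as many as full solutions.
  have hcard : M₀ ≤ M := by
    have h1 := hT.ncard_solutions_le hi.le
    rw [← hg.image_eq, Set.InjOn.ncard_image hg.injOn, ← Finset.coe_Ico, Set.ncard_coe_finset,
      Nat.card_Ico] at h1
    omega
  refine .seq (.setReg ?_)
  simp only [Expr.eval, ← hM0]
  -- The loop bound is frozen at `M₀`, so rows appended during the stage are not extended twice.
  -- After `k` iterations, the rows from `S₀` to `k` and the appended ones list the extensions of
  -- the first old rows; rows below `S₀` belong to earlier cut edges.
  refine .forr (fun k s₁ => Env n T s₁ ∧ M₀ ≤ s₁.reg 21 ∧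
    (∀ r < M₀, (k ≤ r ∨ r < S₀) → ∀ v < n, (s₁.ent 9 n r v ↔ s.ent 9 n r v)) ∧
    Set.BijOn (pre n s₁ (i + 1)) (Set.Ico S₀ k ∪ Set.Ico M₀ (s₁.reg 21))
      {Y ∈ solutions n T (i + 1) | ∃ r ∈ Set.Ico S₀ k, Y ∩ Set.Iio i = pre n s i r})
    (by simp [extend, check, append]) (by simp [extend, check, append]) (by simp)
    (by simpa using hcard) ?_ ?_ ?_
  · refine ⟨(hE.setReg (by simp) (by simp)).setReg (by simp) (by simp), by simp [hM0],
      fun _ _ _ _ _ => Iff.rfl, ?_⟩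
    have h1 : Set.Ico S₀ 0 ∪ Set.Ico M₀ (((s.setReg 20 M₀).setReg 7 0).reg 21) = ∅ := by
      simp [← hM0]
    have h2 : {Y ∈ solutions n T (i + 1) | ∃ r ∈ Set.Ico S₀ 0, Y ∩ Set.Iio i = pre n s i r} = ∅ := by
      simp
    rw [h1, h2]
    exact Set.bijOn_empty _
  · rintro k s₁ hk hF r7 ⟨g1, g2, g3, g4⟩
    have hk' : k < M₀ := by simpa using hk
    have r6 : s₁.reg 6 = i := by
      rw [hF.reg 6 (by simp [extend, check, append])]
      simpa using h6
    have r5 : s₁.reg 5 = S₀ := by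
      rw [hF.reg 5 (by simp [extend, check, append])]
      simpa using h5
    refine .when (fun hc => ?_) fun hc => ?_
    · have hSk : S₀ ≤ k := by
        by_contra h
        simp only [ne_eq, Expr.eval_neg, not_not, Expr.eval_less, Expr.eval, r7, r5] at hc
        omega
      have hpre : pre n s₁ i k = pre n s i k :=
        pre_congr fun v hv => g3 k hk' (Or.inl le_rfl) v (by omega)
      have hcons : Consistent n T i (pre n s₁ i k) := by
        rw [hpre]
        exact (hg.mapsTo ⟨hSk, hk'⟩).2
      refine (runs_extend hT g1 hi hn r6 r7 (by omega) hcons).mono ?_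
      rintro s₂ - ⟨e1, e2, e3, e4⟩
      rw [hpre] at e4
      have e3' : ∀ v < i, (s₂.ent 9 n k v ↔ s.ent 9 n k v) := fun v hv =>
        (e3 v hv).trans (g3 k hk' (Or.inl le_rfl) v (by omega))
      have hle : s₁.reg 21 ≤ s₂.reg 21 := by
        rcases e4 with h | h | h <;> omega
      have heq : Set.EqOn (pre n s₁ (i + 1)) (pre n s₂ (i + 1))
          (Set.Ico S₀ k ∪ Set.Ico M₀ (s₁.reg 21)) := by
        rintro r hr
        refine (pre_congr fun v hv => e2 r ?_ ?_ v (by omega)).symm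
        · rcases hr with hr | hr
          · have := hr.2
            omega
          · exact hr.2
        · rcases hr with hr | hr
          · exact hr.2.ne
          · have := hr.1
            omega
      refine ⟨e1.setReg (by simp) (by simp), by simp; omega, fun r hr hor v hv => ?_, ?_⟩
      · have h1 : r ≠ k := by omega
        exact (e2 r (by omega) h1 v hv).trans (g3 r hr (by omega) v hv)
      · refine hT.bijOn_split hi hg ⟨hSk, hk'⟩ g4 ?_ heq ?_
        · simp
          omega
        · have hins : Set.Ico S₀ (k + 1) = insert k (Set.Ico S₀ k) := by
            ext r
            simp only [Set.mem_Ico, Set.mem_insert_iff]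
            omega
          have hreg : (s₂.setReg 7 (k + 1)).reg 21 = s₂.reg 21 := by simp
          rw [hreg, hins, Set.insert_union]
          rcases e4 with ⟨a1, a2, a3, a4, a5, a6⟩ | ⟨a1, a2, a3, a4⟩ | ⟨a1, a2, a3, a4⟩
          · refine Or.inl ⟨a1, a2, s₁.reg 21, by simp; omega, by omega, ?_,
              pre_succ_of_ent e3' a4, pre_succ_of_not_ent (fun v hv => (a5 v hv).trans
                (g3 k hk' (Or.inl le_rfl) v (by omega))) a6⟩
            rw [a3]
            ext r
            simp only [Set.mem_Ico, Set.mem_insert_iff, Set.mem_union]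
            omega
          · exact Or.inr (Or.inl ⟨a1, a2, by rw [a3], pre_succ_of_ent e3' a4⟩)
          · exact Or.inr (Or.inr ⟨a1, a2, by rw [a3], pre_succ_of_not_ent e3' a4⟩)
    · have hkS : k < S₀ := by
        by_contra h
        rw [Expr.eval_neg] at hc
        refine hc ?_
        rw [Expr.eval_less]
        simp only [Expr.eval, r5, r7]
        omega
      refine ⟨g1.setReg (by simp) (by simp), by simpa using g2, fun r hr hor v hv =>
        g3 r hr (by omega) v hv, ?_⟩
      have h1 : Set.Ico S₀ (k + 1) = Set.Ico S₀ k := by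
        ext r
        simp only [Set.mem_Ico]
        omega
      have hreg : (s₁.setReg 7 (k + 1)).reg 21 = s₁.reg 21 := by simp
      rw [h1, hreg]
      exact g4
  · rintro s₁ - ⟨g1, g2, g3, g4⟩
    have hr20 : (s.setReg 20 M₀).reg 20 = M₀ := by simp
    rw [hr20] at g3 g4
    refine ⟨g1, hS.trans g2, ?_, fun r hr v hv => g3 r (by omega) (Or.inr hr) v hv⟩
    convert g4 using 1
    · ext r
      simp only [Set.mem_Ico, Set.mem_union]
      omega
    · ext Y
      constructor
      · intro hY
        refine ⟨hY, ?_⟩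
        obtain ⟨r, hr, hr'⟩ := hg.surjOn ((hT.mem_solutions_succ hi).1 hY).2.1
        exact ⟨r, hr, hr'.symm⟩
      · exact And.left

theorem runs_enumerate (hT : Closed n T) (hE : Env n T s) (hn : n ≤ N)
    (hM : s.reg 21 + (solutions n T n).ncard ≤ M) :
    Runs N M enumerate s fun s' => s'.reg 0 = n ∧ (∀ k ≤ s'.reg 21, s'.arr 8 k = k * n) ∧
      s.reg 21 ≤ s'.reg 21 ∧
      Set.BijOn (pre n s' n) (Set.Ico (s.reg 21) (s'.reg 21)) (solutions n T n) ∧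
      ∀ r < s.reg 21, ∀ v < n, (s'.ent 9 n r v ↔ s.ent 9 n r v) := by
  set m := s.reg 21 with hm
  refine .seq (.setReg (.seq (.setArr (.seq (.setReg ?_)))))
  simp only [Expr.eval, Store.setReg_reg, Store.setArr_reg, Store.setReg_arr, ← hm]
  simp only [Nat.reduceEqDiff, if_false, hE.size, hE.offset m le_rfl, ← Nat.succ_mul]
  set s₁ := (((s.setReg 5 m).setArr 8 (m + 1) (m.succ * n)).setReg 21 (m + 1)) with hs1
  have hE1 : Env n T s₁ := by
    refine ⟨by simp [hs1, hE.size], by simpa [hs1] using hE.row,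
      by simpa [hs1, Store.ent] using hE.imp, fun k hk => ?_⟩
    have hk' : k ≤ m + 1 := by simpa [hs1] using hk
    simp only [hs1, Store.setReg_arr, Store.setArr_arr, true_and]
    split_ifs with h
    · rw [h]
    · exact hE.offset k (by omega)
  have h91 : ∀ r v, s₁.ent 9 n r v ↔ s.ent 9 n r v := by simp [hs1, Store.ent]
  refine .forr (fun i s₂ => Env n T s₂ ∧ m ≤ s₂.reg 21 ∧
    Set.BijOn (pre n s₂ i) (Set.Ico m (s₂.reg 21)) (solutions n T i) ∧
    ∀ r < m, ∀ v < n, (s₂.ent 9 n r v ↔ s₁.ent 9 n r v))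
    (by simp [extend, check, append]) (by simp [extend, check, append]) (by simp)
    (by simpa [hE1.size] using hn) ?_ ?_ ?_
  · refine ⟨hE1.setReg (by simp) (by simp), by simp [hs1], ?_, fun _ _ _ _ => Iff.rfl⟩
    have h1 : (s₁.setReg 6 0).reg 21 = m + 1 := by simp [hs1]
    have h2 : Set.Ico m (m + 1) = {m} := by
      ext r
      simp only [Set.mem_Ico, Set.mem_singleton_iff]
      omega
    -- The initial row stands for the assignment of no variables, whatever its cells contain.
    have h3 : pre n (s₁.setReg 6 0) 0 m = ∅ := by
      ext v
      simp [pre]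
    rw [h1, h2, solutions_zero, ← h3]
    exact Set.bijOn_singleton.2 rfl
  · rintro i s₂ hi hF r6 ⟨g1, g2, g3, g4⟩
    rw [hE1.size] at hi
    have r5 : s₂.reg 5 = m := by
      rw [hF.reg 5 (by simp [extend, check, append])]
      simp [hs1]
    refine (runs_stage hT g1 hi hn r6 r5 g2 hM g3).mono ?_
    rintro s₃ - ⟨e1, e2, e3, e4⟩
    refine ⟨e1.setReg (by simp) (by simp), by simpa using e2, ?_, fun r hr v hv =>
      (e4 r hr v hv).trans (g4 r hr v hv)⟩
    have hreg : (s₃.setReg 6 (i + 1)).reg 21 = s₃.reg 21 := by simp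
    rw [hreg]
    exact e3
  · rintro s₂ - ⟨g1, g2, g3, g4⟩
    rw [hE1.size] at g3
    exact ⟨g1.size, g1.offset, g2, g3, fun r hr v hv => (g4 r hr v hv).trans (h91 r v)⟩

end HalvingProgram

/-! ### Programs building the 2-SAT instance of a cut edge -/

namespace HalvingProgram

open TwoSat CutEdge

/-- Marks an entry of the matrix of forbidden pairs. -/
def mark (x y : Expr) : Program := .setArr 3 (.add (.get 4 x) y) (.lit 1)

/-- The forced vertices, for the registers `x` and `y` holding the ends of the cut edge. -/
def forcedExpr (x y : ℕ) : Expr :=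
  .add (.same (.reg 6) (.reg x)) (.conj (.entry 0 1 (.reg x) (.reg 6))
    (.conj (.neg (.same (.reg 6) (.reg y))) (.neg (.entry 0 1 (.reg y) (.reg 6)))))

/-- Computes the forced vertices on both sides. -/
def forced : Program :=
  .forr 6 0 (.seq (.setArr 6 (.reg 6) (forcedExpr 3 4)) (.setArr 7 (.reg 6) (forcedExpr 4 3)))

/-- Marks the pairs forbidden by earlier edges. -/
def markBefore : Program :=
  .forr 6 0 (.forr 7 0 (.when (.conj (.entry 0 1 (.reg 6) (.reg 7))
    (.add (.less (.reg 6) (.reg 3)) (.conj (.same (.reg 6) (.reg 3)) (.less (.reg 7) (.reg 4)))))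
    (mark (.reg 6) (.add (.reg 0) (.reg 7)))))

/-- The condition that the edges in the registers `6`, `7` and `8`, `9` are incompatible. -/
def badExpr : Expr :=
  .conj (.entry 0 1 (.reg 6) (.reg 7)) (.conj (.entry 0 1 (.reg 8) (.reg 9))
    (.add (.conj (.neg (.same (.reg 6) (.reg 8))) (.neg (.entry 0 1 (.reg 6) (.reg 8))))
      (.conj (.neg (.same (.reg 7) (.reg 9))) (.neg (.entry 0 1 (.reg 7) (.reg 9))))))

/-- Marks the pairs forbidden by two edges. -/
def markPair : Program :=
  .when badExpr <|
    .seq (.when (.conj (.get 6 (.reg 8)) (.get 7 (.reg 9)))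
      (mark (.reg 6) (.add (.reg 0) (.reg 7)))) <|
    .seq (.when (.conj (.get 7 (.reg 7)) (.get 7 (.reg 9))) (mark (.reg 6) (.reg 8))) <|
    .seq (.when (.conj (.get 6 (.reg 6)) (.get 6 (.reg 8)))
      (mark (.add (.reg 0) (.reg 7)) (.add (.reg 0) (.reg 9))))
    (.when (.conj (.get 7 (.reg 7)) (.get 6 (.reg 8)))
      (mark (.reg 6) (.add (.reg 0) (.reg 9))))

/-- Marks all forbidden pairs. -/
def forbid : Program :=
  .seq (mark (.add (.reg 0) (.reg 3)) (.add (.reg 0) (.reg 3))) <| .seq (mark (.reg 4) (.reg 4)) <|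
    .seq markBefore <| .forr 6 0 (.forr 7 0 (.forr 8 0 (.forr 9 0 markPair)))

/-- The implications given by the forbidden pairs. -/
def impExpr : Expr :=
  .add (.same (.reg 6) (.reg 7)) (.add (.entry 3 4 (.reg 6) (.get 5 (.reg 7)))
    (.entry 3 4 (.get 5 (.reg 7)) (.reg 6)))

/-- Checks satisfiability. -/
def satisfiable : Program :=
  .seq (.setReg 10 (.lit 1)) <| .forr 6 0 (.when
    (.conj (.entry 2 4 (.reg 6) (.add (.reg 0) (.reg 6)))
      (.entry 2 4 (.add (.reg 0) (.reg 6)) (.reg 6))) (.setReg 10 (.lit 0)))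

/-- Computes the closed implications for the cut edge in the registers `3` and `4`. -/
def implications : Program :=
  .seq (.fill 3 4 2 6 7 (.lit 1) (.lit 0)) <| .seq forced <| .seq forbid <|
    .seq (.fill 2 4 2 6 7 (.lit 1) impExpr) (.closure 4 2)

/-- Appends all halfspaces whose first cut edge is in the registers `3` and `4`. -/
def edge : Program :=
  .seq implications <| .seq satisfiable <| .when (.reg 10) enumerate

variable {n : ℕ} {G : SimpleGraph (Fin n)} {s : Store} {N M : ℕ}

theorem eval_add_eq_zero {e f : Expr} : (Expr.add e f).eval s = 0 ↔ e.eval s = 0 ∧ f.eval s = 0 := by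
  rw [Expr.eval, Nat.add_eq_zero_iff]

/-- The program `c` adds exactly the pairs in `P` to the forbidden pairs. -/
def Marks (n N M : ℕ) (c : Program) (s : Store) (P : ℕ → ℕ → Prop) : Prop :=
  Runs N M c s fun s' => ∀ x < 2 * n, ∀ y < 2 * n,
    (s'.ent 3 (2 * n) x y ↔ s.ent 3 (2 * n) x y ∨ P x y)

namespace Marks

variable {c d : Program} {P Q : ℕ → ℕ → Prop}

theorem congr (h : Marks n N M c s P) (hPQ : ∀ x < 2 * n, ∀ y < 2 * n, (P x y ↔ Q x y)) :
    Marks n N M c s Q :=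
  h.mono fun _ _ h' x hx y hy => by rw [h' x hx y hy, hPQ x hx y hy]

theorem seq (hc : Marks n N M c s P) (hd : ∀ s₁, Frame c s s₁ → Marks n N M d s₁ Q) :
    Marks n N M (.seq c d) s fun x y => P x y ∨ Q x y :=
  Runs.seq (hc.mono fun s₁ hF h1 => (hd s₁ hF).mono fun s₂ _ h2 x hx y hy => by
    rw [h2 x hx y hy, h1 x hx y hy, or_assoc])

theorem when {e : Expr} (h : e.eval s ≠ 0 → Marks n N M c s P) :
    Marks n N M (.when e c) s fun x y => e.eval s ≠ 0 ∧ P x y :=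
  Runs.when (fun he => (h he).mono fun s₁ _ h1 x hx y hy => by simp [h1 x hx y hy, he])
    fun he x _ y _ => by simp [he]

theorem forr {i b : ℕ} {P : ℕ → ℕ → ℕ → Prop} (hx : i ∉ c.wr) (hb : b ∉ c.wr) (hib : i ≠ b)
    (hb20 : b ≠ 20) (hN : s.reg b ≤ N)
    (h : ∀ k s₁, k < s.reg b → Frame (.forr i b c) s s₁ → s₁.reg i = k → Marks n N M c s₁ (P k)) :
    Marks n N M (.forr i b c) s fun x y => ∃ k < s.reg b, P k x y := by
  refine Runs.forr (fun m s₁ => ∀ x < 2 * n, ∀ y < 2 * n,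
    (s₁.ent 3 (2 * n) x y ↔ s.ent 3 (2 * n) x y ∨ ∃ k < m, P k x y)) hx hb hib
    (by simpa [hb20] using hN) (by simp) ?_ fun _ _ h => h
  intro k s₁ hk hF hi hI
  refine (h k s₁ hk hF hi).mono fun s₂ _ h2 x hx y hy => ?_
  rw [Store.ent_setReg, h2 x hx y hy, hI x hx y hy, Nat.exists_lt_succ_right, or_assoc]

theorem mark {x y : Expr} {k l : ℕ} (hx : x.eval s = k) (hy : y.eval s = l) (hl : l < 2 * n)
    (hr : s.arr 4 k = k * (2 * n)) :
    Marks n N M (mark x y) s fun x y => x = k ∧ y = l := by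
  refine Runs.setArr fun x' _ y' hy' => ?_
  simp only [Expr.eval, hx, hy, hr]
  exact Store.ent_setArr hl hy'

theorem when_mark {e x y : Expr} {p : Prop} {k l : ℕ} (he : e.eval s = 0 ↔ ¬ p)
    (hx : x.eval s = k) (hy : y.eval s = l) (hl : l < 2 * n) (hr : s.arr 4 k = k * (2 * n)) :
    Marks n N M (.when e (HalvingProgram.mark x y)) s fun x y => p ∧ x = k ∧ y = l :=
  (Marks.when fun _ => Marks.mark hx hy hl hr).congr fun _ _ _ _ =>
    and_congr_left fun _ => he.not.trans not_not

end Marks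

/-- The part of the store that is fixed after the preprocessing of the graph. -/
structure Base (G : SimpleGraph (Fin n)) (s : Store) : Prop extends
    toWinnow : WinnowProgram.Base G s where
  dim : s.reg 2 = 2 * n
  row2 : ∀ k < 2 * n, s.arr 4 k = k * (2 * n)
  negation : ∀ l < 2 * n, s.arr 5 l = neg n l

theorem Base.frame {s' : Store} {c : Program} (h : Base G s) (hF : Frame c s s')
    (h0 : 0 ∉ c.wr ∧ 2 ∉ c.wr) (ha : (0 ∉ c.wa ∧ 1 ∉ c.wa) ∧ 4 ∉ c.wa ∧ 5 ∉ c.wa) : Base G s' :=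
  ⟨h.toWinnow.frame hF h0.1 ha.1, by rw [hF.reg 2 h0.2, h.dim], by rw [hF.arr 4 ha.2.1]; exact h.row2,
    by rw [hF.arr 5 ha.2.2]; exact h.negation⟩

theorem Base.eval_adj (h : Base G s) {x y : Expr} (hx : x.eval s < n) (hy : y.eval s < n) :
    (Expr.entry 0 1 x y).eval s = 0 ↔ ¬ A G (x.eval s) (y.eval s) := by
  have := h.toWinnow.ent ⟨_, hx⟩ ⟨_, hy⟩
  rw [h.toWinnow.entry hx, ← not_iff_not, not_not]
  refine this.trans ⟨fun h => ⟨hx, hy, h⟩, fun h => h.2.2⟩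

/-- The store in the treatment of the cut edge from `a` to `b`. -/
structure Ctx (G : SimpleGraph (Fin n)) (a b : ℕ) (s : Store) : Prop extends Base G s where
  fst : s.reg 3 = a
  snd : s.reg 4 = b

/-- The forced vertices have been computed. -/
structure Ctx' (G : SimpleGraph (Fin n)) (a b : ℕ) (s : Store) : Prop extends Ctx G a b s where
  pos : ∀ u < n, (s.arr 6 u = 0 ↔ ¬ Forced G a b u)
  neg : ∀ u < n, (s.arr 7 u = 0 ↔ ¬ Forced G b a u)

theorem Ctx'.frame {a b : ℕ} {s' : Store} {c : Program} (h : Ctx' G a b s) (hF : Frame c s s')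
    (h0 : (0 ∉ c.wr ∧ 2 ∉ c.wr) ∧ 3 ∉ c.wr ∧ 4 ∉ c.wr)
    (ha : ((0 ∉ c.wa ∧ 1 ∉ c.wa) ∧ 4 ∉ c.wa ∧ 5 ∉ c.wa) ∧ 6 ∉ c.wa ∧ 7 ∉ c.wa) :
    Ctx' G a b s' :=
  ⟨⟨h.toBase.frame hF h0.1 ha.1, by rw [hF.reg 3 h0.2.1, h.fst], by rw [hF.reg 4 h0.2.2, h.snd]⟩,
    by rw [hF.arr 6 ha.2.1]; exact h.pos, by rw [hF.arr 7 ha.2.2]; exact h.neg⟩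

theorem runs_forced {a b : ℕ} (hC : Ctx G a b s) (ha : a < n) (hb : b < n) (hn : n ≤ N) :
    Runs N M forced s (Ctx' G a b) := by
  refine .forr (fun m s₁ => ∀ u < m,
    (s₁.arr 6 u = 0 ↔ ¬ Forced G a b u) ∧ (s₁.arr 7 u = 0 ↔ ¬ Forced G b a u))
    (by simp) (by simp) (by simp) (by simpa [hC.size] using hn) (by simp) ?_ ?_
  · intro u s₁ hu hF h6 hI
    rw [hC.size] at hu
    have hval : ∀ {x y p q : ℕ} {s₂ : Store}, Base G s₂ → s₂.reg 6 = u → s₂.reg x = p →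
        s₂.reg y = q → p < n → q < n → ((forcedExpr x y).eval s₂ = 0 ↔ ¬ Forced G p q u) := by
      intro x y p q s₂ hB q6 hx hy hp hq
      have e1 := hB.eval_adj (x := .reg x) (y := .reg 6) (by simpa [hx] using hp)
        (by simpa [q6] using hu)
      have e2 := hB.eval_adj (x := .reg y) (y := .reg 6) (by simpa [hy] using hq)
        (by simpa [q6] using hu)
      simp only [forcedExpr, Forced]
      rw [Expr.eval, Nat.add_eq_zero_iff]
      simp only [Expr.eval_same, Expr.eval_conj, Expr.eval_neg, ne_eq, e1, e2]
      simp only [Expr.eval, hx, hy, q6]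
      tauto
    have hB1 : Base G s₁ := hC.toBase.frame hF (by simp) (by simp)
    have r3 : s₁.reg 3 = a := by rw [hF.reg 3 (by simp), hC.fst]
    have r4 : s₁.reg 4 = b := by rw [hF.reg 4 (by simp), hC.snd]
    refine .seq (.setArr (.setArr ?_))
    have v1 := hval hB1 h6 r3 r4 ha hb
    simp only [Expr.eval, Store.setArr_reg, h6]
    set s₂ := s₁.setArr 6 u ((forcedExpr 3 4).eval s₁) with hs2
    have hB2 : Base G s₂ := ⟨⟨hB1.size, by rw [← hB1.adj]; funext; simp [hs2],
      by simpa [hs2] using hB1.row⟩,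
      hB1.dim, by simpa [hs2] using hB1.row2, by simpa [hs2] using hB1.negation⟩
    have v2 := hval hB2 h6 r4 r3 hb ha
    intro u' hu'
    simp only [Store.setReg_arr, Store.setArr_arr, hs2, true_and, Nat.reduceEqDiff, false_and,
      if_false]
    rw [← hs2]
    by_cases h : u' = u
    · subst h
      simpa using ⟨v1, v2⟩
    · simpa [h] using hI u' (by omega)
  · intro s₁ hF h1
    rw [hC.size] at h1
    exact ⟨⟨hC.toBase.frame hF (by simp) (by simp), by rw [hF.reg 3 (by simp), hC.fst],
      by rw [hF.reg 4 (by simp), hC.snd]⟩, fun u hu => (h1 u hu).1, fun u hu => (h1 u hu).2⟩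

theorem marks_before {a b : ℕ} (hC : Ctx' G a b s) (hn : n ≤ N) :
    Marks n N M markBefore s fun x y =>
      ∃ u w, A G u w ∧ Before u w a b ∧ x = u ∧ y = n + w := by
  refine (Marks.forr (P := fun u x y => ∃ w < n, (A G u w ∧ Before u w a b) ∧ x = u ∧ y = n + w)
    (by simp [mark]) (by simp [mark]) (by simp) (by simp) (by rwa [hC.size]) ?_).congr ?_
  · intro u s₁ hu hF h6
    rw [hC.size] at hu
    have hC1 : Ctx' G a b s₁ := hC.frame hF (by simp [mark]) (by simp [mark])
    refine (Marks.forr (P := fun w x y => (A G u w ∧ Before u w a b) ∧ x = u ∧ y = n + w)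
      (by simp [mark]) (by simp [mark]) (by simp) (by simp) (by rwa [hC1.size]) ?_).congr
      (by simp [hC1.size])
    intro w s₂ hw hF2 h7
    rw [hC1.size] at hw
    have hC2 : Ctx' G a b s₂ := hC1.frame hF2 (by simp [mark]) (by simp [mark])
    have q6 : s₂.reg 6 = u := by rw [hF2.reg 6 (by simp [mark]), h6]
    refine (Marks.when (P := fun x y => x = u ∧ y = n + w) fun _ => Marks.mark (by simp [q6])
      (by simp [hC2.size, h7]) (by omega) (hC2.row2 u (by omega))).congr ?_
    intro x _ y _
    refine and_congr_left fun _ => ?_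
    have e1 := hC2.toBase.eval_adj (x := .reg 6) (y := .reg 7) (by simpa [q6] using hu)
      (by simpa [h7] using hw)
    rw [ne_eq, Expr.eval_conj, e1]
    simp only [Expr.eval, Nat.add_eq_zero_iff, Expr.eval_less, Expr.eval_conj, Expr.eval_same, q6, h7,
      hC2.fst, hC2.snd, Before]
    grind
  · intro x _ y _
    rw [hC.size]
    constructor
    · rintro ⟨u, -, w, -, h1, h2⟩
      exact ⟨u, w, h1.1, h1.2, h2⟩
    · rintro ⟨u, w, h1, h2, h3⟩
      exact ⟨u, h1.1, w, h1.2.1, ⟨h1, h2⟩, h3⟩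

theorem eval_badExpr {u w u' w' : ℕ} (hB : Base G s) (hu : u < n) (hw : w < n) (hu' : u' < n)
    (hw' : w' < n) (h6 : s.reg 6 = u) (h7 : s.reg 7 = w) (h8 : s.reg 8 = u') (h9 : s.reg 9 = w') :
    badExpr.eval s ≠ 0 ↔ A G u w ∧ A G u' w' ∧ Bad G u w u' w' := by
  have e1 := hB.eval_adj (x := .reg 6) (y := .reg 7) (by simpa [h6]) (by simpa [h7])
  have e2 := hB.eval_adj (x := .reg 8) (y := .reg 9) (by simpa [h8]) (by simpa [h9])
  have e3 := hB.eval_adj (x := .reg 6) (y := .reg 8) (by simpa [h6]) (by simpa [h8])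
  have e4 := hB.eval_adj (x := .reg 7) (y := .reg 9) (by simpa [h7]) (by simpa [h9])
  rw [badExpr, ne_eq, Expr.eval_conj, Expr.eval_conj, e1, e2, eval_add_eq_zero]
  simp only [Expr.eval_conj, Expr.eval_neg, Expr.eval_same, ne_eq, e3, e4]
  simp only [Expr.eval, h6, h7, h8, h9, Bad]
  grind

theorem marks_pair {a b u w u' w' : ℕ} (hC : Ctx' G a b s) (hu : u < n) (hw : w < n) (hu' : u' < n)
    (hw' : w' < n) (h6 : s.reg 6 = u) (h7 : s.reg 7 = w) (h8 : s.reg 8 = u') (h9 : s.reg 9 = w') :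
    Marks n N M markPair s (PairForbidden G a b u w u' w') := by
  have hframe : ∀ {x y : Expr} {e : Expr} {s₁ s₂ : Store},
      Ctx' G a b s₁ ∧ s₁.reg 6 = u ∧ s₁.reg 7 = w ∧ s₁.reg 8 = u' ∧ s₁.reg 9 = w' →
      Frame (.when e (mark x y)) s₁ s₂ →
      Ctx' G a b s₂ ∧ s₂.reg 6 = u ∧ s₂.reg 7 = w ∧ s₂.reg 8 = u' ∧ s₂.reg 9 = w' := by
    rintro x y e s₁ s₂ ⟨h1, h2, h3, h4, h5⟩ hF
    exact ⟨h1.frame hF (by simp [mark]) (by simp [mark]), by rw [hF.reg 6 (by simp [mark]), h2],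
      by rw [hF.reg 7 (by simp [mark]), h3], by rw [hF.reg 8 (by simp [mark]), h4],
      by rw [hF.reg 9 (by simp [mark]), h5]⟩
  have hbad := eval_badExpr hC.toBase hu hw hu' hw' h6 h7 h8 h9
  have hS : Ctx' G a b s ∧ s.reg 6 = u ∧ s.reg 7 = w ∧ s.reg 8 = u' ∧ s.reg 9 = w' :=
    ⟨hC, h6, h7, h8, h9⟩
  have m1 : ∀ s₁, Ctx' G a b s₁ ∧ s₁.reg 6 = u ∧ s₁.reg 7 = w ∧ s₁.reg 8 = u' ∧ s₁.reg 9 = w' →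
      Marks n N M (.when (.conj (.get 6 (.reg 8)) (.get 7 (.reg 9))) (mark (.reg 6) (.add (.reg 0) (.reg 7)))) s₁
        fun x y => (Forced G a b u' ∧ Forced G b a w') ∧ x = u ∧ y = n + w := by
    rintro s₁ ⟨hC, h6, h7, h8, h9⟩
    refine Marks.when_mark ?_ (by simp [h6]) (by simp [hC.size, h7]) (by omega) (hC.row2 _ (by omega))
    rw [Expr.eval_conj, Expr.eval, Expr.eval, Expr.eval, Expr.eval, h8, h9, hC.pos _ hu', hC.neg _ hw', not_and_or]
  have m2 : ∀ s₁, Ctx' G a b s₁ ∧ s₁.reg 6 = u ∧ s₁.reg 7 = w ∧ s₁.reg 8 = u' ∧ s₁.reg 9 = w' →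
      Marks n N M (.when (.conj (.get 7 (.reg 7)) (.get 7 (.reg 9))) (mark (.reg 6) (.reg 8))) s₁
        fun x y => (Forced G b a w ∧ Forced G b a w') ∧ x = u ∧ y = u' := by
    rintro s₁ ⟨hC, h6, h7, h8, h9⟩
    refine Marks.when_mark ?_ (by simp [h6]) (by simp [h8]) (by omega) (hC.row2 _ (by omega))
    rw [Expr.eval_conj, Expr.eval, Expr.eval, Expr.eval, Expr.eval, h7, h9, hC.neg _ hw, hC.neg _ hw', not_and_or]
  have m3 : ∀ s₁, Ctx' G a b s₁ ∧ s₁.reg 6 = u ∧ s₁.reg 7 = w ∧ s₁.reg 8 = u' ∧ s₁.reg 9 = w' →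
      Marks n N M (.when (.conj (.get 6 (.reg 6)) (.get 6 (.reg 8))) (mark (.add (.reg 0) (.reg 7)) (.add (.reg 0) (.reg 9)))) s₁
        fun x y => (Forced G a b u ∧ Forced G a b u') ∧ x = n + w ∧ y = n + w' := by
    rintro s₁ ⟨hC, h6, h7, h8, h9⟩
    refine Marks.when_mark ?_ (by simp [hC.size, h7]) (by simp [hC.size, h9]) (by omega) (hC.row2 _ (by omega))
    rw [Expr.eval_conj, Expr.eval, Expr.eval, Expr.eval, Expr.eval, h6, h8, hC.pos _ hu, hC.pos _ hu', not_and_or]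
  have m4 : ∀ s₁, Ctx' G a b s₁ ∧ s₁.reg 6 = u ∧ s₁.reg 7 = w ∧ s₁.reg 8 = u' ∧ s₁.reg 9 = w' →
      Marks n N M (.when (.conj (.get 7 (.reg 7)) (.get 6 (.reg 8))) (mark (.reg 6) (.add (.reg 0) (.reg 9)))) s₁
        fun x y => (Forced G b a w ∧ Forced G a b u') ∧ x = u ∧ y = n + w' := by
    rintro s₁ ⟨hC, h6, h7, h8, h9⟩
    refine Marks.when_mark ?_ (by simp [h6]) (by simp [hC.size, h9]) (by omega) (hC.row2 _ (by omega))
    rw [Expr.eval_conj, Expr.eval, Expr.eval, Expr.eval, Expr.eval, h7, h8, hC.neg _ hw, hC.pos _ hu', not_and_or]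
  refine (Marks.when fun _ => (m1 s hS).seq fun s₁ hF1 => (m2 s₁ (hframe hS hF1)).seq fun s₂ hF2 =>
    (m3 s₂ (hframe (hframe hS hF1) hF2)).seq fun s₃ hF3 =>
      m4 s₃ (hframe (hframe (hframe hS hF1) hF2) hF3)).congr fun x _ y _ => ?_
  simp only [hbad, PairForbidden, and_assoc]

theorem marks_forbid {a b : ℕ} (hC : Ctx' G a b s) (ha : a < n) (hb : b < n) (hn : n ≤ N) :
    Marks n N M forbid s (Forbidden G a b) := by
  have hfm : ∀ {x y : Expr} {s₁ s₂ : Store}, Ctx' G a b s₁ → Frame (mark x y) s₁ s₂ →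
      Ctx' G a b s₂ := fun h hF => h.frame hF (by simp [mark]) (by simp [mark])
  refine ((Marks.mark (k := n + a) (l := n + a) (by simp [hC.size, hC.fst])
    (by simp [hC.size, hC.fst]) (by omega) (hC.row2 _ (by omega))).seq fun s₁ hF1 =>
    (Marks.mark (k := b) (l := b) (by simp [(hfm hC hF1).snd]) (by simp [(hfm hC hF1).snd])
      (by omega) ((hfm hC hF1).row2 _ (by omega))).seq fun s₂ hF2 =>
    (marks_before (hfm (hfm hC hF1) hF2) hn).seq
      (Q := fun x y => ∃ u w u' w', PairForbidden G a b u w u' w' x y) fun s₃ hF3 => ?_).congr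
    fun x _ y _ => Iff.rfl
  have hC3 : Ctx' G a b s₃ := (hfm (hfm hC hF1) hF2).frame hF3 (by simp [markBefore, mark])
    (by simp [markBefore, mark])
  refine (Marks.forr (P := fun u x y => ∃ w < n, ∃ u' < n, ∃ w' < n,
    PairForbidden G a b u w u' w' x y) (by simp [markPair, mark]) (by simp [markPair, mark])
    (by simp) (by simp) (by rwa [hC3.size]) ?_).congr ?_
  · intro u s₄ hu hF4 h6
    rw [hC3.size] at hu
    have hC4 : Ctx' G a b s₄ := hC3.frame hF4 (by simp [markPair, mark]) (by simp [markPair, mark])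
    refine (Marks.forr (P := fun w x y => ∃ u' < n, ∃ w' < n, PairForbidden G a b u w u' w' x y)
      (by simp [markPair, mark]) (by simp [markPair, mark]) (by simp) (by simp)
      (by rwa [hC4.size]) ?_).congr (by simp [hC4.size])
    intro w s₅ hw hF5 h7
    rw [hC4.size] at hw
    have hC5 : Ctx' G a b s₅ := hC4.frame hF5 (by simp [markPair, mark]) (by simp [markPair, mark])
    refine (Marks.forr (P := fun u' x y => ∃ w' < n, PairForbidden G a b u w u' w' x y)
      (by simp [markPair, mark]) (by simp [markPair, mark]) (by simp) (by simp)
      (by rwa [hC5.size]) ?_).congr (by simp [hC5.size])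
    intro u' s₆ hu' hF6 h8
    rw [hC5.size] at hu'
    have hC6 : Ctx' G a b s₆ := hC5.frame hF6 (by simp [markPair, mark]) (by simp [markPair, mark])
    refine (Marks.forr (P := fun w' x y => PairForbidden G a b u w u' w' x y)
      (by simp [markPair, mark]) (by simp [markPair, mark]) (by simp) (by simp)
      (by rwa [hC6.size]) ?_).congr (by simp [hC6.size])
    intro w' s₇ hw' hF7 h9
    rw [hC6.size] at hw'
    have hC7 : Ctx' G a b s₇ := hC6.frame hF7 (by simp [markPair, mark]) (by simp [markPair, mark])
    have q8 : s₇.reg 8 = u' := by rw [hF7.reg 8 (by simp [markPair, mark]), h8]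
    have q7 : s₇.reg 7 = w := by
      rw [hF7.reg 7 (by simp [markPair, mark]), hF6.reg 7 (by simp [markPair, mark]), h7]
    have q6 : s₇.reg 6 = u := by
      rw [hF7.reg 6 (by simp [markPair, mark]), hF6.reg 6 (by simp [markPair, mark]),
        hF5.reg 6 (by simp [markPair, mark]), h6]
    exact marks_pair hC7 hu hw hu' hw' q6 q7 q8 h9
  · intro x _ y _
    rw [hC3.size]
    constructor
    · rintro ⟨u, -, w, -, u', -, w', -, h⟩
      exact ⟨u, w, u', w', h⟩
    · rintro ⟨u, w, u', w', h⟩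
      exact ⟨u, h.1.1, w, h.1.2.1, u', h.2.1.1, w', h.2.1.2.1, h⟩

theorem runs_implications {a b : ℕ} (hC : Ctx G a b s) (ha : a < n) (hb : b < n) (hn : 2 * n ≤ N) :
    Runs N M implications s fun s' => ∀ x < 2 * n, ∀ y < 2 * n,
      (s'.ent 2 (2 * n) x y ↔ Reach n (Forbidden G a b) x y) := by
  -- The matrix of forbidden pairs is reused for every cut edge and has to be cleared.
  refine .seq ((Runs.fill (fun _ _ c => c = 0) (by simp) (by simp) (by simp) (by simp) (by simp)
    (by rwa [hC.dim]) (by rw [hC.dim]; exact hC.row2) (by simp)).mono ?_)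
  intro s₁ hF1 h1
  rw [hC.dim] at h1
  have hC1 : Ctx G a b s₁ := ⟨hC.toBase.frame hF1 (by simp [Program.fill]) (by simp [Program.fill]),
    by rw [hF1.reg 3 (by simp [Program.fill]), hC.fst],
    by rw [hF1.reg 4 (by simp [Program.fill]), hC.snd]⟩
  refine .seq ((runs_forced hC1 ha hb (by omega)).mono ?_)
  intro s₂ hF2 hC2
  refine .seq ((marks_forbid hC2 ha hb (by omega)).mono ?_)
  intro s₃ hF3 h3
  have hB3 : Base G s₃ := hC2.toBase.frame hF3 (by simp [forbid, markBefore, markPair, mark])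
    (by simp [forbid, markBefore, markPair, mark])
  have hforb : ∀ x < 2 * n, ∀ y < 2 * n, (s₃.ent 3 (2 * n) x y ↔ Forbidden G a b x y) := by
    intro x hx y hy
    rw [h3 x hx y hy, Store.ent, hF2.arr 3 (by simp [forced]), h1 x hx y hy]
    simp
  refine .seq ((Runs.fill (fun x y c => c ≠ 0 ↔ Imp n (Forbidden G a b) x y) (by simp) (by simp)
    (by simp) (by simp) (by simp) (by rwa [hB3.dim]) (by rw [hB3.dim]; exact hB3.row2) ?_).mono ?_)
  · intro x y s₄ hx hy hF4 h6 h7 _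
    refine ⟨fun _ => ?_, fun h => by simp at h⟩
    rw [hB3.dim] at hx hy
    have hB4 : Base G s₄ := hB3.frame hF4 (by simp [Program.fill]) (by simp [Program.fill])
    have hny := neg_lt hy
    have e1 := hforb x hx _ hny
    have e2 := hforb _ hny x hx
    have q3 : s₄.arr 3 = s₃.arr 3 := hF4.arr 3 (by simp [Program.fill])
    simp only [Store.ent] at e1 e2
    rw [Imp, ← e1, ← e2, impExpr, Expr.eval, Expr.eval]
    simp only [ne_eq, Nat.add_eq_zero_iff, Expr.eval_same, Expr.eval_entry]
    simp only [Expr.eval, h6, h7, hB4.negation y hy, hB4.row2 x hx, hB4.row2 _ hny, q3]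
    tauto
  intro s₄ hF4 h4
  have hB4 : Base G s₄ := hB3.frame hF4 (by simp [Program.fill]) (by simp [Program.fill])
  rw [hB3.dim] at h4
  have hT : ∀ x < 2 * n, ∀ y < 2 * n, (s₄.ent 2 (2 * n) x y ↔ Imp n (Forbidden G a b) x y) :=
    fun x hx y hy => h4 x hx y hy
  refine (Runs.closure (by simp) (by simp) (by rwa [hB4.dim]) (by rw [hB4.dim]; exact hB4.row2)
    (by rw [hB4.dim]; exact fun x hx => (hT x hx x hx).2 (Or.inl rfl))).mono ?_
  intro s₅ _ h5 x hx y hy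
  rw [hB4.dim] at h5
  rw [h5 x hx y hy, Reach]
  have : (fun i j => i < 2 * n ∧ j < 2 * n ∧ s₄.ent 2 (2 * n) i j) =
      fun x y => x < 2 * n ∧ y < 2 * n ∧ Imp n (Forbidden G a b) x y := by
    funext i j
    exact propext (and_congr_right fun hi => and_congr_right fun hj => hT i hi j hj)
  rw [this]

theorem runs_satisfiable {T : ℕ → ℕ → Prop} (hE : Env n T s) (hn : n ≤ N) :
    Runs N M satisfiable s fun s' => s'.reg 10 ≠ 0 ↔ ∀ v < n, ¬ (T v (n + v) ∧ T (n + v) v) := by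
  refine .seq (.setReg (.forr (fun m s₁ => s₁.reg 10 ≠ 0 ↔
    ∀ v < m, ¬ (T v (n + v) ∧ T (n + v) v)) (by simp) (by simp) (by simp)
    (by simpa [hE.size] using hn) (by simp) ?_ ?_))
  · intro v s₁ hv hF h6 hI
    have hv' : v < n := by simpa [hE.size] using hv
    have hE0 : Env n T (s.setReg 10 1) := hE.setReg (by simp) (by simp)
    have hE1 : Env n T s₁ := hE0.frame hF (by simp) (by simp)
    have e1 := hE1.eval_imp (x := .reg 6) (y := .add (.reg 0) (.reg 6)) (by simp [h6]; omega)
      (by simp [h6, hE1.size]; omega)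
    have e2 := hE1.eval_imp (x := .add (.reg 0) (.reg 6)) (y := .reg 6)
      (by simp [h6, hE1.size]; omega) (by simp [h6]; omega)
    simp only [Expr.eval_entry] at e1 e2
    simp only [Expr.eval, h6, hE1.size] at e1 e2
    refine .when (fun hc => .setReg ?_) fun hc => ?_
    · simp only [ne_eq, Expr.eval_conj, Expr.eval_entry, not_or] at hc
      simp only [Expr.eval, h6, hE1.size] at hc
      simp only [Expr.eval, Store.setReg_reg, Nat.reduceEqDiff, if_false, if_true, ne_eq,
        not_true_eq_false, false_iff]
      intro h
      exact h v (by omega) ⟨e1.1 hc.1, e2.1 hc.2⟩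
    · simp only [Expr.eval_conj, Expr.eval_entry] at hc
      simp only [Expr.eval, h6, hE1.size] at hc
      simp only [Store.setReg_reg, Nat.reduceEqDiff, if_false, hI, Nat.forall_lt_succ_right]
      refine (and_iff_left ?_).symm
      rintro ⟨h1, h2⟩
      rcases hc with hc | hc
      · exact e1.2 h1 hc
      · exact e2.2 h2 hc
  · intro s₁ _ h
    have : (s.setReg 10 ((Expr.lit 1).eval s)).reg 0 = n := by simp [hE.size]
    rwa [this] at h

end HalvingProgram

/-! ### The table of all halfspaces -/

namespace HalvingProgram

open TwoSat CutEdge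

variable {n : ℕ} {G : SimpleGraph (Fin n)} {s : Store} {N M : ℕ}

/-- The halfspaces as sets of numbers. -/
def halfs (G : SimpleGraph (Fin n)) : Set (Set ℕ) :=
  {σ | σ ⊆ Set.Iio n ∧ toFin n σ ∈ mHalfspaces G}

/-- The halfspaces with first cut edge from `a` to `b`. -/
def cut (G : SimpleGraph (Fin n)) (a b : ℕ) : Set (Set ℕ) := {σ ∈ halfs G | FirstCut G a b σ}

/-- The trivial halfspaces and those with first cut edge before that from `a` to `b`. -/
def done (G : SimpleGraph (Fin n)) (a b : ℕ) : Set (Set ℕ) :=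
  {σ ∈ halfs G | toFin n σ = ∅ ∨ toFin n σ = Set.univ ∨
    ∃ a' b', A G a' b' ∧ Before a' b' a b ∧ FirstCut G a' b' σ}

theorem bijOn_toFin : Set.BijOn (toFin n) (halfs G) (mHalfspaces G) := by
  refine ⟨fun σ h => h.2, fun σ hσ τ hτ h => ?_, fun H hH => ⟨Fin.val '' H, ⟨?_, ?_⟩, ?_⟩⟩
  · ext v
    by_cases hv : v < n
    · exact Set.ext_iff.1 h ⟨v, hv⟩
    · exact iff_of_false (fun h => hv (hσ.1 h)) fun h => hv (hτ.1 h)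
  · rintro _ ⟨v, -, rfl⟩
    exact v.2
  · convert hH
    ext v
    simp [toFin, Fin.val_inj]
  · ext v
    simp [toFin, Fin.val_inj]

theorem finite_halfs : (halfs G).Finite :=
  (Set.finite_Iio n).powerset.subset fun _ h => h.1

theorem solutions_eq_cut (hG : G.Connected) {a b : ℕ} (hab : A G a b) :
    solutions n (Reach n (Forbidden G a b)) n = cut G a b := by
  ext σ
  simp only [solutions, cut, halfs, Set.mem_ofPred_eq]
  rw [consistent_iff, forbidden_iff hG hab, and_assoc]

theorem disjoint_done_cut {a b : ℕ} (hab : A G a b) : Disjoint (done G a b) (cut G a b) := by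
  rw [Set.disjoint_left]
  rintro σ ⟨-, h | h | ⟨a', b', h1, h2, h3⟩⟩ ⟨-, h'⟩
  · exact Set.eq_empty_iff_forall_notMem.1 h ⟨a, hab.1⟩ h'.1
  · exact h'.2.1 (Set.eq_univ_iff_forall.1 h ⟨b, hab.2.1⟩)
  · obtain ⟨rfl, rfl⟩ := h3.unique h1 hab h'
    unfold Before at h2
    omega

theorem done_succ {a b : ℕ} (hab : A G a b) : done G a (b + 1) = done G a b ∪ cut G a b := by
  have : ∀ a' b', Before a' b' a (b + 1) ↔ Before a' b' a b ∨ (a' = a ∧ b' = b) := by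
    intro a' b'
    unfold Before
    omega
  ext σ
  simp only [done, cut, Set.mem_union, Set.mem_ofPred_eq, this]
  constructor
  · rintro ⟨h1, h | h | ⟨a', b', h2, h3 | ⟨rfl, rfl⟩, h4⟩⟩
    · exact Or.inl ⟨h1, Or.inl h⟩
    · exact Or.inl ⟨h1, Or.inr (Or.inl h)⟩
    · exact Or.inl ⟨h1, Or.inr (Or.inr ⟨a', b', h2, h3, h4⟩)⟩
    · exact Or.inr ⟨h1, h4⟩
  · rintro (⟨h1, h | h | ⟨a', b', h2, h3, h4⟩⟩ | ⟨h1, h2⟩)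
    · exact ⟨h1, Or.inl h⟩
    · exact ⟨h1, Or.inr (Or.inl h)⟩
    · exact ⟨h1, Or.inr (Or.inr ⟨a', b', h2, Or.inl h3, h4⟩)⟩
    · exact ⟨h1, Or.inr (Or.inr ⟨a, b, hab, Or.inr ⟨rfl, rfl⟩, h2⟩)⟩

/-- Only actual edges matter, so the double loop may pass over nonadjacent pairs and from the end of
one row to the start of the next. -/
theorem done_congr {a b a' b' : ℕ}
    (h : ∀ u w, A G u w → (Before u w a b ↔ Before u w a' b')) : done G a b = done G a' b' := by
  ext σ
  refine and_congr_right fun _ => or_congr_right (or_congr_right (exists_congr fun u =>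
    exists_congr fun w => and_congr_right fun huw => and_congr_left fun _ => h u w huw))

theorem done_zero : done G 0 0 = {σ ∈ halfs G | toFin n σ = ∅ ∨ toFin n σ = Set.univ} := by
  ext σ
  simp [done, Before]

theorem done_end (hG : G.Connected) : done G n 0 = halfs G := by
  ext σ
  refine ⟨And.left, fun h => ⟨h, ?_⟩⟩
  by_cases h1 : toFin n σ = ∅
  · exact Or.inl h1
  by_cases h2 : toFin n σ = Set.univ
  · exact Or.inr (Or.inl h2)
  obtain ⟨a, b, hab, h⟩ := exists_firstCut hG h1 h2
  exact Or.inr (Or.inr ⟨a, b, hab, Or.inl hab.1, h⟩)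

/-- The rows are the members of `S`. -/
structure Table (n : ℕ) (S : Set (Set ℕ)) (s : Store) : Prop where
  offset : ∀ k ≤ s.reg 21, s.arr 8 k = k * n
  rows : Set.BijOn (pre n s n) (Set.Iio (s.reg 21)) S

theorem Table.congr {S : Set (Set ℕ)} {s' : Store} (h : Table n S s) (h21 : s'.reg 21 = s.reg 21)
    (h8 : s'.arr 8 = s.arr 8) (h9 : s'.arr 9 = s.arr 9) : Table n S s' := by
  refine ⟨by rw [h21, h8]; exact h.offset, ?_⟩
  rw [h21]
  exact h.rows.congr fun r _ => (pre_congr fun v _ => by rw [Store.ent, Store.ent, h9]).symm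

theorem Table.ncard_eq {S : Set (Set ℕ)} (h : Table n S s) : S.ncard = s.reg 21 := by
  rw [← h.rows.ncard_eq, Set.ncard_eq_toFinset_card', Set.toFinset_Iio, Nat.card_Iio]

/-- Disjointness from the halfspaces listed before keeps the correspondence between rows and
halfspaces injective, so each halfspace will have one vote. -/
theorem runs_edge (hG : G.Connected) {a b : ℕ} (hC : Ctx G a b s) (hab : A G a b) {S : Set (Set ℕ)}
    (hT : Table n S s) (hd : Disjoint S (cut G a b)) (hN : 2 * n ≤ N)
    (hM : s.reg 21 + (cut G a b).ncard ≤ M) :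
    Runs N M edge s (Table n (S ∪ cut G a b)) := by
  refine .seq ((runs_implications hC hab.1 hab.2.1 hN).mono fun s₁ hF1 h1 => ?_)
  have hE1 : Env n (Reach n (Forbidden G a b)) s₁ :=
    ⟨by rw [hF1.reg 0 (by decide), hC.size], by rw [hF1.arr 4 (by decide)]; exact hC.row2, h1,
      by rw [hF1.arr 8 (by decide), hF1.reg 21 (by decide)]; exact hT.offset⟩
  refine .seq ((runs_satisfiable hE1 (by omega)).mono fun s₂ hF2 h2 => ?_)
  have hE2 := hE1.frame hF2 (by simp [satisfiable]) (by simp [satisfiable])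
  have hT2 : Table n S s₂ :=
    (hT.congr (hF1.reg 21 (by decide)) (hF1.arr 8 (by decide)) (hF1.arr 9 (by decide))).congr
      (hF2.reg 21 (by decide)) (hF2.arr 8 (by decide)) (hF2.arr 9 (by decide))
  rw [← solutions_eq_cut hG hab] at hd hM ⊢
  refine .when (fun hc => (runs_enumerate (closed_reach (h2.1 hc)) hE2 (by omega) ?_).mono ?_)
    fun hc => ?_
  · rwa [← hT2.ncard_eq, hT.ncard_eq]
  · rintro s₃ - ⟨-, h3, h4, h5, h6⟩
    refine ⟨h3, ?_⟩
    have h7 : Set.BijOn (pre n s₃ n) (Set.Iio (s₂.reg 21)) S :=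
      hT2.rows.congr fun r hr => (pre_congr (h6 r hr)).symm
    rw [← Set.Iio_union_Ico_eq_Iio h4]
    refine h7.union h5 ((Set.injOn_union ?_).2 ⟨h7.injOn, h5.injOn, fun x hx y hy he => ?_⟩)
    · exact Set.disjoint_left.2 fun r hr hr' => absurd hr'.1 (not_le.2 hr)
    · exact Set.disjoint_left.1 hd (h7.mapsTo hx) (he ▸ h5.mapsTo hy)
  · have : solutions n (Reach n (Forbidden G a b)) n = ∅ := by
      refine Set.eq_empty_iff_forall_notMem.2 fun σ hσ => ?_
      have := mt h2.2 (not_not.2 hc)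
      push Not at this
      obtain ⟨v, hv, h⟩ := this
      exact not_consistent hv h hσ.2
    rwa [this, Set.union_empty]

/-- Computes the negations of the literals. -/
def negations : Program :=
  .forr 6 0 (.seq (.setArr 5 (.reg 6) (.add (.reg 0) (.reg 6)))
    (.setArr 5 (.add (.reg 0) (.reg 6)) (.reg 6)))

/-- Computes the part of the store that is fixed afterwards. -/
def base : Program :=
  .seq (.setReg 2 (.add (.reg 0) (.reg 0))) <| .seq (.rows 1 0 0 6) <| .seq (.rows 4 2 2 6) negations

/-- Writes the rows of the two trivial halfspaces. -/
def trivialRows : Program :=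
  .seq (.setArr 8 (.lit 1) (.reg 0)) <| .seq (.setArr 8 (.lit 2) (.reg 2)) <|
    .seq (.setReg 21 (.lit 2)) (.forr 6 0 (.setArr 9 (.add (.reg 0) (.reg 6)) (.lit 1)))

/-- The list of all halfspaces, one per row. -/
def init : Program :=
  .seq base <| .seq trivialRows <|
    .forr 3 0 (.forr 4 0 (.when (.entry 0 1 (.reg 3) (.reg 4)) edge))

theorem runs_base (hN : 2 * n ≤ N) :
    Runs N M base (inputStore G) fun s => Base G s ∧ s.arr 8 = 0 ∧ s.arr 9 = 0 := by
  have hn : (inputStore G).reg 0 = n := by simp [inputStore]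
  refine .seq (.setReg ?_)
  simp only [Expr.eval, hn, ← two_mul]
  set s₀ := (inputStore G).setReg 2 (2 * n) with hs0
  have r0 : s₀.reg 0 = n := by simp [hs0, hn]
  have r2 : s₀.reg 2 = 2 * n := by simp [hs0]
  refine .seq ((Runs.rows (by simp) (by simp) (by simp [hs0, inputStore]) (by simp)
    (by rw [r0]; omega)).mono fun s₁ hF1 h1 => ?_)
  have q0 : s₁.reg 0 = n := by rw [hF1.reg 0 (by simp [Program.rows]), r0]
  have q2 : s₁.reg 2 = 2 * n := by rw [hF1.reg 2 (by simp [Program.rows]), r2]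
  refine .seq ((Runs.rows (by simp) (by simp)
    (by simp [hF1.arr 4 (by simp [Program.rows]), hs0, inputStore]) (by simp)
    (by rwa [q2])).mono fun s₂ hF2 h2 => ?_)
  have p0 : s₂.reg 0 = n := by rw [hF2.reg 0 (by simp [Program.rows]), q0]
  have p2 : s₂.reg 2 = 2 * n := by rw [hF2.reg 2 (by simp [Program.rows]), q2]
  refine .forr (fun m s => ∀ v < m, s.arr 5 v = n + v ∧ s.arr 5 (n + v) = v) (by simp) (by simp)
    (by simp) (by simp [p0]; omega) (by simp) ?_ ?_
  · intro k s₃ hk hF3 h6 hI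
    have t0 : s₃.reg 0 = n := by rw [hF3.reg 0 (by simp), p0]
    rw [p0] at hk
    refine .seq (.setArr (.setArr fun v hv => ?_))
    simp only [Expr.eval, Store.setReg_arr, Store.setArr_arr, Store.setArr_reg, true_and, h6, t0]
    by_cases hvk : v = k
    · subst hvk
      simp
    · have h1 := hI v (by omega)
      rw [if_neg (by omega), if_neg hvk, if_neg (by omega), if_neg (by omega)]
      exact h1
  · intro s₃ hF3 h3
    rw [p0] at h3
    refine ⟨⟨⟨?_, ?_, ?_⟩, ?_, ?_, fun l hl => ?_⟩, ?_, ?_⟩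
    · rw [hF3.reg 0 (by simp), p0]
    · rw [hF3.arr 0 (by simp), hF2.arr 0 (by simp [Program.rows]),
        hF1.arr 0 (by simp [Program.rows])]
      rfl
    · rw [hF3.arr 1 (by simp), hF2.arr 1 (by simp [Program.rows])]
      intro k hk
      rw [h1 k (by rw [r0]; omega), r0]
    · rw [hF3.reg 2 (by simp), p2]
    · rw [hF3.arr 4 (by simp)]
      intro k hk
      rw [h2 k (by rw [q2]; omega), q2]
    · rw [neg]
      split_ifs with h
      · exact (h3 l h).1
      · have := (h3 (l - n) (by omega)).2
        rwa [Nat.add_sub_cancel' (by omega)] at this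
    · rw [hF3.arr 8 (by simp), hF2.arr 8 (by simp [Program.rows]),
        hF1.arr 8 (by simp [Program.rows])]
      funext
      simp [hs0, inputStore]
    · rw [hF3.arr 9 (by simp), hF2.arr 9 (by simp [Program.rows]),
        hF1.arr 9 (by simp [Program.rows])]
      funext
      simp [hs0, inputStore]

theorem runs_trivialRows (hG : G.Connected) (hB : Base G s) (h8 : s.arr 8 = 0)
    (h9 : s.arr 9 = 0) (hN : 2 * n ≤ N) :
    Runs N M trivialRows s (Table n (done G 0 0)) := by
  -- Without vertices the two trivial halfspaces would coincide and be listed twice.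
  have hpos : 0 < n := Fin.pos hG.nonempty.some
  refine .seq (.setArr (.seq (.setArr (.seq (.setReg ?_)))))
  simp only [Expr.eval, Store.setArr_reg, hB.size, hB.dim]
  set s₁ := ((s.setArr 8 1 n).setArr 8 2 (2 * n)).setReg 21 2 with hs1
  have r0 : s₁.reg 0 = n := by simp [hs1, hB.size]
  have r8 : ∀ k ≤ 2, s₁.arr 8 k = k * n := by
    intro k hk
    interval_cases k <;> simp [hs1, h8]
  refine .forr (fun m s => ∀ r < 2, ∀ v < n, (s.ent 9 n r v ↔ r = 1 ∧ v < m)) (by simp) (by simp)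
    (by simp) (by simp [r0]; omega) (by simp [hs1, Store.ent, h9]) ?_ ?_
  · intro k s₂ hk hF h6 hI
    rw [r0] at hk
    refine .setArr fun r hr v hv => ?_
    have hnk : n + k = 1 * n + k := by rw [one_mul]
    simp only [Expr.eval, h6, hF.reg 0 (by simp), r0]
    rw [Store.ent_setReg, hnk, Store.ent_setArr hk hv, hI r hr v hv]
    omega
  · intro s₂ hF h
    rw [r0] at h
    have q21 : s₂.reg 21 = 2 := by simp [hF.reg 21 (by simp), hs1]
    refine ⟨by rw [q21, hF.arr 8 (by simp)]; exact r8, ?_⟩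
    have p0 : pre n s₂ n 0 = ∅ := by
      ext v
      simp +contextual [pre, h 0]
    have p1 : pre n s₂ n 1 = Set.Iio n := by
      ext v
      simp +contextual [pre, h 1]
    have hI : Set.Iio 2 = ({0, 1} : Set ℕ) := by
      ext k
      simp
      omega
    have hS : done G 0 0 = {∅, Set.Iio n} := by
      rw [done_zero]
      have e0 : (∅ : Set ℕ) ∈ halfs G := ⟨by simp, SimpleGraph.empty_mem_mHalfspaces⟩
      have tI : toFin n (Set.Iio n) = Set.univ := by
        ext v
        simp [toFin]
      have e1 : Set.Iio n ∈ halfs G := ⟨subset_rfl, by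
        rw [tI]
        exact SimpleGraph.univ_mem_mHalfspaces⟩
      ext σ
      constructor
      · rintro ⟨h, h' | h'⟩
        · exact Or.inl (bijOn_toFin.injOn h e0 h')
        · exact Or.inr (bijOn_toFin.injOn h e1 (h'.trans tI.symm))
      · rintro (rfl | rfl)
        · exact ⟨e0, Or.inl rfl⟩
        · exact ⟨e1, Or.inr tI⟩
    have hne : Set.Iio n ≠ ∅ := Set.Nonempty.ne_empty ⟨0, hpos⟩
    rw [q21, hI, hS]
    have := (Set.injOn_pair (f := pre n s₂ n) (a := 0) (b := 1)).2 fun h => by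
      rw [p0, p1] at h
      exact (hne h.symm).elim
    simpa only [Set.image_pair, p0, p1] using this.bijOn_image

theorem runs_init (hG : G.Connected) (hN : 2 * n ≤ N) (hM : (mHalfspaces G).ncard ≤ M) :
    Runs N M init (inputStore G) fun s => Table n (halfs G) s ∧ s.arr 10 = 0 := by
  suffices Runs N M init (inputStore G) (Table n (halfs G)) from this.mono fun s hF h =>
    ⟨h, by
      rw [hF.arr 10 (by decide)]
      funext
      simp [inputStore]⟩
  refine .seq ((runs_base hN).mono fun s₁ hF1 ⟨hB1, h8, h9⟩ =>
    .seq ((runs_trivialRows hG hB1 h8 h9 hN).mono fun s₂ hF2 h2 => ?_))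
  have hB2 : Base G s₂ := hB1.frame hF2 (by decide) (by decide)
  refine .forr (fun a s => Table n (done G a 0) s) (by decide) (by decide) (by simp)
    (by simp [hB2.size]; omega) (h2.congr (by simp) rfl rfl) ?_ ?_
  · intro a s₃ ha hF3 h3 hI
    rw [hB2.size] at ha
    have hB3 : Base G s₃ := hB2.frame hF3 (by decide) (by decide)
    refine .forr (fun b s => Table n (done G a b) s) (by decide) (by decide) (by simp)
      (by simp [hB3.size]; omega) (hI.congr (by simp) rfl rfl) ?_ ?_
    · intro b s₄ hb hF4 h4 hI4
      rw [hB3.size] at hb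
      have hB4 : Base G s₄ := hB3.frame hF4 (by decide) (by decide)
      have q3 : s₄.reg 3 = a := by rw [hF4.reg 3 (by decide), h3]
      have hadj := hB4.eval_adj (x := .reg 3) (y := .reg 4) (by simpa [q3]) (by simpa [h4])
      simp only [Expr.eval, q3, h4] at hadj
      refine .when (fun hc => ?_) fun hc => ?_
      · have hab : A G a b := not_not.1 fun h => hc (hadj.2 h)
        have hd := disjoint_done_cut hab
        refine (runs_edge hG ⟨hB4, q3, h4⟩ hab hI4 hd hN ?_).mono fun s₅ _ h5 => ?_
        -- Old and new rows are disjoint families of halfspaces, so together they number at most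
        -- `M`.
        · rw [← hI4.ncard_eq, ← Set.ncard_union_eq hd (finite_halfs.subset fun _ h => h.1)
            (finite_halfs.subset fun _ h => h.1), ← done_succ hab]
          exact (Set.ncard_le_ncard (fun _ h => h.1) finite_halfs).trans
            (bijOn_toFin.ncard_eq.trans_le hM)
        · rw [done_succ hab]
          exact h5.congr (by simp) rfl rfl
      · have hab : ¬ A G a b := hadj.1 hc
        rw [done_congr (a' := a) (b' := b) fun u w huw => ?_]
        · exact hI4.congr (by simp) rfl rfl
        · have : ¬ (u = a ∧ w = b) := by
            rintro ⟨rfl, rfl⟩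
            exact hab huw
          unfold Before
          omega
    · intro s₄ _ h
      rw [hB3.size] at h
      rw [done_congr (a' := a) (b' := n) fun u w huw => ?_]
      · exact h.congr (by simp) rfl rfl
      · have := huw.2.1
        unfold Before
        omega
  · intro s₃ _ h
    rwa [hB2.size, done_end hG] at h

end HalvingProgram

/-! ### The rounds of the Halving learner -/

namespace HalvingProgram

open TwoSat CutEdge

/-- The prediction. -/
def predict : Program :=
  .seq (.setReg 3 (.reg 1)) <| .seq (.setReg 8 (.lit 0)) <| .seq (.setReg 9 (.lit 0)) <|
    .seq (.setReg 20 (.reg 21)) <|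
    .seq (.forr 7 20 (.when (.neg (.get 10 (.reg 7))) (.ite (.entry 9 8 (.reg 7) (.reg 3))
      (.setReg 8 (.add (.reg 8) (.lit 1))) (.setReg 9 (.add (.reg 9) (.lit 1)))))) <|
    .setReg 1 (.sub (.add (.reg 8) (.lit 1)) (.reg 9))

/-- The removal of the inconsistent halfspaces. -/
def update : Program :=
  .seq (.setReg 20 (.reg 21)) <| .forr 7 20 <|
    .when (.neg (.same (.neg (.entry 9 8 (.reg 7) (.reg 3))) (.neg (.reg 1))))
      (.setArr 10 (.reg 7) (.lit 1))

variable {n : ℕ} {G : SimpleGraph (Fin n)} {s : Store} {N M : ℕ} {h : List (Fin n × Bool)}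

/-- The halfspace in a row. -/
def hyp (n : ℕ) (s : Store) (k : ℕ) : Set (Fin n) := toFin n (pre n s n k)

theorem mem_hyp {k : ℕ} {v : Fin n} : v ∈ hyp n s k ↔ s.ent 9 n k v := by
  simp [hyp, toFin, pre]

/-- The invariant between the rounds. -/
structure Inv (G : SimpleGraph (Fin n)) (h : List (Fin n × Bool)) (s : Store) : Prop
    extends Table n (halfs G) s where
  alive : ∀ k < s.reg 21, (s.arr 10 k = 0 ↔ hyp n s k ∈ versionSpace (mHalfspaces G) h)

theorem Inv.congr {s' : Store} (hI : Inv G h s) (h21 : s'.reg 21 = s.reg 21)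
    (h8 : s'.arr 8 = s.arr 8) (h9 : s'.arr 9 = s.arr 9) (h10 : s'.arr 10 = s.arr 10) :
    Inv G h s' := by
  refine ⟨hI.toTable.congr h21 h8 h9, ?_⟩
  have : ∀ k, hyp n s' k = hyp n s k := fun k => by
    ext v
    rw [mem_hyp, mem_hyp, Store.ent, Store.ent, h9]
  simp only [h21, h10, this]
  exact hI.alive

theorem Inv.bijOn (hI : Inv G h s) : Set.BijOn (hyp n s) (Set.Iio (s.reg 21)) (mHalfspaces G) :=
  bijOn_toFin.comp hI.rows

theorem Inv.eval_row (hI : Inv G h s) {v : Fin n} {k : ℕ} (hk : k < s.reg 21) (h7 : s.reg 7 = k)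
    (h3 : s.reg 3 = v) : (Expr.entry 9 8 (.reg 7) (.reg 3)).eval s ≠ 0 ↔ v ∈ hyp n s k := by
  rw [mem_hyp, Expr.eval_entry, Store.ent]
  simp only [Expr.eval, h7, h3, hI.offset k hk.le]

/-- Rows and halfspaces correspond bijectively and array `10` is zero exactly on consistent ones, so
counting live rows counts votes. -/
theorem Inv.count_eq (hI : Inv G h s) (P : Set (Fin n) → Prop)
    [DecidablePred fun k => s.arr 10 k = 0 ∧ P (hyp n s k)] :
    Nat.count (fun k => s.arr 10 k = 0 ∧ P (hyp n s k)) (s.reg 21) =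
      {H ∈ versionSpace (mHalfspaces G) h | P H}.ncard := by
  rw [Nat.count_eq_card_filter_range, ← Set.ncard_coe_finset]
  refine Set.BijOn.ncard_eq (f := hyp n s) ⟨?_, ?_, ?_⟩
  · intro k hk
    simp only [Finset.coe_filter, Finset.mem_range, Set.mem_ofPred_eq] at hk
    exact ⟨(hI.alive k hk.1).1 hk.2.1, hk.2.2⟩
  · refine hI.bijOn.injOn.mono fun k hk => ?_
    simp only [Finset.coe_filter, Finset.mem_range, Set.mem_ofPred_eq] at hk
    exact hk.1
  · rintro H ⟨h1, h2⟩
    obtain ⟨k, hk, rfl⟩ := hI.bijOn.surjOn h1.1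
    refine ⟨k, ?_, rfl⟩
    simp only [Finset.coe_filter, Finset.mem_range, Set.mem_ofPred_eq]
    exact ⟨hk, (hI.alive k hk).2 h1, h2⟩

open Classical in
theorem runs_predict (hI : Inv G h s) (hM : (mHalfspaces G).ncard ≤ M) (v : Fin n) :
    Runs N M predict (s.setReg 1 v) fun s' => Inv G h s' ∧ s'.reg 3 = v ∧
      (s'.reg 1 ≠ 0 ↔ halving (mHalfspaces G) h v = true) := by
  suffices Runs N M predict (s.setReg 1 v) fun s' => s'.reg 3 = v ∧
      (s'.reg 1 ≠ 0 ↔ halving (mHalfspaces G) h v = true) from this.mono fun s' hF h' =>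
    ⟨hI.congr (by simp [hF.reg 21 (by decide)]) (hF.arr 8 (by decide)) (hF.arr 9 (by decide))
      (hF.arr 10 (by decide)), h'⟩
  refine .seq (.setReg (.seq (.setReg (.seq (.setReg (.seq (.setReg ?_)))))))
  set s₁ := ((((s.setReg 1 v).setReg 3 ((Expr.reg 1).eval (s.setReg 1 v))).setReg 8 0).setReg 9
    0).setReg 20 (s.reg 21) with hs1
  have hI1 : Inv G h s₁ := hI.congr (by simp [hs1]) rfl rfl rfl
  have h21 : s₁.reg 21 = s.reg 21 := by simp [hs1]
  have h20 : s₁.reg 20 = s.reg 21 := by simp [hs1]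
  have h3 : s₁.reg 3 = v := by simp [hs1]
  suffices Runs N M (.forr 7 20 (.when (.neg (.get 10 (.reg 7)))
      (.ite (.entry 9 8 (.reg 7) (.reg 3)) (.setReg 8 (.add (.reg 8) (.lit 1)))
        (.setReg 9 (.add (.reg 9) (.lit 1)))))) s₁ fun s' =>
      s'.reg 8 = {H ∈ versionSpace (mHalfspaces G) h | v ∈ H}.ncard ∧
      s'.reg 9 = {H ∈ versionSpace (mHalfspaces G) h | v ∉ H}.ncard by
    refine .seq (this.mono fun s₂ hF ⟨g8, g9⟩ => .setReg ?_)
    simp only [Expr.eval, Store.setReg_reg, if_true, Nat.reduceEqDiff, if_false, g8, g9, halving,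
      decide_eq_true_eq]
    -- The added one makes the truncated difference of the votes nonzero also for a tie, which must
    -- give the label 1.
    exact ⟨by rw [hF.reg 3 (by decide), h3], by omega⟩
  refine .forr (fun m s' => s'.reg 8 = Nat.count (fun k => s₁.arr 10 k = 0 ∧ v ∈ hyp n s₁ k) m ∧
    s'.reg 9 = Nat.count (fun k => s₁.arr 10 k = 0 ∧ v ∉ hyp n s₁ k) m) (by decide) (by decide)
    (by simp) ?_ (by simp [hs1]) ?_ ?_
  · rw [if_pos rfl, h20, ← hI.ncard_eq, bijOn_toFin.ncard_eq]
    exact hM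
  · intro k s₂ hk hF h7 ⟨g8, g9⟩
    rw [h20, ← h21] at hk
    have e9 : s₂.arr 9 = s₁.arr 9 := hF.arr 9 (by decide)
    have e10 : s₂.arr 10 = s₁.arr 10 := hF.arr 10 (by decide)
    have e21 : s₂.reg 21 = s₁.reg 21 := hF.reg 21 (by decide)
    have hI2 : Inv G h s₂ := hI1.congr e21 (hF.arr 8 (by decide)) e9 e10
    have hrow := hI2.eval_row (k := k) (by rwa [e21]) h7 ((hF.reg 3 (by decide)).trans h3)
    have hhyp : v ∈ hyp n s₂ k ↔ v ∈ hyp n s₁ k := by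
      rw [mem_hyp, mem_hyp, Store.ent, Store.ent, e9]
    rw [hhyp] at hrow
    simp only [Nat.count_succ, ← g8, ← g9]
    have hdead : (Expr.neg (.get 10 (.reg 7))).eval s₂ = 0 ↔ s₁.arr 10 k ≠ 0 := by
      rw [Expr.eval_neg, Expr.eval, Expr.eval, h7, e10]
    refine .when (fun hc => ?_) fun hc => ?_
    · have hd := not_not.1 fun h => hc (hdead.2 h)
      refine .ite (fun hr => .setReg ?_) fun hr => .setReg ?_
      · simp [hd, hrow.1 hr]
      · have : v ∉ hyp n s₁ k := fun h => hrow.2 h hr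
        simp [hd, this]
    · simp [hdead.1 hc]
  · intro s₂ _ ⟨g8, g9⟩
    rw [h20, ← h21, hI1.count_eq fun H => v ∈ H] at g8
    rw [h20, ← h21, hI1.count_eq fun H => v ∉ H] at g9
    exact ⟨g8, g9⟩

theorem runs_update (hI : Inv G h s) (hM : (mHalfspaces G).ncard ≤ M) {v : Fin n} (y : Bool)
    (h3 : s.reg 3 = v) : Runs N M update (s.setReg 1 y.toNat) (Inv G (h ++ [(v, y)])) := by
  suffices Runs N M update (s.setReg 1 y.toNat) fun s' => ∀ k < s.reg 21,
      (s'.arr 10 k = 0 ↔ hyp n s k ∈ versionSpace (mHalfspaces G) (h ++ [(v, y)])) by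
    refine this.mono fun s' hF h' => ?_
    have e21 : s'.reg 21 = s.reg 21 := by simp [hF.reg 21 (by decide)]
    have e9 : s'.arr 9 = s.arr 9 := hF.arr 9 (by decide)
    refine ⟨hI.toTable.congr e21 (hF.arr 8 (by decide)) e9, fun k hk => ?_⟩
    have : hyp n s' k = hyp n s k := by
      ext v
      rw [mem_hyp, mem_hyp, Store.ent, Store.ent, e9]
    rw [this]
    exact h' k (by rwa [← e21])
  refine .seq (.setReg ?_)
  set s₁ := (s.setReg 1 y.toNat).setReg 20 ((Expr.reg 21).eval (s.setReg 1 y.toNat)) with hs1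
  have hI1 : Inv G h s₁ := hI.congr (by simp [hs1]) rfl rfl rfl
  have h21 : s₁.reg 21 = s.reg 21 := by simp [hs1]
  have h20 : s₁.reg 20 = s.reg 21 := by simp [hs1]
  have h3 : s₁.reg 3 = v := by simp [hs1, h3]
  have h1 : s₁.reg 1 = y.toNat := by simp [hs1]
  -- The new example has been taken into account for the rows below `m`; dead rows stay dead.
  refine .forr (fun m s' => ∀ k < s.reg 21, (s'.arr 10 k = 0 ↔
    hyp n s k ∈ versionSpace (mHalfspaces G) h ∧ (k < m → label (hyp n s k) v = y)))
    (by decide) (by decide) (by simp) ?_ ?_ ?_ ?_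
  · rw [if_pos rfl, h20, ← hI.ncard_eq, bijOn_toFin.ncard_eq]
    exact hM
  · simpa [hs1] using hI.alive
  · intro k s₂ hk hF h7 hJ
    rw [h20] at hk
    have hrow : (Expr.entry 9 8 (.reg 7) (.reg 3)).eval s₂ ≠ 0 ↔ v ∈ hyp n s k := by
      rw [mem_hyp, Expr.eval_entry, Store.ent]
      simp only [Expr.eval, h7, hF.reg 3 (by decide), h3, hF.arr 8 (by decide),
        hF.arr 9 (by decide), hI1.offset k (by rw [h21]; omega)]
      rfl
    have hc : (Expr.neg (.same (.neg (.entry 9 8 (.reg 7) (.reg 3))) (.neg (.reg 1)))).eval s₂ = 0 ↔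
        label (hyp n s k) v = y := by
      have q1 : s₂.reg 1 = y.toNat := by rw [hF.reg 1 (by decide), h1]
      rw [Expr.eval_neg, ne_eq, Expr.eval_same, not_not, Bool.eq_iff_iff, label_eq_true, ← hrow]
      rw [Expr.neg, Expr.eval, Expr.neg, Expr.eval, Expr.eval, Expr.eval.eq_2, q1]
      cases y <;> simp <;> omega
    refine .when (fun he => .setArr fun k' hk' => ?_) fun he k' hk' => ?_
    · simp only [Expr.eval, Store.setReg_arr, Store.setArr_arr, h7, true_and]
      split_ifs with heq
      · subst heq
        have := mt hc.2 he
        simp [this]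
      · rw [hJ k' hk']
        have : k' < k + 1 ↔ k' < k := by omega
        rw [this]
    · rw [Store.setReg_arr, hJ k' hk']
      refine and_congr_right fun _ => ?_
      by_cases heq : k' = k
      · subst heq
        simp [hc.1 he]
      · have : k' < k + 1 ↔ k' < k := by omega
        rw [this]
  · intro s₂ _ hJ k hk
    rw [h20] at hJ
    rw [hJ k hk, versionSpace_append]
    exact and_congr_right fun _ => ⟨fun h => h hk, fun h _ => h⟩

/-- The learner. -/
def learner : OnlineLearner := ⟨init, predict, update⟩

/-- The loop bound is 2n because matrices over literals have that dimension, and `M + 1 ≤ 2 * M`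
removes the additive term. -/
theorem exists_time_le {c : Program} (hc : c.depth = 1) :
    ∃ p : Polynomial ℕ, ∀ n M, 1 ≤ M → c.time (2 * n) M ≤ M * p.eval n := by
  obtain ⟨p, hp⟩ := c.exists_time_le
  refine ⟨2 * p.comp (2 * Polynomial.X), fun n M hM => (hp _ M).trans ?_⟩
  rw [hc, pow_one]
  simp only [Polynomial.eval_mul, Polynomial.eval_comp, Polynomial.eval_ofNat, Polynomial.eval_X]
  rw [← mul_assoc]
  exact Nat.mul_le_mul_right _ (by omega)

end HalvingProgram

theorem exists_halving_learner : ∃ (A : OnlineLearner) (p : Polynomial ℕ),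
    ∀ (n : ℕ) (G : SimpleGraph (Fin n)), G.Connected → ∀ (H : Set (Fin n)) (vs : List (Fin n)),
      A.Plays G H ((mHalfspaces G).ncard * p.eval n) vs
        ((halving (mHalfspaces G)).predictions H [] vs) := by
  obtain ⟨p₁, h1⟩ := HalvingProgram.exists_time_le (c := HalvingProgram.init) (by rfl)
  obtain ⟨p₂, h2⟩ := HalvingProgram.exists_time_le (c := HalvingProgram.predict) (by rfl)
  obtain ⟨p₃, h3⟩ := HalvingProgram.exists_time_le (c := HalvingProgram.update) (by rfl)
  refine ⟨HalvingProgram.learner, p₁ + p₂ + p₃, fun n G hG H vs => ?_⟩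
  -- The empty set is always a halfspace, so the number of halfspaces may serve as a factor of the
  -- time bound.
  have hpos : 1 ≤ (mHalfspaces G).ncard :=
    (Set.ncard_pos (Set.toFinite _)).2 ⟨∅, SimpleGraph.empty_mem_mHalfspaces⟩
  have h1 := h1 n _ hpos
  have h2 := h2 n _ hpos
  have h3 := h3 n _ hpos
  simp only [Polynomial.eval_add, mul_add]
  obtain ⟨t, s, he, ht, hT, hs⟩ := HalvingProgram.runs_init hG le_rfl le_rfl
  refine ⟨t, s, he, by omega, OnlineLearner.rounds_of_invariant (HalvingProgram.Inv G) ?_ vs [] s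
    ⟨hT, fun k hk => ?_⟩⟩
  · intro h s v hs
    obtain ⟨t₁, s₁, e1, ht1, hI1, hv, hp⟩ := HalvingProgram.runs_predict (N := 2 * n) hs le_rfl v
    obtain ⟨t₂, s₂, e2, ht2, hI2⟩ :=
      HalvingProgram.runs_update (N := 2 * n) hI1 le_rfl (label H v) hv
    refine ⟨t₁, s₁, t₂, s₂, e1, e2, by omega, ?_, hI2⟩
    rw [Bool.eq_iff_iff, decide_eq_true_eq]
    exact hp
  · rw [hs]
    exact iff_of_true rfl ⟨(HalvingProgram.bijOn_toFin.comp hT.rows).mapsTo hk, by simp⟩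

theorem mainTheorem8 :
    -- polynomial time, by Winnow on edge-shadow features
    (∃ (A : OnlineLearner) (p : Polynomial ℕ) (C : ℝ),
      ∀ (n : ℕ) (G : SimpleGraph (Fin n)), 2 ≤ n → G.Connected →
        ∀ H ∈ mHalfspaces G, ∀ vs : List (Fin n), ∃ ys : List Bool,
          A.Plays G H (p.eval n) vs ys ∧
          ys = (shadowWinnow G).predictions H [] vs ∧
          (mistakes H vs ys : ℝ) ≤ C * ((G.cliqueNum : ℝ) * Real.log n)) ∧
    -- time linear in the number of halfspaces, by Halving
    (∃ (A : OnlineLearner) (p : Polynomial ℕ) (C : ℝ),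
      ∀ (n : ℕ) (G : SimpleGraph (Fin n)), G.Connected →
        ∀ H ∈ mHalfspaces G, ∀ vs : List (Fin n), ∃ ys : List Bool,
          A.Plays G H ((mHalfspaces G).ncard * p.eval n) vs ys ∧
          ys = (halving (mHalfspaces G)).predictions H [] vs ∧
          (mistakes H vs ys : ℝ) ≤
            C * ((G.cliqueNum : ℝ) + Real.log ((n : ℝ) / (G.cliqueNum : ℝ)))) ∧
    -- the number of halfspaces
    (∃ p : Polynomial ℕ, ∀ (n : ℕ) (G : SimpleGraph (Fin n)), G.Connected →
      (mHalfspaces G).ncard ≤ 2 ^ G.cliqueNum * p.eval n) ∧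
    -- the decomposition into edge shadows
    (∀ (n : ℕ) (G : SimpleGraph (Fin n)), 2 ≤ n → G.Connected → ∀ H ∈ mHalfspaces G,
      ∃ S : Finset G.Dart, S.card ≤ G.cliqueNum ∧
        H = (⋃ e ∈ S, mShadow G e.fst e.snd) ∧
        (H ≠ Set.univ → ∀ e ∈ S, e.fst ∈ H ∧ e.snd ∉ H)) := by
  refine ⟨?_, ?_, ⟨Polynomial.X ^ 2 + 2, fun n G hG => ?_⟩, fun n G hn hG H hH => ?_⟩
  · obtain ⟨A, p, hA⟩ := exists_winnow_learner
    exact ⟨A, p, _, fun n G hn hG H hH vs =>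
      ⟨_, hA n G H vs, rfl, shadowWinnow_mistakes_le hn hG hH vs⟩⟩
  · obtain ⟨A, p, hA⟩ := exists_halving_learner
    exact ⟨A, p, _, fun n G hG H hH vs =>
      ⟨_, hA n G hG H vs, rfl, halving_mHalfspaces_mistakes_le hG hH vs⟩⟩
  · simpa using SimpleGraph.ncard_mHalfspaces_le hG
  · have : Nontrivial (Fin n) := Fin.nontrivial_iff_two_le.2 hn
    exact SimpleGraph.exists_shadows hG hH
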